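/- Let $(\mathcal Q,\Delta)$ be a compact quantum group: $\mathcal Q$ is a unital $C^*$-algebra and $\Delta:\mathcal Q\to\mathcal Q\otimes\mathcal Q$ (minimal $C^*$-tensor product) is a unital $*$-homomorphism with $(\Delta\otimes\mathrm{id})\Delta=(\mathrm{id}\otimes\Delta)\Delta$ such that the linear spans of $\Delta(\mathcal Q)(1\otimes\mathcal Q)$ and $\Delta(\mathcal Q)(\mathcal Q\otimes 1)$ are dense in $\mathcal Q\otimes\mathcal Q$. All Hilbert spaces below are finite-dimensional. An element $V\in B(K)\otimes\mathcal Q$ is a corepresentation of $(\mathcal Q,\Delta)$ on $K$ if $(\mathrm{id}\otimes\Delta)(V)=V_{12}V_{13}$; it is called a unitary (invertible) corepresentation if moreover $V$ is unitary (invertible) in $B(K)\otimes\mathcal Q$. For $V\in B(K)\otimes\mathcal Q$ and $W\in B(L)\otimes\mathcal Q$ put $V\otimes W:=V_{13}W_{23}\in B(K\otimes L)\otimes\mathcal Q$. A right $2$-cocycle is a unitary $\Omega\in\mathcal Q\otimes\mathcal Q$ with $(\mathrm{id}\otimes\Delta)(\Omega)(1\otimes\Omega)=(\Delta\otimes\mathrm{id})(\Omega)(\Omega\otimes1)$;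 a left $2$-cocycle is a unitary $\Omega\in\mathcal Q\otimes\mathcal Q$ with $(1\otimes\Omega)(\mathrm{id}\otimes\Delta)(\Omega)=(\Omega\otimes1)(\Delta\otimes\mathrm{id})(\Omega)$. A unitary $U\in B(H)\otimes\mathcal Q$ is a right projective corepresentation if there is a right $2$-cocycle $\Omega$ with $(\mathrm{id}\otimes\Delta_\Omega)(U)=U_{12}U_{13}$, where $\Delta_\Omega(x)=\Delta(x)\Omega$; it is a left projective corepresentation if there is a left $2$-cocycle $\Omega$ with $(\mathrm{id}\otimes{}_\Omega\Delta)(U)=U_{12}U_{13}$, where ${}_\Omega\Delta(x)=\Omega\Delta(x)$; it is bi-projective if it is both left and right projective (with possibly different cocycles). Let $\bar H$ be the conjugate Hilbert space of $H$, let $j:B(H)\to B(\bar H)$ be the linear anti-multiplicative map $j(T)\bar x=\overline{T^*x}$, and for $U\in B(H)\otimes\mathcal Q$ put $U^c:=(j\otimes\mathrm{id})(U^*)\in B(\bar H)\otimes\mathcal Q$. For a positive invertible $\rho\in B(\bar H)$ put $U^c_\rho:=(\rho^{1/2}\otimes1)\,U^c\,(\rho^{-1/2}\otimes1)$. Let $H$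 be a finite-dimensional Hilbert space and let $U\in B(H)\otimes\mathcal Q$ be unitary. (a) The following are equivalent: (1) $U$ is a right projective corepresentation; (2) there is a positive invertible $\rho\in B(\bar H)$ such that $U\otimes U^c_\rho$ is a unitary corepresentation; (3) $U\otimes U^c$ is an invertible corepresentation on $H\otimes\bar H$. (b) The following are equivalent: (1) $U$ is a left projective corepresentation; (2) there is a positive invertible $\rho\in B(\bar H)$ such that $U^c_\rho\otimes U$ is a unitary corepresentation; (3) $U^c\otimes U$ is an invertible corepresentation on $\bar H\otimes H$. (c) The following are equivalent: (1) $U$ is a bi-projective corepresentation; (2) there is a positive invertible $\rho\in B(\bar H)$ such that both $U^c_\rho\otimes U$ and $U\otimes U^c_\rho$ are unitary corepresentations; (3) both $U\otimes U^c$ and $U^c\otimes U$ are invertible corepresentations. -/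

import Mathlib

open scoped TensorProduct InnerProductSpace

universe u v

noncomputable section

namespace CQG

open UniformSpace

/-! ### Commuting *-homomorphisms -/

section StarLift

variable {A B C : Type*} [Ring A] [StarRing A] [Algebra ℂ A] [StarModule ℂ A]
  [Ring B] [StarRing B] [Algebra ℂ B] [StarModule ℂ B] [Semiring C] [StarRing C] [Algebra ℂ C]

/-- The *-homomorphism `a ⊗ b ↦ f a * g b` on the algebraic tensor product, for *-homomorphisms
`f` and `g` with commuting ranges. -/
def starLift (f : A →⋆ₐ[ℂ] C) (g : B →⋆ₐ[ℂ] C) (h : ∀ a b, Commute (f a) (g b)) :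
    A ⊗[ℂ] B →⋆ₐ[ℂ] C :=
  { Algebra.TensorProduct.lift (f : A →ₐ[ℂ] C) (g : B →ₐ[ℂ] C) h with
    map_star' := fun x => by
      change Algebra.TensorProduct.lift (f : A →ₐ[ℂ] C) (g : B →ₐ[ℂ] C) h (star x) =
        star (Algebra.TensorProduct.lift (f : A →ₐ[ℂ] C) (g : B →ₐ[ℂ] C) h x)
      induction x using TensorProduct.induction_on with
      | zero => rw [star_zero, map_zero, star_zero]
      | add a b ha hb => rw [star_add, map_add, map_add, ha, hb, star_add]
      | tmul a b =>
        rw [TensorProduct.star_tmul, Algebra.TensorProduct.lift_tmul,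
          Algebra.TensorProduct.lift_tmul, star_mul]
        change f (star a) * g (star b) = star (g b) * star (f a)
        rw [map_star, map_star, ← star_mul, ← star_mul, (h a b).eq] }

theorem starLift_tmul (f : A →⋆ₐ[ℂ] C) (g : B →⋆ₐ[ℂ] C) (h : ∀ a b, Commute (f a) (g b))
    (a : A) (b : B) : starLift f g h (a ⊗ₜ b) = f a * g b := rfl

end StarLift

/-! ### Hilbert space tensor products and product representations -/

section HilbertTensor

variable {H K : Type*} [NormedAddCommGroup H] [InnerProductSpace ℂ H]
  [NormedAddCommGroup K] [InnerProductSpace ℂ K]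

/-- The Hilbert space tensor product: the completion of the algebraic tensor product. -/
def HilbertTensor (H K : Type*) [NormedAddCommGroup H] [InnerProductSpace ℂ H]
    [NormedAddCommGroup K] [InnerProductSpace ℂ K] : Type _ :=
  Completion (H ⊗[ℂ] K)

instance : NormedAddCommGroup (HilbertTensor H K) :=
  inferInstanceAs (NormedAddCommGroup (Completion (H ⊗[ℂ] K)))

instance : InnerProductSpace ℂ (HilbertTensor H K) :=
  inferInstanceAs (InnerProductSpace ℂ (Completion (H ⊗[ℂ] K)))

instance : CompleteSpace (HilbertTensor H K) :=
  inferInstanceAs (CompleteSpace (Completion (H ⊗[ℂ] K)))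

variable (H K) in
/-- The inclusion of the algebraic tensor product. -/
def toHilbertTensor : H ⊗[ℂ] K →ₗᵢ[ℂ] HilbertTensor H K :=
  (Completion.toComplₗᵢ : H ⊗[ℂ] K →ₗᵢ[ℂ] Completion (H ⊗[ℂ] K))

theorem denseRange_toHilbertTensor : DenseRange (toHilbertTensor H K) :=
  Completion.denseRange_coe

/-- The bounded operator `S ⊗ T` on the Hilbert space tensor product. -/
def opTensor (S : H →L[ℂ] H) (T : K →L[ℂ] K) : HilbertTensor H K →L[ℂ] HilbertTensor H K :=
  ((TensorProduct.mapL S T).completion :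
    Completion (H ⊗[ℂ] K) →L[ℂ] Completion (H ⊗[ℂ] K))

theorem opTensor_coe (S : H →L[ℂ] H) (T : K →L[ℂ] K) (x : H ⊗[ℂ] K) :
    opTensor S T (toHilbertTensor H K x) = toHilbertTensor H K (TensorProduct.mapL S T x) :=
  ContinuousLinearMap.completion_apply_coe _ _

theorem clm_completion_ext {F : Type*} [NormedAddCommGroup F] [NormedSpace ℂ F]
    {S T : HilbertTensor H K →L[ℂ] F}
    (h : ∀ x, S (toHilbertTensor H K x) = T (toHilbertTensor H K x)) : S = T :=
  ContinuousLinearMap.ext fun x => denseRange_toHilbertTensor.induction_on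
    (p := fun x => S x = T x) x (isClosed_eq S.continuous T.continuous) h

theorem norm_opTensor_le (S : H →L[ℂ] H) (T : K →L[ℂ] K) : ‖opTensor S T‖ ≤ ‖S‖ * ‖T‖ := by
  refine ContinuousLinearMap.opNorm_le_bound _ (by positivity) fun x => ?_
  refine denseRange_toHilbertTensor.induction_on
    (p := fun x => ‖opTensor S T x‖ ≤ ‖S‖ * ‖T‖ * ‖x‖) x
    (isClosed_le (by fun_prop) (by fun_prop)) fun a => ?_
  rw [opTensor_coe, LinearIsometry.norm_map, LinearIsometry.norm_map]
  exact (ContinuousLinearMap.le_opNorm _ _).trans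
    (mul_le_mul_of_nonneg_right (TensorProduct.norm_mapL_le S T) (norm_nonneg _))

theorem opTensor_mul (S S' : H →L[ℂ] H) (T T' : K →L[ℂ] K) :
    opTensor (S * S') (T * T') = opTensor S T * opTensor S' T' :=
  clm_completion_ext fun x => by
    rw [mul_apply_eq_comp, opTensor_coe, opTensor_coe, opTensor_coe,
      TensorProduct.mapL_mul, mul_apply_eq_comp]

theorem opTensor_one : opTensor (1 : H →L[ℂ] H) (1 : K →L[ℂ] K) = 1 :=
  clm_completion_ext fun x => by
    rw [opTensor_coe]
    exact congrArg (fun f : H ⊗[ℂ] K →L[ℂ] H ⊗[ℂ] K => toHilbertTensor H K (f x))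
      TensorProduct.mapL_id_id

theorem opTensor_add_left (S S' : H →L[ℂ] H) (T : K →L[ℂ] K) :
    opTensor (S + S') T = opTensor S T + opTensor S' T :=
  clm_completion_ext fun x => by
    rw [add_apply, opTensor_coe, opTensor_coe, opTensor_coe,
      TensorProduct.mapL_add_left, add_apply, LinearIsometry.map_add]

theorem opTensor_add_right (S : H →L[ℂ] H) (T T' : K →L[ℂ] K) :
    opTensor S (T + T') = opTensor S T + opTensor S T' :=
  clm_completion_ext fun x => by
    rw [add_apply, opTensor_coe, opTensor_coe, opTensor_coe,
      TensorProduct.mapL_add_right, add_apply, LinearIsometry.map_add]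

theorem opTensor_smul_left (c : ℂ) (S : H →L[ℂ] H) (T : K →L[ℂ] K) :
    opTensor (c • S) T = c • opTensor S T :=
  clm_completion_ext fun x => by
    rw [smul_apply, opTensor_coe, opTensor_coe,
      TensorProduct.mapL_smul_left, smul_apply, LinearIsometry.map_smul]

theorem opTensor_smul_right (c : ℂ) (S : H →L[ℂ] H) (T : K →L[ℂ] K) :
    opTensor S (c • T) = c • opTensor S T :=
  clm_completion_ext fun x => by
    rw [smul_apply, opTensor_coe, opTensor_coe,
      TensorProduct.mapL_smul_right, smul_apply, LinearIsometry.map_smul]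

theorem inner_mapL_left [CompleteSpace H] [CompleteSpace K] (S : H →L[ℂ] H) (T : K →L[ℂ] K)
    (x y : H ⊗[ℂ] K) :
    ⟪TensorProduct.mapL (star S) (star T) x, y⟫_ℂ = ⟪x, TensorProduct.mapL S T y⟫_ℂ := by
  induction x using TensorProduct.induction_on with
  | zero => simp
  | add a b ha hb => simp only [map_add, inner_add_left, ha, hb]
  | tmul a b =>
    induction y using TensorProduct.induction_on with
    | zero => simp
    | add a b ha hb => simp only [map_add, inner_add_right, ha, hb]
    | tmul c d =>
      rw [TensorProduct.mapL_tmul, TensorProduct.mapL_tmul, TensorProduct.inner_tmul,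
        TensorProduct.inner_tmul, ContinuousLinearMap.star_eq_adjoint,
        ContinuousLinearMap.star_eq_adjoint, ContinuousLinearMap.adjoint_inner_left,
        ContinuousLinearMap.adjoint_inner_left]

theorem opTensor_star [CompleteSpace H] [CompleteSpace K] (S : H →L[ℂ] H) (T : K →L[ℂ] K) :
    opTensor (star S) (star T) = star (opTensor S T) := by
  rw [ContinuousLinearMap.star_eq_adjoint (opTensor S T), ContinuousLinearMap.eq_adjoint_iff]
  intro x y
  refine denseRange_toHilbertTensor.induction_on₂
    (p := fun x y => ⟪opTensor (star S) (star T) x, y⟫_ℂ = ⟪x, opTensor S T y⟫_ℂ)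
    (isClosed_eq (by fun_prop) (by fun_prop)) (fun a b => ?_) x y
  rw [opTensor_coe, opTensor_coe, LinearIsometry.inner_map_map, LinearIsometry.inner_map_map,
    inner_mapL_left]

/-- `S ↦ S ⊗ 1`. -/
def opTensorLeft (H K : Type*) [NormedAddCommGroup H] [InnerProductSpace ℂ H]
    [NormedAddCommGroup K] [InnerProductSpace ℂ K] [CompleteSpace H] [CompleteSpace K] :
    (H →L[ℂ] H) →⋆ₐ[ℂ] (HilbertTensor H K →L[ℂ] HilbertTensor H K) where
  toFun S := opTensor S 1
  map_one' := opTensor_one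
  map_mul' S S' := by rw [← opTensor_mul, one_mul]
  map_zero' := by rw [← zero_smul ℂ (0 : H →L[ℂ] H), opTensor_smul_left, zero_smul]
  map_add' S S' := opTensor_add_left S S' 1
  commutes' c := by
    rw [Algebra.algebraMap_eq_smul_one, Algebra.algebraMap_eq_smul_one, opTensor_smul_left,
      opTensor_one]
  map_star' S := by rw [← opTensor_star, star_one]

/-- `T ↦ 1 ⊗ T`. -/
def opTensorRight (H K : Type*) [NormedAddCommGroup H] [InnerProductSpace ℂ H]
    [NormedAddCommGroup K] [InnerProductSpace ℂ K] [CompleteSpace H] [CompleteSpace K] :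
    (K →L[ℂ] K) →⋆ₐ[ℂ] (HilbertTensor H K →L[ℂ] HilbertTensor H K) where
  toFun T := opTensor 1 T
  map_one' := opTensor_one
  map_mul' T T' := by rw [← opTensor_mul, one_mul]
  map_zero' := by rw [← zero_smul ℂ (0 : K →L[ℂ] K), opTensor_smul_right, zero_smul]
  map_add' T T' := opTensor_add_right 1 T T'
  commutes' c := by
    rw [Algebra.algebraMap_eq_smul_one, Algebra.algebraMap_eq_smul_one, opTensor_smul_right,
      opTensor_one]
  map_star' T := by rw [← opTensor_star, star_one]

theorem opTensorLeft_apply [CompleteSpace H] [CompleteSpace K] (S : H →L[ℂ] H) :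
    opTensorLeft H K S = opTensor S 1 := rfl

theorem opTensorRight_apply [CompleteSpace H] [CompleteSpace K] (T : K →L[ℂ] K) :
    opTensorRight H K T = opTensor 1 T := rfl

theorem opTensor_one_mul (S : H →L[ℂ] H) (T : K →L[ℂ] K) :
    opTensor S 1 * opTensor 1 T = opTensor S T := by
  rw [← opTensor_mul, one_mul, mul_one]

theorem opTensor_commute (S : H →L[ℂ] H) (T : K →L[ℂ] K) :
    Commute (opTensor S 1) (opTensor 1 T) := by
  rw [commute_iff_eq, opTensor_one_mul, ← opTensor_mul, one_mul, mul_one]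

/-- The product representation `π ⊗ σ` of the algebraic tensor product `A ⊗ B` on the Hilbert
space tensor product, `(π ⊗ σ)(a ⊗ b) = π a ⊗ σ b`. -/
def prodRep {A B : Type*} [Ring A] [StarRing A] [Algebra ℂ A] [StarModule ℂ A]
    [Ring B] [StarRing B] [Algebra ℂ B] [StarModule ℂ B] [CompleteSpace H] [CompleteSpace K]
    (π : A →⋆ₐ[ℂ] (H →L[ℂ] H)) (σ : B →⋆ₐ[ℂ] (K →L[ℂ] K)) :
    A ⊗[ℂ] B →⋆ₐ[ℂ] (HilbertTensor H K →L[ℂ] HilbertTensor H K) :=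
  starLift (C := HilbertTensor H K →L[ℂ] HilbertTensor H K) ((opTensorLeft H K).comp π) ((opTensorRight H K).comp σ)
    (fun a b => opTensor_commute (π a) (σ b))

theorem prodRep_tmul {A B : Type*} [Ring A] [StarRing A] [Algebra ℂ A] [StarModule ℂ A]
    [Ring B] [StarRing B] [Algebra ℂ B] [StarModule ℂ B] [CompleteSpace H] [CompleteSpace K]
    (π : A →⋆ₐ[ℂ] (H →L[ℂ] H)) (σ : B →⋆ₐ[ℂ] (K →L[ℂ] K)) (a : A) (b : B) :
    prodRep π σ (a ⊗ₜ b) = opTensor (π a) (σ b) :=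
  opTensor_one_mul (π a) (σ b)

end HilbertTensor

/-! ### Completion of a *-algebra in the norm given by a family of representations -/

/-- A *-representation of a unital *-algebra by bounded operators on a Hilbert space. -/
structure HilbertRep (A : Type u) [Ring A] [StarRing A] [Algebra ℂ A] : Type (u + 1) where
  space : Type u
  [normed : NormedAddCommGroup space]
  [inner : InnerProductSpace ℂ space]
  [complete : CompleteSpace space]
  rep : A →⋆ₐ[ℂ] (space →L[ℂ] space)

attribute [instance] HilbertRep.normed HilbertRep.inner HilbertRep.complete

/-- A pointwise bounded family of *-representations of a unital *-algebra. -/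
structure RepFamily (A : Type u) [Ring A] [StarRing A] [Algebra ℂ A] : Type (u + 1) where
  reps : Set (HilbertRep A)
  bounded : ∀ x : A, ∃ C : ℝ, ∀ ρ ∈ reps, ‖ρ.rep x‖ ≤ C

namespace RepFamily

section

variable {A : Type u} [Ring A] [StarRing A] [Algebra ℂ A] (F : RepFamily A)

/-- The C*-seminorm `‖x‖ = sup_ρ ‖ρ x‖`. -/
def seminorm (x : A) : ℝ := ⨆ ρ : F.reps, ‖ρ.1.rep x‖

theorem bddAbove (x : A) : BddAbove (Set.range fun ρ : F.reps => ‖ρ.1.rep x‖) := by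
  obtain ⟨C, hC⟩ := F.bounded x
  refine ⟨C, ?_⟩
  rintro _ ⟨ρ, rfl⟩
  exact hC ρ.1 ρ.2

theorem norm_rep_le (ρ : HilbertRep A) (hρ : ρ ∈ F.reps) (x : A) : ‖ρ.rep x‖ ≤ F.seminorm x :=
  le_ciSup (F.bddAbove x) ⟨ρ, hρ⟩

theorem seminorm_nonneg (x : A) : 0 ≤ F.seminorm x :=
  Real.iSup_nonneg fun _ => norm_nonneg _

theorem seminorm_le {x : A} {c : ℝ} (hc : 0 ≤ c) (h : ∀ ρ ∈ F.reps, ‖ρ.rep x‖ ≤ c) :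
    F.seminorm x ≤ c :=
  Real.iSup_le (fun ρ => h ρ.1 ρ.2) hc

theorem seminorm_zero : F.seminorm 0 = 0 := by
  simp [seminorm]

theorem seminorm_add_le (x y : A) : F.seminorm (x + y) ≤ F.seminorm x + F.seminorm y :=
  F.seminorm_le (add_nonneg (F.seminorm_nonneg x) (F.seminorm_nonneg y)) fun ρ hρ => by
    rw [map_add]
    exact (norm_add_le _ _).trans (add_le_add (F.norm_rep_le ρ hρ x) (F.norm_rep_le ρ hρ y))

theorem seminorm_neg (x : A) : F.seminorm (-x) = F.seminorm x := by
  simp [seminorm]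

theorem seminorm_mul_le (x y : A) : F.seminorm (x * y) ≤ F.seminorm x * F.seminorm y :=
  F.seminorm_le (mul_nonneg (F.seminorm_nonneg x) (F.seminorm_nonneg y)) fun ρ hρ => by
    rw [map_mul]
    exact (norm_mul_le _ _).trans (mul_le_mul (F.norm_rep_le ρ hρ x) (F.norm_rep_le ρ hρ y)
      (norm_nonneg _) (F.seminorm_nonneg x))

theorem seminorm_smul_le (c : ℂ) (x : A) : F.seminorm (c • x) ≤ ‖c‖ * F.seminorm x :=
  F.seminorm_le (mul_nonneg (norm_nonneg c) (F.seminorm_nonneg x)) fun ρ hρ => by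
    rw [map_smul, norm_smul]
    exact mul_le_mul_of_nonneg_left (F.norm_rep_le ρ hρ x) (norm_nonneg c)

theorem seminorm_star (x : A) : F.seminorm (star x) = F.seminorm x := by
  simp [seminorm, map_star]

theorem seminorm_mul_self_le (x : A) :
    F.seminorm x * F.seminorm x ≤ F.seminorm (star x * x) := by
  have h : F.seminorm x ≤ Real.sqrt (F.seminorm (star x * x)) :=
    F.seminorm_le (Real.sqrt_nonneg _) fun ρ hρ => by
      refine Real.le_sqrt_of_sq_le ?_
      have h1 := F.norm_rep_le ρ hρ (star x * x)
      rw [map_mul, map_star, CStarRing.norm_star_mul_self] at h1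
      rwa [sq]
  calc F.seminorm x * F.seminorm x
      ≤ Real.sqrt (F.seminorm (star x * x)) * Real.sqrt (F.seminorm (star x * x)) :=
        mul_le_mul h h (F.seminorm_nonneg x) (Real.sqrt_nonneg _)
    _ = _ := Real.mul_self_sqrt (F.seminorm_nonneg _)

/-- The *-algebra `A`, carrying the seminorm of the family `F`. -/
def Pre (_F : RepFamily A) : Type u := A

instance : Ring F.Pre := inferInstanceAs (Ring A)
instance : StarRing F.Pre := inferInstanceAs (StarRing A)
instance : Algebra ℂ F.Pre := inferInstanceAs (Algebra ℂ A)
instance [StarModule ℂ A] : StarModule ℂ F.Pre := inferInstanceAs (StarModule ℂ A)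

/-- The identity map from `A` to `F.Pre`. -/
def toPre : A →⋆ₐ[ℂ] F.Pre := StarAlgHom.id ℂ A

instance : SeminormedRing F.Pre :=
  { AddGroupSeminorm.toSeminormedAddCommGroup (E := F.Pre)
      { toFun := F.seminorm
        map_zero' := F.seminorm_zero
        add_le' := F.seminorm_add_le
        neg' := F.seminorm_neg }, (inferInstance : Ring F.Pre) with
    norm_mul_le := F.seminorm_mul_le }

theorem norm_toPre (x : A) : ‖F.toPre x‖ = F.seminorm x := rfl

instance : NormedAlgebra ℂ F.Pre where
  norm_smul_le := F.seminorm_smul_le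

theorem norm_star_pre (x : F.Pre) : ‖star x‖ = ‖x‖ := F.seminorm_star x

theorem norm_mul_self_le_pre (x : F.Pre) : ‖x‖ * ‖x‖ ≤ ‖star x * x‖ := F.seminorm_mul_self_le x

/-- The C*-algebra obtained from `A` by separation and completion in the seminorm of `F`. -/
def CStarCompletion (F : RepFamily A) : Type u := Completion F.Pre

instance : NormedRing F.CStarCompletion := inferInstanceAs (NormedRing (Completion F.Pre))
instance : Algebra ℂ F.CStarCompletion := inferInstanceAs (Algebra ℂ (Completion F.Pre))
instance : NormedAlgebra ℂ F.CStarCompletion where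
  norm_smul_le := norm_smul_le (α := ℂ) (β := Completion F.Pre)
instance : CompleteSpace F.CStarCompletion := inferInstanceAs (CompleteSpace (Completion F.Pre))

/-- The canonical map from `F.Pre` to the completion. -/
def coe (x : F.Pre) : F.CStarCompletion := (x : Completion F.Pre)

theorem norm_coe (x : F.Pre) : ‖F.coe x‖ = ‖x‖ := Completion.norm_coe x

theorem isometry_coe : Isometry F.coe := Completion.coe_isometry

theorem denseRange_coe : DenseRange F.coe := Completion.denseRange_coe

theorem coe_add (x y : F.Pre) : F.coe (x + y) = F.coe x + F.coe y := Completion.coe_add x y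

theorem coe_mul (x y : F.Pre) : F.coe (x * y) = F.coe x * F.coe y := Completion.coe_mul x y

theorem coe_one : F.coe 1 = 1 := Completion.coe_one F.Pre

theorem coe_smul (c : ℂ) (x : F.Pre) : F.coe (c • x) = c • F.coe x := Completion.coe_smul c x

theorem isometry_star_pre : Isometry (star : F.Pre → F.Pre) :=
  AddMonoidHomClass.isometry_of_norm (starAddEquiv : F.Pre ≃+ F.Pre) F.norm_star_pre

instance : Star F.CStarCompletion := ⟨Completion.map (star : F.Pre → F.Pre)⟩

theorem continuous_star : Continuous (star : F.CStarCompletion → F.CStarCompletion) :=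
  Completion.continuous_map

theorem coe_star (x : F.Pre) : F.coe (star x) = star (F.coe x) :=
  (Completion.map_coe F.isometry_star_pre.uniformContinuous x).symm

@[elab_as_elim]
theorem induction_on {F : RepFamily A} {p : F.CStarCompletion → Prop} (x : F.CStarCompletion)
    (hp : IsClosed {x | p x}) (h : ∀ a, p (F.coe a)) : p x :=
  Completion.induction_on x hp h

instance : StarRing F.CStarCompletion where
  star_involutive x := by
    refine induction_on x (isClosed_eq (F.continuous_star.comp F.continuous_star)
      continuous_id) fun a => ?_
    rw [← coe_star, ← coe_star, star_star]
  star_mul x y := by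
    refine induction_on x (isClosed_eq (F.continuous_star.comp (by fun_prop))
      (continuous_const.mul F.continuous_star)) fun a => ?_
    refine induction_on y (isClosed_eq (F.continuous_star.comp (by fun_prop))
      (F.continuous_star.mul continuous_const)) fun b => ?_
    rw [← coe_mul, ← coe_star, ← coe_star, ← coe_star, star_mul, coe_mul]
  star_add x y := by
    refine induction_on x (isClosed_eq (F.continuous_star.comp (by fun_prop))
      (F.continuous_star.add continuous_const)) fun a => ?_
    refine induction_on y (isClosed_eq (F.continuous_star.comp (by fun_prop))
      (continuous_const.add F.continuous_star)) fun b => ?_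
    rw [← coe_add, ← coe_star, ← coe_star, ← coe_star, star_add, coe_add]

instance : CStarRing F.CStarCompletion where
  norm_mul_self_le x := by
    refine induction_on x (isClosed_le (by fun_prop)
      (continuous_norm.comp (F.continuous_star.mul continuous_id))) fun a => ?_
    rw [← coe_star, ← coe_mul, norm_coe, norm_coe]
    exact F.norm_mul_self_le_pre a

instance [StarModule ℂ A] : StarModule ℂ F.CStarCompletion where
  star_smul c x := by
    have h1 : Continuous fun x : F.CStarCompletion => c • x := continuous_const_smul c
    have h2 : Continuous fun x : F.CStarCompletion => star c • x := continuous_const_smul _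
    refine induction_on x (isClosed_eq (F.continuous_star.comp h1)
      (h2.comp F.continuous_star)) fun a => ?_
    rw [← coe_smul, ← coe_star, ← coe_star, star_smul, coe_smul]

instance [StarModule ℂ A] : CStarAlgebra F.CStarCompletion where

/-- The canonical *-homomorphism from `A` to its completion. -/
def of : A →⋆ₐ[ℂ] F.CStarCompletion where
  toFun x := F.coe (F.toPre x)
  map_one' := by rw [map_one, coe_one]
  map_mul' x y := by rw [map_mul, coe_mul]
  map_zero' := by rw [map_zero]; exact Completion.coe_zero
  map_add' x y := by rw [map_add, coe_add]
  commutes' c := rfl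
  map_star' x := by rw [map_star, coe_star]

theorem norm_of (x : A) : ‖F.of x‖ = F.seminorm x := F.norm_coe (F.toPre x)

theorem denseRange_of : DenseRange F.of := F.denseRange_coe

@[elab_as_elim]
theorem induction_on_of {F : RepFamily A} {p : F.CStarCompletion → Prop} (x : F.CStarCompletion)
    (hp : IsClosed {x | p x}) (h : ∀ a : A, p (F.of a)) : p x :=
  induction_on x hp h

/-- The extension to the completion of a *-homomorphism that is dominated by the seminorm. -/
def lift {D : Type*} [NormedRing D] [StarRing D] [CStarRing D] [NormedAlgebra ℂ D]
    [CompleteSpace D] (f : A →⋆ₐ[ℂ] D)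
    (hf : ∀ x, ‖f x‖ ≤ F.seminorm x) : F.CStarCompletion →⋆ₐ[ℂ] D :=
  have hc : UniformContinuous (fun x : F.Pre => f x) :=
    (AddMonoidHomClass.lipschitz_of_bound (f := (show F.Pre →+ D from (f : A →+* D).toAddMonoidHom))
      1 fun x => by rw [one_mul]; exact hf x).uniformContinuous
  have he : ∀ a : F.Pre, Completion.extension (fun x : F.Pre => f x) (F.coe a) = f a :=
    Completion.extension_coe hc
  have hcont : Continuous fun x : F.CStarCompletion =>
      Completion.extension (fun x : F.Pre => f x) x := Completion.continuous_extension
  { toFun := fun x => Completion.extension (fun x : F.Pre => f x) x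
    map_one' := by rw [← coe_one, he]; exact map_one f
    map_zero' := by
      have h : (0 : F.CStarCompletion) = F.coe 0 := Completion.coe_zero.symm
      rw [h, he]; exact map_zero f
    map_mul' := fun x y => by
      refine induction_on x (isClosed_eq (hcont.comp (by fun_prop))
        (hcont.mul continuous_const)) fun a => ?_
      refine induction_on y (isClosed_eq (hcont.comp (by fun_prop))
        (continuous_const.mul hcont)) fun b => ?_
      rw [← coe_mul, he, he, he]; exact map_mul f a b
    map_add' := fun x y => by
      refine induction_on x (isClosed_eq (hcont.comp (by fun_prop))
        (hcont.add continuous_const)) fun a => ?_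
      refine induction_on y (isClosed_eq (hcont.comp (by fun_prop))
        (continuous_const.add hcont)) fun b => ?_
      rw [← coe_add, he, he, he]; exact map_add f a b
    commutes' := fun c => by
      have h : algebraMap ℂ F.CStarCompletion c = F.coe (algebraMap ℂ F.Pre c) := rfl
      rw [h, he]; exact AlgHomClass.commutes f c
    map_star' := fun x => by
      refine induction_on x (isClosed_eq (hcont.comp F.continuous_star)
        (ContinuousStar.continuous_star.comp hcont)) fun a => ?_
      rw [← coe_star, he, he]; exact map_star f a }

theorem lift_of {D : Type*} [NormedRing D] [StarRing D] [CStarRing D] [NormedAlgebra ℂ D]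
    [CompleteSpace D] (f : A →⋆ₐ[ℂ] D) (hf : ∀ x, ‖f x‖ ≤ F.seminorm x) (a : A) :
    F.lift f hf (F.of a) = f a :=
  Completion.extension_coe (f := fun x : F.Pre => f x)
    ((AddMonoidHomClass.lipschitz_of_bound
      (f := (show F.Pre →+ D from (f : A →+* D).toAddMonoidHom))
      1 fun x => by rw [one_mul]; exact hf x).uniformContinuous) a

theorem continuous_lift {D : Type*} [NormedRing D] [StarRing D] [CStarRing D] [NormedAlgebra ℂ D]
    [CompleteSpace D] (f : A →⋆ₐ[ℂ] D) (hf : ∀ x, ‖f x‖ ≤ F.seminorm x) :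
    Continuous (F.lift f hf) :=
  Completion.continuous_extension (f := fun x : F.Pre => f x)

/-- The extension to the completion of a member of the family. -/
def extendRep (ρ : HilbertRep A) (hρ : ρ ∈ F.reps) :
    F.CStarCompletion →⋆ₐ[ℂ] (ρ.space →L[ℂ] ρ.space) :=
  F.lift ρ.rep (F.norm_rep_le ρ hρ)

theorem extendRep_of (ρ : HilbertRep A) (hρ : ρ ∈ F.reps) (a : A) :
    F.extendRep ρ hρ (F.of a) = ρ.rep a := F.lift_of _ _ a

theorem continuous_extendRep (ρ : HilbertRep A) (hρ : ρ ∈ F.reps) :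
    Continuous (F.extendRep ρ hρ) := F.continuous_lift _ _

/-- The norm of the completion is the supremum over the extended representations. -/
theorem norm_le_of_extendRep (x : F.CStarCompletion) {c : ℝ} (hc : 0 ≤ c)
    (h : ∀ ρ hρ, ‖F.extendRep ρ hρ x‖ ≤ c) : ‖x‖ ≤ c := by
  refine le_of_forall_pos_le_add fun ε hε => ?_
  obtain ⟨a, ha⟩ := Metric.denseRange_iff.1 F.denseRange_of x (ε / 2) (half_pos hε)
  rw [dist_eq_norm] at ha
  have h1 : ‖F.of a‖ ≤ c + ε / 2 := by
    rw [norm_of]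
    refine F.seminorm_le (by positivity) fun ρ hρ => ?_
    rw [← F.extendRep_of ρ hρ]
    have h2 : ‖F.extendRep ρ hρ (x - F.of a)‖ ≤ ‖x - F.of a‖ := by
      refine induction_on_of (x - F.of a) (isClosed_le
        (continuous_norm.comp (F.continuous_extendRep ρ hρ)) continuous_norm) fun b => ?_
      rw [extendRep_of, norm_of]
      exact F.norm_rep_le ρ hρ b
    rw [map_sub] at h2
    have h3 := norm_sub_rev (F.extendRep ρ hρ x) (F.extendRep ρ hρ (F.of a))
    have h4 := norm_le_insert' (F.extendRep ρ hρ (F.of a)) (F.extendRep ρ hρ x)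
    linarith [h ρ hρ]
  have h5 := norm_le_insert' x (F.of a)
  linarith

end

end RepFamily

/-! ### The associator of Hilbert space tensor products -/

section Associator

theorem denseRange_rTensor {E E' : Type*} (G : Type*) [NormedAddCommGroup E]
    [InnerProductSpace ℂ E] [NormedAddCommGroup E'] [InnerProductSpace ℂ E']
    [NormedAddCommGroup G] [InnerProductSpace ℂ G] (f : E →ₗᵢ[ℂ] E') (hf : DenseRange f) :
    DenseRange (f.rTensor G) := by
  have key : ∀ x : E' ⊗[ℂ] G,
      x ∈ (LinearMap.range (f.rTensor G).toLinearMap).topologicalClosure := by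
    intro x
    induction x using TensorProduct.induction_on with
    | zero => exact Submodule.zero_mem _
    | add a b ha hb => exact Submodule.add_mem _ ha hb
    | tmul a g =>
      refine hf.induction_on (p := fun a => a ⊗ₜ[ℂ] g ∈
        (LinearMap.range (f.rTensor G).toLinearMap).topologicalClosure) a ?_ fun e => ?_
      · refine (Submodule.isClosed_topologicalClosure _).preimage ?_
        exact (TensorProduct.continuous_tmul (𝕜 := ℂ) (E := E') (F := G)).comp
          (continuous_id.prodMk continuous_const)
      · exact Submodule.le_topologicalClosure _ ⟨e ⊗ₜ g, by simp⟩
  intro x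
  have h := key x
  rw [← SetLike.mem_coe, Submodule.topologicalClosure_coe] at h
  exact h

theorem denseRange_lTensor {E E' : Type*} (G : Type*) [NormedAddCommGroup E]
    [InnerProductSpace ℂ E] [NormedAddCommGroup E'] [InnerProductSpace ℂ E']
    [NormedAddCommGroup G] [InnerProductSpace ℂ G] (f : E →ₗᵢ[ℂ] E') (hf : DenseRange f) :
    DenseRange (f.lTensor G) := by
  have key : ∀ x : G ⊗[ℂ] E',
      x ∈ (LinearMap.range (f.lTensor G).toLinearMap).topologicalClosure := by
    intro x
    induction x using TensorProduct.induction_on with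
    | zero => exact Submodule.zero_mem _
    | add a b ha hb => exact Submodule.add_mem _ ha hb
    | tmul g a =>
      refine hf.induction_on (p := fun a => g ⊗ₜ[ℂ] a ∈
        (LinearMap.range (f.lTensor G).toLinearMap).topologicalClosure) a ?_ fun e => ?_
      · refine (Submodule.isClosed_topologicalClosure _).preimage ?_
        exact (TensorProduct.continuous_tmul (𝕜 := ℂ) (E := G) (F := E')).comp
          (continuous_const.prodMk continuous_id)
      · exact Submodule.le_topologicalClosure _ ⟨g ⊗ₜ e, by simp⟩
  intro x
  have h := key x
  rw [← SetLike.mem_coe, Submodule.topologicalClosure_coe] at h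
  exact h

variable (H₁ H₂ H₃ : Type*) [NormedAddCommGroup H₁] [InnerProductSpace ℂ H₁]
  [NormedAddCommGroup H₂] [InnerProductSpace ℂ H₂] [NormedAddCommGroup H₃] [InnerProductSpace ℂ H₃]

/-- The canonical map `(H₁ ⊗ H₂) ⊗ H₃ → (H₁ ⊗̂ H₂) ⊗̂ H₃`. -/
def tripleLeft : (H₁ ⊗[ℂ] H₂) ⊗[ℂ] H₃ →ₗᵢ[ℂ] HilbertTensor (HilbertTensor H₁ H₂) H₃ :=
  (toHilbertTensor (HilbertTensor H₁ H₂) H₃).comp ((toHilbertTensor H₁ H₂).rTensor H₃)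

/-- The canonical map `H₁ ⊗ (H₂ ⊗ H₃) → H₁ ⊗̂ (H₂ ⊗̂ H₃)`. -/
def tripleRight : H₁ ⊗[ℂ] (H₂ ⊗[ℂ] H₃) →ₗᵢ[ℂ] HilbertTensor H₁ (HilbertTensor H₂ H₃) :=
  (toHilbertTensor H₁ (HilbertTensor H₂ H₃)).comp ((toHilbertTensor H₂ H₃).lTensor H₁)

variable {H₁ H₂ H₃} in
theorem tripleLeft_tmul (a : H₁ ⊗[ℂ] H₂) (b : H₃) : tripleLeft H₁ H₂ H₃ (a ⊗ₜ b) =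
    toHilbertTensor (HilbertTensor H₁ H₂) H₃ (toHilbertTensor H₁ H₂ a ⊗ₜ[ℂ] b) := rfl

variable {H₁ H₂ H₃} in
theorem tripleRight_tmul (a : H₁) (b : H₂ ⊗[ℂ] H₃) : tripleRight H₁ H₂ H₃ (a ⊗ₜ b) =
    toHilbertTensor H₁ (HilbertTensor H₂ H₃) (a ⊗ₜ[ℂ] toHilbertTensor H₂ H₃ b) := rfl

theorem denseRange_tripleLeft : DenseRange (tripleLeft H₁ H₂ H₃) :=
  denseRange_toHilbertTensor.comp (denseRange_rTensor H₃ _ denseRange_toHilbertTensor)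
    (toHilbertTensor _ _).continuous

theorem denseRange_tripleRight : DenseRange (tripleRight H₁ H₂ H₃) :=
  denseRange_toHilbertTensor.comp (denseRange_lTensor H₁ _ denseRange_toHilbertTensor)
    (toHilbertTensor _ _).continuous

/-- The associativity unitary `(H₁ ⊗̂ H₂) ⊗̂ H₃ → H₁ ⊗̂ (H₂ ⊗̂ H₃)`. -/
def hilbertAssoc :
    HilbertTensor (HilbertTensor H₁ H₂) H₃ ≃ₗᵢ[ℂ] HilbertTensor H₁ (HilbertTensor H₂ H₃) :=
  (TensorProduct.assoc ℂ H₁ H₂ H₃).extendOfIsometry (tripleLeft H₁ H₂ H₃).toLinearMap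
    (tripleRight H₁ H₂ H₃).toLinearMap (denseRange_tripleLeft H₁ H₂ H₃)
    (denseRange_tripleRight H₁ H₂ H₃) fun x => by
      change ‖tripleRight H₁ H₂ H₃ _‖ = ‖tripleLeft H₁ H₂ H₃ x‖
      rw [LinearIsometry.norm_map, LinearIsometry.norm_map, TensorProduct.norm_assoc]

theorem hilbertAssoc_triple (x : (H₁ ⊗[ℂ] H₂) ⊗[ℂ] H₃) :
    hilbertAssoc H₁ H₂ H₃ (tripleLeft H₁ H₂ H₃ x) =
      tripleRight H₁ H₂ H₃ (TensorProduct.assoc ℂ H₁ H₂ H₃ x) :=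
  LinearEquiv.extendOfIsometry_eq _ _ _ _ _ _ x

variable {H₁ H₂ H₃}

theorem hilbertAssoc_opTensor (R : H₁ →L[ℂ] H₁) (S : H₂ →L[ℂ] H₂) (T : H₃ →L[ℂ] H₃)
    (x : HilbertTensor (HilbertTensor H₁ H₂) H₃) :
    hilbertAssoc H₁ H₂ H₃ (opTensor (opTensor R S) T x) =
      opTensor R (opTensor S T) (hilbertAssoc H₁ H₂ H₃ x) := by
  refine (denseRange_tripleLeft H₁ H₂ H₃).induction_on (p := fun x =>
    hilbertAssoc H₁ H₂ H₃ (opTensor (opTensor R S) T x) =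
      opTensor R (opTensor S T) (hilbertAssoc H₁ H₂ H₃ x)) x
    (isClosed_eq (by fun_prop) (by fun_prop)) fun y => ?_
  have h1 : ∀ z, opTensor (opTensor R S) T (tripleLeft H₁ H₂ H₃ z) =
      tripleLeft H₁ H₂ H₃ (TensorProduct.mapL (TensorProduct.mapL R S) T z) := by
    intro z
    induction z using TensorProduct.induction_on with
    | zero => simp only [map_zero, LinearIsometry.map_zero]
    | add a b ha hb => simp only [map_add, ha, hb]
    | tmul a b =>
      rw [tripleLeft_tmul, opTensor_coe, TensorProduct.mapL_tmul, opTensor_coe,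
        TensorProduct.mapL_tmul, tripleLeft_tmul]
  have h2 : ∀ z, opTensor R (opTensor S T) (tripleRight H₁ H₂ H₃ z) =
      tripleRight H₁ H₂ H₃ (TensorProduct.mapL R (TensorProduct.mapL S T) z) := by
    intro z
    induction z using TensorProduct.induction_on with
    | zero => simp only [map_zero, LinearIsometry.map_zero]
    | add a b ha hb => simp only [map_add, ha, hb]
    | tmul a b =>
      rw [tripleRight_tmul, opTensor_coe, TensorProduct.mapL_tmul, opTensor_coe,
        TensorProduct.mapL_tmul, tripleRight_tmul]
  rw [h1, hilbertAssoc_triple, hilbertAssoc_triple, h2]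
  clear h1 h2
  congr 1
  induction y using TensorProduct.induction_on with
  | zero => simp only [map_zero]
  | add a b ha hb => simp only [map_add, ha, hb]
  | tmul a b =>
    induction a using TensorProduct.induction_on with
    | zero => simp only [map_zero, TensorProduct.zero_tmul]
    | add a b ha hb => simp only [map_add, TensorProduct.add_tmul, ha, hb]
    | tmul a c => rfl

end Associator

/-! ### Minimal tensor products of C*-algebras -/

/-- The product of two representations, on the Hilbert space tensor product. -/
def HilbertRep.prod {A B : Type u} [Ring A] [StarRing A] [Algebra ℂ A] [StarModule ℂ A]
    [Ring B] [StarRing B] [Algebra ℂ B] [StarModule ℂ B] (π : HilbertRep A) (σ : HilbertRep B) :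
    HilbertRep (A ⊗[ℂ] B) where
  space := HilbertTensor π.space σ.space
  rep := prodRep π.rep σ.rep

theorem norm_prod_rep_tmul_le {A B : Type u} [Ring A] [StarRing A] [Algebra ℂ A] [StarModule ℂ A]
    [Ring B] [StarRing B] [Algebra ℂ B] [StarModule ℂ B] (π : HilbertRep A) (σ : HilbertRep B)
    (a : A) (b : B) : ‖(π.prod σ).rep (a ⊗ₜ b)‖ ≤ ‖π.rep a‖ * ‖σ.rep b‖ := by
  change ‖prodRep π.rep σ.rep (a ⊗ₜ b)‖ ≤ _
  rw [prodRep_tmul]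
  exact norm_opTensor_le _ _

theorem HilbertRep.norm_le {A : Type u} [CStarAlgebra A] (π : HilbertRep A) (a : A) :
    ‖π.rep a‖ ≤ ‖a‖ :=
  NonUnitalStarAlgHom.norm_apply_le π.rep a

section MinTensor

variable (A B C : Type u) [CStarAlgebra A] [CStarAlgebra B] [CStarAlgebra C]

/-- The product representations `π ⊗ σ` of `A ⊗ B`. The corresponding norm
`‖x‖ = sup ‖(π ⊗ σ) x‖` is the spatial (minimal) C*-norm. -/
def minFamily : RepFamily (A ⊗[ℂ] B) where
  reps := {ρ | ∃ (π : HilbertRep A) (σ : HilbertRep B), ρ = π.prod σ}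
  bounded x := by
    induction x using TensorProduct.induction_on with
    | zero => exact ⟨0, fun ρ _ => by rw [map_zero, norm_zero]⟩
    | add a b ha hb =>
      obtain ⟨c, hc⟩ := ha
      obtain ⟨d, hd⟩ := hb
      refine ⟨c + d, fun ρ hρ => ?_⟩
      rw [map_add]
      exact (norm_add_le _ _).trans (add_le_add (hc ρ hρ) (hd ρ hρ))
    | tmul a b =>
      refine ⟨‖a‖ * ‖b‖, ?_⟩
      rintro _ ⟨π, σ, rfl⟩
      exact (norm_prod_rep_tmul_le π σ a b).trans
        (mul_le_mul (π.norm_le a) (σ.norm_le b) (norm_nonneg _) (norm_nonneg _))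

/-- The product representations `(π ⊗ σ) ⊗ τ` of `(A ⊗ B) ⊗ C`. -/
def minFamily₃ : RepFamily ((A ⊗[ℂ] B) ⊗[ℂ] C) where
  reps := {ρ | ∃ (π : HilbertRep A) (σ : HilbertRep B) (τ : HilbertRep C),
    ρ = (π.prod σ).prod τ}
  bounded x := by
    induction x using TensorProduct.induction_on with
    | zero => exact ⟨0, fun ρ _ => by rw [map_zero, norm_zero]⟩
    | add a b ha hb =>
      obtain ⟨c, hc⟩ := ha
      obtain ⟨d, hd⟩ := hb
      refine ⟨c + d, fun ρ hρ => ?_⟩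
      rw [map_add]
      exact (norm_add_le _ _).trans (add_le_add (hc ρ hρ) (hd ρ hρ))
    | tmul y b =>
      obtain ⟨c, hc⟩ := (minFamily A B).bounded y
      refine ⟨c * ‖b‖, ?_⟩
      rintro _ ⟨π, σ, τ, rfl⟩
      have h := hc (π.prod σ) ⟨π, σ, rfl⟩
      exact (norm_prod_rep_tmul_le (π.prod σ) τ y b).trans
        (mul_le_mul h (τ.norm_le b) (norm_nonneg _) ((norm_nonneg _).trans h))

/-- The minimal C*-tensor product `A ⊗ B`. -/
abbrev MinTensor : Type u := (minFamily A B).CStarCompletion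

/-- The minimal C*-tensor product `A ⊗ B ⊗ C`. -/
abbrev MinTensor₃ : Type u := (minFamily₃ A B C).CStarCompletion

/-- `a ↦ a ⊗ 1`. -/
def minLeft : A →⋆ₐ[ℂ] MinTensor A B :=
  (minFamily A B).of.comp
    { (Algebra.TensorProduct.includeLeft : A →ₐ[ℂ] A ⊗[ℂ] B) with
      map_star' := fun a => by
        change star a ⊗ₜ[ℂ] (1 : B) = star (a ⊗ₜ[ℂ] (1 : B))
        rw [TensorProduct.star_tmul, star_one] }

/-- `b ↦ 1 ⊗ b`. -/
def minRight : B →⋆ₐ[ℂ] MinTensor A B :=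
  (minFamily A B).of.comp
    { (Algebra.TensorProduct.includeRight : B →ₐ[ℂ] A ⊗[ℂ] B) with
      map_star' := fun b => by
        change (1 : A) ⊗ₜ[ℂ] star b = star ((1 : A) ⊗ₜ[ℂ] b)
        rw [TensorProduct.star_tmul, star_one] }

/-- The inclusion `x ↦ x ⊗ 1` of algebraic tensor products. -/
def algLeg₁₂ : A ⊗[ℂ] B →⋆ₐ[ℂ] (A ⊗[ℂ] B) ⊗[ℂ] C :=
  { (Algebra.TensorProduct.includeLeft : A ⊗[ℂ] B →ₐ[ℂ] (A ⊗[ℂ] B) ⊗[ℂ] C) with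
    map_star' := fun x => by
      change star x ⊗ₜ[ℂ] (1 : C) = star (x ⊗ₜ[ℂ] (1 : C))
      rw [TensorProduct.star_tmul, star_one] }

/-- The inclusion `c ↦ 1 ⊗ 1 ⊗ c` of algebraic tensor products. -/
def algLeg₃ : C →⋆ₐ[ℂ] (A ⊗[ℂ] B) ⊗[ℂ] C :=
  { (Algebra.TensorProduct.includeRight : C →ₐ[ℂ] (A ⊗[ℂ] B) ⊗[ℂ] C) with
    map_star' := fun c => by
      change (1 : A ⊗[ℂ] B) ⊗ₜ[ℂ] star c = star ((1 : A ⊗[ℂ] B) ⊗ₜ[ℂ] c)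
      rw [TensorProduct.star_tmul, star_one] }

/-- The inclusion `a ↦ a ⊗ 1 ⊗ 1` of algebraic tensor products. -/
def algLeg₁ : A →⋆ₐ[ℂ] (A ⊗[ℂ] B) ⊗[ℂ] C :=
  (algLeg₁₂ A B C).comp
    { (Algebra.TensorProduct.includeLeft : A →ₐ[ℂ] A ⊗[ℂ] B) with
      map_star' := fun a => by
        change star a ⊗ₜ[ℂ] (1 : B) = star (a ⊗ₜ[ℂ] (1 : B))
        rw [TensorProduct.star_tmul, star_one] }

/-- The inclusion `b ↦ 1 ⊗ b ⊗ 1` of algebraic tensor products. -/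
def algLeg₂ : B →⋆ₐ[ℂ] (A ⊗[ℂ] B) ⊗[ℂ] C :=
  (algLeg₁₂ A B C).comp
    { (Algebra.TensorProduct.includeRight : B →ₐ[ℂ] A ⊗[ℂ] B) with
      map_star' := fun b => by
        change (1 : A) ⊗ₜ[ℂ] star b = star ((1 : A) ⊗ₜ[ℂ] b)
        rw [TensorProduct.star_tmul, star_one] }

variable {A B C}

theorem algLeg₁₂_apply (x : A ⊗[ℂ] B) : algLeg₁₂ A B C x = x ⊗ₜ 1 := rfl
theorem algLeg₁_apply (a : A) : algLeg₁ A B C a = (a ⊗ₜ 1) ⊗ₜ 1 := rfl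
theorem algLeg₂_apply (b : B) : algLeg₂ A B C b = (1 ⊗ₜ b) ⊗ₜ 1 := rfl
theorem algLeg₃_apply (c : C) : algLeg₃ A B C c = 1 ⊗ₜ c := rfl

variable (A B C)

/-- The inclusion `b ⊗ c ↦ 1 ⊗ b ⊗ c` of algebraic tensor products. -/
def algLeg₂₃ : B ⊗[ℂ] C →⋆ₐ[ℂ] (A ⊗[ℂ] B) ⊗[ℂ] C :=
  starLift (algLeg₂ A B C) (algLeg₃ A B C) fun b c => by
    rw [commute_iff_eq, algLeg₂_apply, algLeg₃_apply, Algebra.TensorProduct.tmul_mul_tmul,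
      Algebra.TensorProduct.tmul_mul_tmul, one_mul, one_mul, mul_one, mul_one]

variable {A B C}

theorem algLeg₂₃_tmul (b : B) (c : C) : algLeg₂₃ A B C (b ⊗ₜ c) = (1 ⊗ₜ b) ⊗ₜ c := by
  rw [algLeg₂₃, starLift_tmul, algLeg₂_apply, algLeg₃_apply, Algebra.TensorProduct.tmul_mul_tmul,
    one_mul, mul_one]

theorem norm_opTensor_one_le {H K : Type*} [NormedAddCommGroup H] [InnerProductSpace ℂ H]
    [NormedAddCommGroup K] [InnerProductSpace ℂ K] (S : H →L[ℂ] H) :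
    ‖opTensor S (1 : K →L[ℂ] K)‖ ≤ ‖S‖ :=
  (norm_opTensor_le S 1).trans (mul_le_of_le_one_right (norm_nonneg _)
    ContinuousLinearMap.norm_id_le)

theorem norm_algLeg₁₂_le (x : A ⊗[ℂ] B) :
    (minFamily₃ A B C).seminorm (algLeg₁₂ A B C x) ≤ (minFamily A B).seminorm x := by
  refine RepFamily.seminorm_le _ (RepFamily.seminorm_nonneg _ x) ?_
  rintro _ ⟨π, σ, τ, rfl⟩
  have h : ((π.prod σ).prod τ).rep (algLeg₁₂ A B C x) =
      opTensor ((π.prod σ).rep x) (1 : τ.space →L[ℂ] τ.space) := by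
    change prodRep (π.prod σ).rep τ.rep (x ⊗ₜ 1) = _
    rw [prodRep_tmul, map_one]
  rw [h]
  exact (norm_opTensor_one_le _).trans
    ((minFamily A B).norm_rep_le (π.prod σ) ⟨π, σ, rfl⟩ x)

/-- The representation `b ↦ 1 ⊗ σ b` on the Hilbert space tensor product. -/
def HilbertRep.ampRight (H : Type u) [NormedAddCommGroup H] [InnerProductSpace ℂ H]
    [CompleteSpace H] (σ : HilbertRep B) : HilbertRep B where
  space := HilbertTensor H σ.space
  rep := (opTensorRight H σ.space).comp σ.rep

theorem prodRep_algLeg₂₃ {H K L : Type*} [NormedAddCommGroup H] [InnerProductSpace ℂ H]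
    [CompleteSpace H] [NormedAddCommGroup K] [InnerProductSpace ℂ K] [CompleteSpace K]
    [NormedAddCommGroup L] [InnerProductSpace ℂ L] [CompleteSpace L]
    (π : A →⋆ₐ[ℂ] (H →L[ℂ] H)) (σ : B →⋆ₐ[ℂ] (K →L[ℂ] K)) (τ : C →⋆ₐ[ℂ] (L →L[ℂ] L))
    (x : B ⊗[ℂ] C) : prodRep (prodRep π σ) τ (algLeg₂₃ A B C x) =
      prodRep ((opTensorRight H K).comp σ) τ x := by
  induction x using TensorProduct.induction_on with
  | zero => rw [map_zero, map_zero, map_zero]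
  | add a b ha hb => rw [map_add, map_add, map_add, ha, hb]
  | tmul b c =>
    rw [algLeg₂₃_tmul, prodRep_tmul, prodRep_tmul, prodRep_tmul, map_one]
    rfl

theorem norm_algLeg₂₃_le (x : B ⊗[ℂ] C) :
    (minFamily₃ A B C).seminorm (algLeg₂₃ A B C x) ≤ (minFamily B C).seminorm x := by
  refine RepFamily.seminorm_le _ (RepFamily.seminorm_nonneg _ x) ?_
  rintro _ ⟨π, σ, τ, rfl⟩
  have h : ((π.prod σ).prod τ).rep (algLeg₂₃ A B C x) =
      ((σ.ampRight π.space).prod τ).rep x := prodRep_algLeg₂₃ π.rep σ.rep τ.rep x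
  rw [h]
  exact (minFamily B C).norm_rep_le _ ⟨σ.ampRight π.space, τ, rfl⟩ x

variable (A B C)

/-- `x ↦ x ⊗ 1`, from `A ⊗ B` to `A ⊗ B ⊗ C`. -/
def leg₁₂ : MinTensor A B →⋆ₐ[ℂ] MinTensor₃ A B C :=
  (minFamily A B).lift ((minFamily₃ A B C).of.comp (algLeg₁₂ A B C)) fun x =>
    ((minFamily₃ A B C).norm_of _).trans_le (norm_algLeg₁₂_le x)

/-- `x ↦ 1 ⊗ x`, from `B ⊗ C` to `A ⊗ B ⊗ C`. -/
def leg₂₃ : MinTensor B C →⋆ₐ[ℂ] MinTensor₃ A B C :=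
  (minFamily B C).lift ((minFamily₃ A B C).of.comp (algLeg₂₃ A B C)) fun x =>
    ((minFamily₃ A B C).norm_of _).trans_le (norm_algLeg₂₃_le x)

/-- `a ↦ a ⊗ 1 ⊗ 1`. -/
def leg₁ : A →⋆ₐ[ℂ] MinTensor₃ A B C := (minFamily₃ A B C).of.comp (algLeg₁ A B C)

/-- `c ↦ 1 ⊗ 1 ⊗ c`. -/
def leg₃ : C →⋆ₐ[ℂ] MinTensor₃ A B C := (minFamily₃ A B C).of.comp (algLeg₃ A B C)

variable {A B C}

theorem leg₁_apply (a : A) :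
    leg₁ A B C a = (minFamily₃ A B C).of ((a ⊗ₜ 1) ⊗ₜ 1) := rfl

theorem leg₃_apply (c : C) : leg₃ A B C c = (minFamily₃ A B C).of (1 ⊗ₜ c) := rfl

theorem leg₁₂_of (x : A ⊗[ℂ] B) : leg₁₂ A B C ((minFamily A B).of x) =
    (minFamily₃ A B C).of (algLeg₁₂ A B C x) := RepFamily.lift_of _ _ _ x

theorem leg₂₃_of (x : B ⊗[ℂ] C) : leg₂₃ A B C ((minFamily B C).of x) =
    (minFamily₃ A B C).of (algLeg₂₃ A B C x) := RepFamily.lift_of _ _ _ x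

theorem continuous_leg₁₂ : Continuous (leg₁₂ A B C) := RepFamily.continuous_lift _ _ _

theorem continuous_leg₂₃ : Continuous (leg₂₃ A B C) := RepFamily.continuous_lift _ _ _

theorem commute_leg₁₂_leg₃ (x : MinTensor A B) (c : C) :
    Commute (leg₁₂ A B C x) (leg₃ A B C c) := by
  rw [commute_iff_eq]
  refine RepFamily.induction_on_of x (isClosed_eq (continuous_leg₁₂.mul continuous_const)
    (continuous_const.mul continuous_leg₁₂)) fun a => ?_
  rw [leg₁₂_of, leg₃_apply, ← map_mul, ← map_mul, algLeg₁₂_apply, Algebra.TensorProduct.tmul_mul_tmul,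
    Algebra.TensorProduct.tmul_mul_tmul, one_mul, one_mul, mul_one, mul_one]

theorem commute_leg₁_leg₂₃ (a : A) (x : MinTensor B C) :
    Commute (leg₁ A B C a) (leg₂₃ A B C x) := by
  rw [commute_iff_eq]
  refine RepFamily.induction_on_of x (isClosed_eq (continuous_const.mul continuous_leg₂₃)
    (continuous_leg₂₃.mul continuous_const)) fun y => ?_
  rw [leg₂₃_of, leg₁_apply, ← map_mul, ← map_mul]
  congr 1
  induction y using TensorProduct.induction_on with
  | zero => rw [map_zero, mul_zero, zero_mul]
  | add y z hy hz => rw [map_add, mul_add, add_mul, hy, hz]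
  | tmul b c =>
    rw [algLeg₂₃_tmul]
    simp only [Algebra.TensorProduct.tmul_mul_tmul, one_mul, mul_one]

end MinTensor

/-! ### The maps `Δ ⊗ id` and `id ⊗ Δ` -/

section Amplification

variable {A B C D : Type u} [CStarAlgebra A] [CStarAlgebra B] [CStarAlgebra C] [CStarAlgebra D]

/-- The extension of `π ⊗ σ` to the minimal tensor product. -/
def minRep (π : HilbertRep A) (σ : HilbertRep B) :
    MinTensor A B →⋆ₐ[ℂ]
      (HilbertTensor π.space σ.space →L[ℂ] HilbertTensor π.space σ.space) :=
  (minFamily A B).extendRep (π.prod σ) ⟨π, σ, rfl⟩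

/-- The extension of `(π ⊗ σ) ⊗ τ` to the minimal tensor product. -/
def minRep₃ (π : HilbertRep A) (σ : HilbertRep B) (τ : HilbertRep C) :
    MinTensor₃ A B C →⋆ₐ[ℂ]
      (HilbertTensor (HilbertTensor π.space σ.space) τ.space →L[ℂ]
        HilbertTensor (HilbertTensor π.space σ.space) τ.space) :=
  (minFamily₃ A B C).extendRep ((π.prod σ).prod τ) ⟨π, σ, τ, rfl⟩

theorem minRep_of (π : HilbertRep A) (σ : HilbertRep B) (x : A ⊗[ℂ] B) :
    minRep π σ ((minFamily A B).of x) = prodRep π.rep σ.rep x :=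
  RepFamily.extendRep_of _ _ _ x

theorem minRep₃_of (π : HilbertRep A) (σ : HilbertRep B) (τ : HilbertRep C)
    (x : (A ⊗[ℂ] B) ⊗[ℂ] C) :
    minRep₃ π σ τ ((minFamily₃ A B C).of x) = prodRep (prodRep π.rep σ.rep) τ.rep x :=
  RepFamily.extendRep_of _ _ _ x

theorem continuous_minRep (π : HilbertRep A) (σ : HilbertRep B) : Continuous (minRep π σ) :=
  RepFamily.continuous_extendRep _ _ _

theorem continuous_minRep₃ (π : HilbertRep A) (σ : HilbertRep B) (τ : HilbertRep C) :
    Continuous (minRep₃ π σ τ) :=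
  RepFamily.continuous_extendRep _ _ _

theorem norm_le_of_minRep₃ (x : MinTensor₃ A B C) {c : ℝ} (hc : 0 ≤ c)
    
    (h : ∀ (π : HilbertRep A) (σ : HilbertRep B) (τ : HilbertRep C), ‖minRep₃ π σ τ x‖ ≤ c) : ‖x‖ ≤ c := by
  refine RepFamily.norm_le_of_extendRep _ x hc ?_
  rintro _ ⟨π, σ, τ, rfl⟩
  exact h π σ τ

theorem norm_prodRep_le {H K : Type u} [NormedAddCommGroup H] [InnerProductSpace ℂ H]
    [CompleteSpace H] [NormedAddCommGroup K] [InnerProductSpace ℂ K] [CompleteSpace K]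
    (π : A →⋆ₐ[ℂ] (H →L[ℂ] H)) (σ : B →⋆ₐ[ℂ] (K →L[ℂ] K)) (x : A ⊗[ℂ] B) :
    ‖prodRep π σ x‖ ≤ (minFamily A B).seminorm x :=
  (minFamily A B).norm_rep_le ((HilbertRep.mk H π).prod (HilbertRep.mk K σ)) ⟨_, _, rfl⟩ x

section

variable {H K : Type*} [NormedAddCommGroup H] [InnerProductSpace ℂ H]
    [NormedAddCommGroup K] [InnerProductSpace ℂ K] [CompleteSpace H] [CompleteSpace K]

theorem continuous_opTensorLeft : Continuous (opTensorLeft H K) :=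
  AddMonoidHomClass.continuous_of_bound (opTensorLeft H K) 1 fun S => by
    rw [one_mul]; exact norm_opTensor_one_le S

theorem continuous_opTensorRight : Continuous (opTensorRight H K) :=
  AddMonoidHomClass.continuous_of_bound (opTensorRight H K) 1 fun T => by
    rw [opTensorRight_apply]
    exact (norm_opTensor_le 1 T).trans
      (mul_le_mul_of_nonneg_right ContinuousLinearMap.norm_id_le (norm_nonneg _))

end

theorem minRep₃_leg₁₂ (π : HilbertRep A) (σ : HilbertRep B) (τ : HilbertRep C)
    (y : MinTensor A B) :
    minRep₃ π σ τ (leg₁₂ A B C y) = opTensorLeft _ τ.space (minRep π σ y) := by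
  refine RepFamily.induction_on_of y
    (isClosed_eq ((continuous_minRep₃ π σ τ).comp continuous_leg₁₂)
      (continuous_opTensorLeft.comp (continuous_minRep π σ))) fun x => ?_
  rw [leg₁₂_of, minRep₃_of, minRep_of, algLeg₁₂_apply, prodRep_tmul, map_one,
    opTensorLeft_apply]

theorem minRep₃_leg₃ (π : HilbertRep A) (σ : HilbertRep B) (τ : HilbertRep C) (c : C) :
    minRep₃ π σ τ (leg₃ A B C c) = opTensorRight (HilbertTensor π.space σ.space) _ (τ.rep c) := by
  rw [leg₃_apply, minRep₃_of, prodRep_tmul, map_one, opTensorRight_apply]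

/-- Conjugation by a unitary. -/
def conjHom {H K : Type*} [NormedAddCommGroup H] [InnerProductSpace ℂ H] [CompleteSpace H]
    [NormedAddCommGroup K] [InnerProductSpace ℂ K] [CompleteSpace K] (e : H ≃ₗᵢ[ℂ] K) :
    (H →L[ℂ] H) →⋆ₐ[ℂ] (K →L[ℂ] K) where
  toFun := e.conjStarAlgEquiv
  map_one' := map_one _
  map_mul' := map_mul _
  map_zero' := map_zero _
  map_add' := map_add _
  commutes' c := by
    rw [Algebra.algebraMap_eq_smul_one, Algebra.algebraMap_eq_smul_one, map_smul, map_one]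
  map_star' := map_star _

/-- Conjugation by the associativity unitary. -/
def assocConj (H₁ H₂ H₃ : Type*) [NormedAddCommGroup H₁] [InnerProductSpace ℂ H₁]
    [NormedAddCommGroup H₂] [InnerProductSpace ℂ H₂]
    [NormedAddCommGroup H₃] [InnerProductSpace ℂ H₃] :
    (HilbertTensor H₁ (HilbertTensor H₂ H₃) →L[ℂ] HilbertTensor H₁ (HilbertTensor H₂ H₃)) →⋆ₐ[ℂ]
      (HilbertTensor (HilbertTensor H₁ H₂) H₃ →L[ℂ] HilbertTensor (HilbertTensor H₁ H₂) H₃) :=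
  conjHom (hilbertAssoc H₁ H₂ H₃).symm

theorem assocConj_opTensor {H₁ H₂ H₃ : Type*} [NormedAddCommGroup H₁] [InnerProductSpace ℂ H₁]
    [NormedAddCommGroup H₂] [InnerProductSpace ℂ H₂]
    [NormedAddCommGroup H₃] [InnerProductSpace ℂ H₃]
    (R : H₁ →L[ℂ] H₁) (S : H₂ →L[ℂ] H₂) (T : H₃ →L[ℂ] H₃) :
    assocConj H₁ H₂ H₃ (opTensor R (opTensor S T)) = opTensor (opTensor R S) T := by
  ext x
  change (hilbertAssoc H₁ H₂ H₃).symm (opTensor R (opTensor S T) (hilbertAssoc H₁ H₂ H₃ x)) = _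
  rw [← hilbertAssoc_opTensor, LinearIsometryEquiv.symm_apply_apply]

theorem norm_assocConj_le {H₁ H₂ H₃ : Type*} [NormedAddCommGroup H₁] [InnerProductSpace ℂ H₁]
    [NormedAddCommGroup H₂] [InnerProductSpace ℂ H₂]
    [NormedAddCommGroup H₃] [InnerProductSpace ℂ H₃]
    (T : HilbertTensor H₁ (HilbertTensor H₂ H₃) →L[ℂ] HilbertTensor H₁ (HilbertTensor H₂ H₃)) :
    ‖assocConj H₁ H₂ H₃ T‖ ≤ ‖T‖ := by
  refine ContinuousLinearMap.opNorm_le_bound _ (norm_nonneg _) fun x => ?_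
  change ‖(hilbertAssoc H₁ H₂ H₃).symm (T (hilbertAssoc H₁ H₂ H₃ x))‖ ≤ _
  rw [LinearIsometryEquiv.norm_map]
  exact (T.le_opNorm _).trans_eq (by rw [LinearIsometryEquiv.norm_map])

theorem continuous_assocConj {H₁ H₂ H₃ : Type*} [NormedAddCommGroup H₁] [InnerProductSpace ℂ H₁]
    [NormedAddCommGroup H₂] [InnerProductSpace ℂ H₂]
    [NormedAddCommGroup H₃] [InnerProductSpace ℂ H₃] : Continuous (assocConj H₁ H₂ H₃) :=
  AddMonoidHomClass.continuous_of_bound (assocConj H₁ H₂ H₃) 1 fun T => by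
    rw [one_mul]; exact norm_assocConj_le T

theorem minRep₃_leg₁ (π : HilbertRep A) (σ : HilbertRep B) (τ : HilbertRep C) (a : A) :
    minRep₃ π σ τ (leg₁ A B C a) = assocConj π.space σ.space τ.space (opTensorLeft _ _ (π.rep a)) := by
  rw [leg₁_apply, minRep₃_of, prodRep_tmul, prodRep_tmul, map_one, map_one, opTensorLeft_apply,
    ← opTensor_one (H := σ.space) (K := τ.space), assocConj_opTensor]

theorem prodRep_algLeg₂₃_eq {H K L : Type*} [NormedAddCommGroup H] [InnerProductSpace ℂ H]
    [CompleteSpace H] [NormedAddCommGroup K] [InnerProductSpace ℂ K] [CompleteSpace K]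
    [NormedAddCommGroup L] [InnerProductSpace ℂ L] [CompleteSpace L]
    (π : A →⋆ₐ[ℂ] (H →L[ℂ] H)) (σ : B →⋆ₐ[ℂ] (K →L[ℂ] K)) (τ : C →⋆ₐ[ℂ] (L →L[ℂ] L))
    (x : B ⊗[ℂ] C) : prodRep (prodRep π σ) τ (algLeg₂₃ A B C x) =
      assocConj H K L (opTensorRight H (HilbertTensor K L) (prodRep σ τ x)) := by
  induction x using TensorProduct.induction_on with
  | zero => rw [map_zero, map_zero, map_zero, map_zero, map_zero]
  | add a b ha hb => rw [map_add, map_add, ha, hb, map_add, map_add, map_add]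
  | tmul b c =>
    rw [algLeg₂₃_tmul, prodRep_tmul, prodRep_tmul, prodRep_tmul, map_one, opTensorRight_apply,
      assocConj_opTensor]

theorem minRep₃_leg₂₃ (π : HilbertRep A) (σ : HilbertRep B) (τ : HilbertRep C)
    (y : MinTensor B C) :
    minRep₃ π σ τ (leg₂₃ A B C y) =
      assocConj π.space σ.space τ.space (opTensorRight π.space _ (minRep σ τ y)) := by
  refine RepFamily.induction_on_of y
    (isClosed_eq ((continuous_minRep₃ π σ τ).comp continuous_leg₂₃)
      (continuous_assocConj.comp
        (continuous_opTensorRight.comp (continuous_minRep σ τ)))) fun x => ?_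
  rw [leg₂₃_of, minRep₃_of, minRep_of, prodRep_algLeg₂₃_eq]

theorem commute_comp_leg₃ (Δ : A →⋆ₐ[ℂ] MinTensor B C) (a : A) (d : D) :
    Commute ((leg₁₂ B C D).comp Δ a) (leg₃ B C D d) := commute_leg₁₂_leg₃ (Δ a) d

theorem commute_leg₁_comp (Δ : B →⋆ₐ[ℂ] MinTensor C D) (a : A) (b : B) :
    Commute (leg₁ A C D a) ((leg₂₃ A C D).comp Δ b) := commute_leg₁_leg₂₃ a (Δ b)

theorem norm_starLift_left_le (Δ : A →⋆ₐ[ℂ] MinTensor B C) (x : A ⊗[ℂ] D) :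
    ‖starLift ((leg₁₂ B C D).comp Δ) (leg₃ B C D) (commute_comp_leg₃ Δ) x‖ ≤
      (minFamily A D).seminorm x := by
  refine norm_le_of_minRep₃ _ (RepFamily.seminorm_nonneg _ x) fun π σ τ => ?_
  have h : minRep₃ π σ τ (starLift ((leg₁₂ B C D).comp Δ) (leg₃ B C D)
      (commute_comp_leg₃ Δ) x) = prodRep ((minRep π σ).comp Δ) τ.rep x := by
    induction x using TensorProduct.induction_on with
    | zero => rw [map_zero, map_zero, map_zero]
    | add a b ha hb => rw [map_add, map_add, map_add, ha, hb]
    | tmul a d =>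
      rw [starLift_tmul, map_mul, minRep₃_leg₃, StarAlgHom.comp_apply, minRep₃_leg₁₂,
        opTensorLeft_apply, opTensorRight_apply, opTensor_one_mul, prodRep_tmul,
        StarAlgHom.comp_apply]
  rw [h]
  exact norm_prodRep_le _ _ x

theorem norm_starLift_right_le (Δ : B →⋆ₐ[ℂ] MinTensor C D) (x : A ⊗[ℂ] B) :
    ‖starLift (leg₁ A C D) ((leg₂₃ A C D).comp Δ) (commute_leg₁_comp Δ) x‖ ≤
      (minFamily A B).seminorm x := by
  refine norm_le_of_minRep₃ _ (RepFamily.seminorm_nonneg _ x) fun π σ τ => ?_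
  have h : minRep₃ π σ τ (starLift (leg₁ A C D) ((leg₂₃ A C D).comp Δ)
      (commute_leg₁_comp Δ) x) =
      assocConj π.space σ.space τ.space (prodRep π.rep ((minRep σ τ).comp Δ) x) := by
    induction x using TensorProduct.induction_on with
    | zero => rw [map_zero, map_zero, map_zero, map_zero]
    | add a b ha hb => rw [map_add, map_add, map_add, map_add, ha, hb]
    | tmul a b =>
      rw [starLift_tmul, map_mul, minRep₃_leg₁, StarAlgHom.comp_apply, minRep₃_leg₂₃,
        ← map_mul, opTensorLeft_apply, opTensorRight_apply, opTensor_one_mul, prodRep_tmul,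
        StarAlgHom.comp_apply]
  rw [h]
  exact (norm_assocConj_le _).trans (norm_prodRep_le _ _ x)

/-- `Δ ⊗ id : A ⊗ D → B ⊗ C ⊗ D`, the continuous extension of `a ⊗ d ↦ Δ(a) ⊗ d`. -/
def tensorId (Δ : A →⋆ₐ[ℂ] MinTensor B C) (D : Type u) [CStarAlgebra D] :
    MinTensor A D →⋆ₐ[ℂ] MinTensor₃ B C D :=
  (minFamily A D).lift (starLift ((leg₁₂ B C D).comp Δ) (leg₃ B C D)
    (commute_comp_leg₃ Δ)) (norm_starLift_left_le Δ)

/-- `id ⊗ Δ : A ⊗ B → A ⊗ C ⊗ D`, the continuous extension of `a ⊗ b ↦ a ⊗ Δ(b)`. -/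
def idTensor (A : Type u) [CStarAlgebra A] (Δ : B →⋆ₐ[ℂ] MinTensor C D) :
    MinTensor A B →⋆ₐ[ℂ] MinTensor₃ A C D :=
  (minFamily A B).lift (starLift (leg₁ A C D) ((leg₂₃ A C D).comp Δ)
    (commute_leg₁_comp Δ)) (norm_starLift_right_le Δ)

end Amplification

/-! ### Compact quantum groups and 2-cocycles -/

/-- A compact quantum group structure on the unital C*-algebra `Q`. -/
structure CompactQuantumGroup (Q : Type u) [CStarAlgebra Q] where
  /-- The comultiplication. -/
  comul : Q →⋆ₐ[ℂ] MinTensor Q Q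
  /-- `(Δ ⊗ id)Δ = (id ⊗ Δ)Δ`. -/
  coassoc : ∀ a, tensorId comul Q (comul a) = idTensor Q comul (comul a)
  /-- The span of `Δ(Q)(1 ⊗ Q)` is dense. -/
  dense_right : Dense (Submodule.span ℂ
    {x | ∃ a b, x = comul a * minRight Q Q b} : Set (MinTensor Q Q))
  /-- The span of `Δ(Q)(Q ⊗ 1)` is dense. -/
  dense_left : Dense (Submodule.span ℂ
    {x | ∃ a b, x = comul a * minLeft Q Q b} : Set (MinTensor Q Q))

namespace CompactQuantumGroup

variable {Q : Type u} [CStarAlgebra Q] (G : CompactQuantumGroup Q)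

/-- A right 2-cocycle: a unitary `Ω` with `(id ⊗ Δ)(Ω)(1 ⊗ Ω) = (Δ ⊗ id)(Ω)(Ω ⊗ 1)`. -/
def IsRightCocycle (Ω : MinTensor Q Q) : Prop :=
  Ω ∈ unitary (MinTensor Q Q) ∧
    idTensor Q G.comul Ω * leg₂₃ Q Q Q Ω = tensorId G.comul Q Ω * leg₁₂ Q Q Q Ω

/-- A left 2-cocycle: a unitary `Ω` with `(1 ⊗ Ω)(id ⊗ Δ)(Ω) = (Ω ⊗ 1)(Δ ⊗ id)(Ω)`. -/
def IsLeftCocycle (Ω : MinTensor Q Q) : Prop :=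
  Ω ∈ unitary (MinTensor Q Q) ∧
    leg₂₃ Q Q Q Ω * idTensor Q G.comul Ω = leg₁₂ Q Q Q Ω * tensorId G.comul Q Ω

/-- The twisted map `Δ_Ω(x) = Δ(x)Ω`. -/
def comulTwistRight (Ω : MinTensor Q Q) : Q →ₗ[ℂ] MinTensor Q Q :=
  LinearMap.mulRight ℂ Ω ∘ₗ G.comul.toAlgHom.toLinearMap

/-- The twisted map `_ΩΔ(x) = ΩΔ(x)`. -/
def comulTwistLeft (Ω : MinTensor Q Q) : Q →ₗ[ℂ] MinTensor Q Q :=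
  LinearMap.mulLeft ℂ Ω ∘ₗ G.comul.toAlgHom.toLinearMap

end CompactQuantumGroup

/-! ### The conjugate Hilbert space -/

/-- The conjugate Hilbert space: the same vectors, with conjugate scalar multiplication and
inner product. -/
def Conj (H : Type v) : Type v := H

namespace Conj

variable {H : Type v} [NormedAddCommGroup H] [InnerProductSpace ℂ H]

/-- The vector `x`, seen in the conjugate space. -/
def bar (x : H) : Conj H := x

/-- The vector of `H` underlying a vector of the conjugate space. -/
def unbar (x : Conj H) : H := x

instance : NormedAddCommGroup (Conj H) := inferInstanceAs (NormedAddCommGroup H)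

instance : Module ℂ (Conj H) := Module.compHom H (starRingEnd ℂ)

theorem smul_bar (c : ℂ) (x : H) : c • bar x = bar (starRingEnd ℂ c • x) := rfl

instance : InnerProductSpace ℂ (Conj H) where
  inner x y := ⟪unbar y, unbar x⟫_ℂ
  norm_smul_le c x := by
    change ‖starRingEnd ℂ c • unbar x‖ ≤ ‖c‖ * ‖unbar x‖
    rw [norm_smul, RCLike.norm_conj]
  norm_sq_eq_re_inner x := norm_sq_eq_re_inner (𝕜 := ℂ) (unbar x)
  conj_inner_symm x y := inner_conj_symm (unbar y) (unbar x)
  add_left x y z := inner_add_right (unbar z) (unbar x) (unbar y)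
  smul_left x y c := inner_smul_right (unbar y) (unbar x) (starRingEnd ℂ c)

theorem inner_bar (x y : H) : ⟪bar x, bar y⟫_ℂ = ⟪y, x⟫_ℂ := rfl

/-- The conjugate-linear map `x ↦ x̄`. -/
def barₛₗ : H →ₛₗ[starRingEnd ℂ] Conj H where
  toFun := bar
  map_add' _ _ := rfl
  map_smul' c x := by rw [smul_bar, RingHomCompTriple.comp_apply, RingHom.id_apply]

instance [FiniteDimensional ℂ H] : FiniteDimensional ℂ (Conj H) :=
  Module.Finite.of_surjective (barₛₗ (H := H)) fun x => ⟨unbar x, rfl⟩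

end Conj

/-! ### Corepresentations on finite-dimensional Hilbert spaces

For a finite-dimensional Hilbert space `H` every linear operator is bounded, and `B(H) ⊗ Q` is
the algebraic tensor product. -/

section Operators

variable (H : Type v) [NormedAddCommGroup H] [InnerProductSpace ℂ H]

/-- The algebra `B(H)` of all operators on a finite-dimensional Hilbert space. -/
def BoundedOp : Type v := Module.End ℂ H

instance : Ring (BoundedOp H) := inferInstanceAs (Ring (Module.End ℂ H))
instance : Algebra ℂ (BoundedOp H) := inferInstanceAs (Algebra ℂ (Module.End ℂ H))

/-- The involution of `B(H)` is the adjoint. -/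
instance [FiniteDimensional ℂ H] : StarRing (BoundedOp H) :=
  inferInstanceAs (StarRing (Module.End ℂ H))

instance [FiniteDimensional ℂ H] : StarModule ℂ (BoundedOp H) :=
  inferInstanceAs (StarModule ℂ (Module.End ℂ H))

/-- The identity map, from linear endomorphisms to `B(H)`. -/
def toBoundedOp : Module.End ℂ H ≃ₐ[ℂ] BoundedOp H := AlgEquiv.refl

end Operators

section Corepresentations

variable {Q : Type u} [CStarAlgebra Q]
variable {H K : Type v} [NormedAddCommGroup H] [InnerProductSpace ℂ H] [FiniteDimensional ℂ H]
  [NormedAddCommGroup K] [InnerProductSpace ℂ K] [FiniteDimensional ℂ K]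

/-- The canonical linear anti-multiplicative map `j : B(H) → B(H̄)`, `j(T) x̄ = (T* x)‾`. -/
def conjOp : BoundedOp H →ₗ[ℂ] BoundedOp (Conj H) :=
  (toBoundedOp (Conj H)).toLinearMap ∘ₗ
    ({ toFun := fun T =>
        { toFun := fun x => Conj.bar (LinearMap.adjoint T x.unbar)
          map_add' := fun x y => map_add (LinearMap.adjoint T) x.unbar y.unbar
          map_smul' := fun c x => map_smul (LinearMap.adjoint T) (starRingEnd ℂ c) x.unbar }
       map_add' := fun S T => by
        refine LinearMap.ext fun x => ?_
        change LinearMap.adjoint (S + T) x.unbar = LinearMap.adjoint S x.unbar +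
          LinearMap.adjoint T x.unbar
        rw [map_add, LinearMap.add_apply]
       map_smul' := fun c T => by
        refine LinearMap.ext fun x => ?_
        change LinearMap.adjoint (c • T) x.unbar =
          starRingEnd ℂ c • LinearMap.adjoint T x.unbar
        rw [map_smulₛₗ, LinearMap.smul_apply] } :
      Module.End ℂ H →ₗ[ℂ] Module.End ℂ (Conj H)) ∘ₗ
    (toBoundedOp H).symm.toLinearMap

/-- `U^c = (j ⊗ id)(U*)`. -/
def conjugate (U : BoundedOp H ⊗[ℂ] Q) : BoundedOp (Conj H) ⊗[ℂ] Q :=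
  LinearMap.rTensor Q conjOp (star U)

/-- `id ⊗ f : B(H) ⊗ A → B(H) ⊗ B`. -/
def idAmp {A B : Type*} [Ring A] [Algebra ℂ A] [Star A] [Ring B] [Algebra ℂ B] [Star B]
    (f : A →⋆ₐ[ℂ] B) : BoundedOp H ⊗[ℂ] A →ₐ[ℂ] BoundedOp H ⊗[ℂ] B :=
  Algebra.TensorProduct.map (AlgHom.id ℂ (BoundedOp H)) f.toAlgHom

/-- `U₁₂ = U ⊗ 1` in `B(H) ⊗ Q ⊗ Q`. -/
def U₁₂ (U : BoundedOp H ⊗[ℂ] Q) : BoundedOp H ⊗[ℂ] MinTensor Q Q :=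
  idAmp (minLeft Q Q) U

/-- `U₁₃` in `B(H) ⊗ Q ⊗ Q`: the second leg of `U` is put in the last place. -/
def U₁₃ (U : BoundedOp H ⊗[ℂ] Q) : BoundedOp H ⊗[ℂ] MinTensor Q Q :=
  idAmp (minRight Q Q) U

/-- `S ↦ S ⊗ 1`, from `B(H)` to `B(H ⊗ K)`. -/
def opLeft (H K : Type v) [NormedAddCommGroup H] [InnerProductSpace ℂ H]
    [NormedAddCommGroup K] [InnerProductSpace ℂ K] : BoundedOp H →ₐ[ℂ] BoundedOp (H ⊗[ℂ] K) :=
  (toBoundedOp (H ⊗[ℂ] K)).toAlgHom.comp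
    ((Module.End.rTensorAlgHom ℂ H K).comp (toBoundedOp H).symm.toAlgHom)

/-- `T ↦ 1 ⊗ T`, from `B(K)` to `B(H ⊗ K)`. -/
def opRight (H K : Type v) [NormedAddCommGroup H] [InnerProductSpace ℂ H]
    [NormedAddCommGroup K] [InnerProductSpace ℂ K] : BoundedOp K →ₐ[ℂ] BoundedOp (H ⊗[ℂ] K) :=
  (toBoundedOp (H ⊗[ℂ] K)).toAlgHom.comp
    ((Module.End.lTensorAlgHom ℂ K H).comp (toBoundedOp K).symm.toAlgHom)

/-- The tensor product `U ⊗ V = U₁₃ V₂₃` in `B(H ⊗ K) ⊗ Q`. -/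
def tensorCorep (U : BoundedOp H ⊗[ℂ] Q) (V : BoundedOp K ⊗[ℂ] Q) :
    BoundedOp (H ⊗[ℂ] K) ⊗[ℂ] Q :=
  Algebra.TensorProduct.map (opLeft H K) (AlgHom.id ℂ Q) U *
    Algebra.TensorProduct.map (opRight H K) (AlgHom.id ℂ Q) V

/-- `(s ⊗ 1) U (s⁻¹ ⊗ 1)`. -/
def conjBy (s : (BoundedOp H)ˣ) (U : BoundedOp H ⊗[ℂ] Q) : BoundedOp H ⊗[ℂ] Q :=
  ((s : BoundedOp H) ⊗ₜ[ℂ] (1 : Q)) * U * (((s⁻¹ : (BoundedOp H)ˣ) : BoundedOp H) ⊗ₜ[ℂ] 1)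

/-- `s = ρ^{1/2}`: the invertible operator `ρ` is positive, and `s` is its positive square
root. -/
def IsPosSqrt (s ρ : (BoundedOp H)ˣ) : Prop :=
  ((toBoundedOp H).symm ρ).IsPositive ∧ ((toBoundedOp H).symm s).IsPositive ∧ s * s = ρ

namespace CompactQuantumGroup

variable (G : CompactQuantumGroup Q)

/-- A corepresentation: `(id ⊗ Δ)(U) = U₁₂ U₁₃`. -/
def IsCorep (U : BoundedOp H ⊗[ℂ] Q) : Prop :=
  idAmp G.comul U = U₁₂ U * U₁₃ U

/-- A unitary corepresentation. -/
def IsUnitaryCorep (U : BoundedOp H ⊗[ℂ] Q) : Prop :=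
  U ∈ unitary (BoundedOp H ⊗[ℂ] Q) ∧ G.IsCorep U

/-- An invertible corepresentation. -/
def IsInvertibleCorep (U : BoundedOp H ⊗[ℂ] Q) : Prop :=
  IsUnit U ∧ G.IsCorep U

/-- A right projective corepresentation: a unitary `U` with `(id ⊗ Δ_Ω)(U) = U₁₂ U₁₃` for a
right 2-cocycle `Ω`, where `Δ_Ω(x) = Δ(x)Ω`. -/
def IsRightProjective (U : BoundedOp H ⊗[ℂ] Q) : Prop :=
  U ∈ unitary (BoundedOp H ⊗[ℂ] Q) ∧ ∃ Ω, G.IsRightCocycle Ω ∧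
    LinearMap.lTensor (BoundedOp H) (G.comulTwistRight Ω) U = U₁₂ U * U₁₃ U

/-- A left projective corepresentation: a unitary `U` with `(id ⊗ _ΩΔ)(U) = U₁₂ U₁₃` for a
left 2-cocycle `Ω`, where `_ΩΔ(x) = ΩΔ(x)`. -/
def IsLeftProjective (U : BoundedOp H ⊗[ℂ] Q) : Prop :=
  U ∈ unitary (BoundedOp H ⊗[ℂ] Q) ∧ ∃ Ω, G.IsLeftCocycle Ω ∧
    LinearMap.lTensor (BoundedOp H) (G.comulTwistLeft Ω) U = U₁₂ U * U₁₃ U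

/-- A bi-projective corepresentation: left and right projective, with possibly different
2-cocycles. -/
def IsBiProjective (U : BoundedOp H ⊗[ℂ] Q) : Prop :=
  G.IsLeftProjective U ∧ G.IsRightProjective U

end CompactQuantumGroup

end Corepresentations

end CQG

end

set_option linter.unusedSectionVars false

noncomputable section

open scoped ComplexOrder

namespace CQG

/-! ### Positive functionals and their representations -/

section PositiveFunctionals

variable {Q : Type u} [CStarAlgebra Q]

/-! In an orthonormal basis `U` is a unitary matrix (u_ij) over Q, U^c is its entrywise adjoint A =
(u_ij*), and U ⊗ U^c has the entries u_ij u_kl*. Put L = U₁₂U₁₃. Then U ⊗ U^c is a corepresentation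
exactly when Δ(u_ij)Δ(u_kl)* = L_ij L_kl* for all indices. If Δ(u_ij)Ω = L_ij with Ω unitary, this
is immediate. Conversely, for any fixed column r, Ω = Σ_k Δ(u_kr)* L_kr is unitary and satisfies
Δ(u_ij)Ω = L_ij; the cocycle identity follows because both of its sides, multiplied by (id ⊗
Δ)Δ(u_ij), become the (i,j) entry of U₁₂U₁₃U₁₄. The left case is the mirror image
(`exists_rightCocycle_iff`, `exists_leftCocycle_iff`). Conjugating one factor by an invertible
scalar matrix does not affect the corepresentation identity.

What remains is analytic: if U ⊗ U^c is a corepresentation, then A is similar to a unitary through a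
positive scalar matrix. Let h be the Haar state and ρ = (id ⊗ h)(A*A). As U is unitary, W = U ⊗ A
satisfies W*W = 1 ⊗ A*A, and left invariance of h turns this into A*ρA = ρ. Once ρ is known to be
invertible, B = ρ^{1/2}Aρ^{-1/2} is an isometry, U ⊗ B is an isometric corepresentation, isometric
corepresentations are unitary (`IsHaar.mul_star_eq_one`), and so B is unitary.

Both the invertibility of ρ and the last fact need control over the null vectors of h, which may
fail to be faithful. The key is that for the coefficients w_ij of a finite-dimensional
corepresentation, h(w_ij* w_ij) = 0 for all i, j if and only if h(w_ij w_ij*) = 0 for all i, j. It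
is derived in `IsHaar.coeff_null` from the strong invariance of h. If q is the kernel projection of
ρ, then U ⊗ Aq is a corepresentation with null coefficients x; hence h(xb) = 0 for every b, while a
suitable sum of terms xb is the scalar q_{l'l}, which forces q = 0.

The Haar state is a state fixed by convolution with every state. For one state it is a limit of
Cesàro means; compactness and a Cauchy–Schwarz argument for means of two states give a common fixed
point. Convolution rests on slice maps of the minimal tensor product, which are bounded for positive
functionals by the GNS construction.

In the bi-projective case one ρ serves both sides, because either tensor product is unitary as soon
as U^c_ρ is. -/

/-- A positive functional on a C*-algebra. -/
def IsPosFunctional (f : Q →L[ℂ] ℂ) : Prop := ∀ a, 0 ≤ f (star a * a)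

/-- This is the GNS representation, with the class of 1 as vector. Writing f as a vector functional
turns Cauchy–Schwarz and the boundedness of slice maps into Hilbert space estimates. -/
theorem exists_rep_of_isPosFunctional {f : Q →L[ℂ] ℂ} (hf : IsPosFunctional f) :
    ∃ (π : HilbertRep Q) (ζ : π.space), ∀ a, f a = ⟪ζ, π.rep a ζ⟫_ℂ := by
  let _ := CStarAlgebra.spectralOrder Q
  have _ := CStarAlgebra.spectralOrderedRing Q
  let g : Q →ₚ[ℂ] ℂ := PositiveLinearMap.mk₀ f.toLinearMap fun a ha => by
    obtain ⟨b, rfl⟩ := CStarAlgebra.nonneg_iff_eq_star_mul_self.1 ha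
    exact hf b
  refine ⟨⟨g.GNS, g.gnsStarAlgHom⟩, ((g.toPreGNS 1 : g.PreGNS) : g.GNS), fun a => ?_⟩
  change f a = ⟪((g.toPreGNS 1 : g.PreGNS) : g.GNS),
    g.gnsNonUnitalStarAlgHom a ((g.toPreGNS 1 : g.PreGNS) : g.GNS)⟫_ℂ
  rw [PositiveLinearMap.gnsNonUnitalStarAlgHom_apply_coe, UniformSpace.Completion.inner_coe,
    PositiveLinearMap.preGNS_inner_def]
  simp only [PositiveLinearMap.ofPreGNS_toPreGNS, PositiveLinearMap.leftMulMapPreGNS_apply,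
    star_one, one_mul, mul_one]
  rfl

theorem isPosFunctional_of_rep (π : HilbertRep Q) (ζ : π.space) {f : Q →L[ℂ] ℂ}
    (hf : ∀ a, f a = ⟪ζ, π.rep a ζ⟫_ℂ) : IsPosFunctional f := by
  intro a
  rw [hf, map_mul, map_star, ContinuousLinearMap.star_eq_adjoint, mul_apply_eq_comp,
    ContinuousLinearMap.adjoint_inner_right]
  rw [inner_self_eq_norm_sq_to_K]
  have h := Complex.zero_le_real.2 (sq_nonneg ‖π.rep a ζ‖)
  rwa [Complex.ofReal_pow] at h

/-- Testing f on a + it gives (Im f(a) + t)² ≤ ‖a‖² + t² for every real t; the term 2t Im f(a) is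
linear in t and nothing on the right can absorb it. -/
theorem im_eq_zero_of_norm_le_one {f : Q →L[ℂ] ℂ} (hf : ‖f‖ ≤ 1) (h1 : f 1 = 1) {a : Q}
    (ha : IsSelfAdjoint a) : (f a).im = 0 := by
  have _ : Nontrivial Q := ⟨1, 0, fun h => by simp [h] at h1⟩
  have key : ∀ t : ℝ, ((f a).im + t) ^ 2 ≤ ‖a‖ ^ 2 + t ^ 2 := by
    intro t
    let b : Q := a + (t * Complex.I) • (1 : Q)
    have hb : star b * b = a * a + ((t : ℂ) ^ 2) • (1 : Q) := by
      simp only [b, star_add, star_smul, star_one, ha.star_eq, Complex.star_def, map_mul,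
        Complex.conj_ofReal, Complex.conj_I]
      simp only [add_mul, mul_add, smul_mul_assoc, mul_smul_comm, one_mul, mul_one, smul_add, smul_smul]
      have : (t * Complex.I * (t * -Complex.I) : ℂ) = (t : ℂ) ^ 2 := by
        ring_nf; simp
      rw [this]
      module
    have hn : ‖b‖ ^ 2 ≤ ‖a‖ ^ 2 + t ^ 2 := by
      rw [sq, ← CStarRing.norm_star_mul_self, hb]
      refine (norm_add_le _ _).trans (add_le_add ((norm_mul_le _ _).trans_eq (sq _).symm) ?_)
      rw [norm_smul]
      refine (mul_le_of_le_one_right (norm_nonneg _) (norm_one (α := Q)).le).trans ?_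
      simp
    have hfb : f b = f a + t * Complex.I := by
      simp [b, h1]
    have h2 : ‖f b‖ ≤ ‖b‖ := (f.le_opNorm b).trans (mul_le_of_le_one_left (norm_nonneg _) hf)
    have h3 : |(f b).im| ≤ ‖b‖ := (Complex.abs_im_le_norm _).trans h2
    have h4 : (f b).im = (f a).im + t := by rw [hfb]; simp
    rw [h4] at h3
    exact (sq_le_sq' (by linarith [neg_abs_le ((f a).im + t)]) (le_of_abs_le h3)).trans hn
  by_contra hne
  -- This t makes the cross term 2t Im f(a) equal to ‖a‖² + 1, which exceeds the bound.
  have h := key ((‖a‖ ^ 2 + 1) / (2 * (f a).im))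
  have h5 : 2 * (f a).im * ((‖a‖ ^ 2 + 1) / (2 * (f a).im)) = ‖a‖ ^ 2 + 1 := by
    field_simp
  nlinarith [sq_nonneg (f a).im]

/-- For b = a*a one has 0 ≤ ‖b‖ - b ≤ ‖b‖, so ‖b‖ - f(b) has modulus at most ‖b‖ and f(b) cannot
have negative real part. -/
theorem isPosFunctional_of_norm_le_one {f : Q →L[ℂ] ℂ} (hf : ‖f‖ ≤ 1) (h1 : f 1 = 1) :
    IsPosFunctional f := by
  let _ := CStarAlgebra.spectralOrder Q
  have _ := CStarAlgebra.spectralOrderedRing Q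
  intro a
  set b := star a * a with hb
  have hsa : IsSelfAdjoint b := IsSelfAdjoint.star_mul_self a
  have hb0 : 0 ≤ b := star_mul_self_nonneg a
  rw [Complex.nonneg_iff]
  refine ⟨?_, (im_eq_zero_of_norm_le_one hf h1 hsa).symm⟩
  have h2 : ‖(‖b‖ : ℂ) • (1 : Q) - b‖ ≤ ‖b‖ := by
    have h3 : (‖b‖ : ℂ) • (1 : Q) = algebraMap ℝ Q ‖b‖ := by
      rw [Algebra.algebraMap_eq_smul_one, ← Complex.coe_smul]
    rw [h3]
    have h4 : 0 ≤ algebraMap ℝ Q ‖b‖ - b := sub_nonneg.2 hsa.le_algebraMap_norm_self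
    rcases subsingleton_or_nontrivial Q with _ | _
    · rw [Subsingleton.elim (algebraMap ℝ Q ‖b‖ - b) 0, norm_zero]; exact norm_nonneg _
    · refine (CStarAlgebra.norm_le_norm_of_nonneg_of_le h4 (sub_le_self _ hb0)).trans ?_
      rw [norm_algebraMap']; simp
  have h5 : ‖f ((‖b‖ : ℂ) • (1 : Q) - b)‖ ≤ ‖b‖ :=
    (f.le_opNorm _).trans ((mul_le_of_le_one_left (norm_nonneg _) hf).trans h2)
  have h6 := (Complex.re_le_norm _).trans h5
  rw [map_sub, map_smul, h1] at h6
  simp at h6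
  linarith

/-- Apply Hahn–Banach not to b = a*a but to c = ‖b‖1 + b, whose norm is 2‖b‖: a norm-one functional
attaining ‖c‖ must attain its bounds on 1 and on b separately, hence is a state norming b. -/
theorem exists_state_norming [Nontrivial Q] (a : Q) :
    ∃ f : Q →L[ℂ] ℂ, IsPosFunctional f ∧ f 1 = 1 ∧ f (star a * a) = (‖a‖ : ℂ) ^ 2 := by
  let _ := CStarAlgebra.spectralOrder Q
  have _ := CStarAlgebra.spectralOrderedRing Q
  rcases eq_or_ne a 0 with rfl | ha
  · obtain ⟨g, hg, hg1⟩ := exists_dual_vector' ℂ (1 : Q)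
    have h1 : g 1 = 1 := by rw [hg1]; simp
    exact ⟨g, isPosFunctional_of_norm_le_one hg.le h1, h1, by simp⟩
  set b := star a * a with hb
  have hbn : ‖b‖ = ‖a‖ ^ 2 := by rw [hb, CStarRing.norm_star_mul_self, sq]
  have hb0 : 0 < ‖b‖ := by rw [hbn]; positivity
  have hbp : 0 ≤ b := star_mul_self_nonneg a
  let c : Q := (‖b‖ : ℂ) • (1 : Q) + b
  have hc : ‖c‖ = 2 * ‖b‖ := by
    refine le_antisymm ?_ ?_
    · refine (norm_add_le _ _).trans ?_
      rw [norm_smul, norm_one]; simp; linarith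
    · have h3 : c = algebraMap ℝ Q ‖b‖ + b := by
        rw [Algebra.algebraMap_eq_smul_one, ← Complex.coe_smul]
      have h4 : ‖b‖ + ‖b‖ ∈ spectrum ℝ c := by
        rw [h3]
        exact spectrum.add_mem_add_iff.2 (CStarAlgebra.norm_mem_spectrum_of_nonneg hbp)
      have h5 := spectrum.norm_le_norm_of_mem h4
      rw [Real.norm_of_nonneg (by positivity)] at h5
      linarith
  obtain ⟨g, hg, hgc⟩ := exists_dual_vector' ℂ c
  have e1 : ‖g 1‖ ≤ 1 := (g.le_opNorm _).trans (by rw [hg]; simp)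
  have e2 : ‖g b‖ ≤ ‖b‖ := (g.le_opNorm _).trans (by rw [hg]; simp)
  have e3 : (‖b‖ : ℂ) * g 1 + g b = 2 * ‖b‖ := by
    have := hgc
    rw [hc] at this
    simpa [c] using this
  have r1 := (Complex.re_le_norm _).trans e1
  have r2 := (Complex.re_le_norm _).trans e2
  have r3 := congrArg Complex.re e3
  simp at r3
  -- The real parts of g(1) and g(b) are at most 1 and ‖b‖, and r3 leaves no slack. The imaginary
  -- parts then vanish because the moduli obey the same bounds.
  have r4 : (g 1).re = 1 := by nlinarith
  have r5 : (g b).re = ‖b‖ := by rw [r4] at r3; linarith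
  have h1 : g 1 = 1 := by
    refine Complex.ext r4 ?_
    have := Complex.sq_norm_sub_sq_re (g 1)
    simp
    nlinarith [norm_nonneg (g 1)]
  have h2 : g b = ‖b‖ := by
    refine Complex.ext (by simpa using r5) ?_
    have := Complex.sq_norm_sub_sq_re (g b)
    simp
    nlinarith [norm_nonneg (g b)]
  exact ⟨g, isPosFunctional_of_norm_le_one hg.le h1, h1, by rw [h2, hbn]; push_cast; rfl⟩

/-- The GNS vector of a norming state is a unit vector ζ with ‖π(a)ζ‖ = ‖a‖. This allows norms in a
C*-algebra to be estimated in representations, where the minimal norm is defined. -/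
theorem norm_le_of_forall_rep {a : Q} {c : ℝ} (hc : 0 ≤ c)
    (h : ∀ π : HilbertRep Q, ‖π.rep a‖ ≤ c) : ‖a‖ ≤ c := by
  rcases subsingleton_or_nontrivial Q with _ | _
  · rwa [Subsingleton.elim a 0, norm_zero]
  obtain ⟨f, hf, h1, hfa⟩ := exists_state_norming a
  obtain ⟨π, ζ, hπ⟩ := exists_rep_of_isPosFunctional hf
  have hζ : ‖ζ‖ ^ 2 = 1 := by
    have := hπ 1
    rw [h1, map_one, one_apply_eq_self, inner_self_eq_norm_sq_to_K] at this
    exact Complex.ofReal_injective (by push_cast; exact this.symm)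
  have h2 : ‖π.rep a ζ‖ ^ 2 = ‖a‖ ^ 2 := by
    have := hπ (star a * a)
    rw [hfa, map_mul, map_star, ContinuousLinearMap.star_eq_adjoint,
      mul_apply_eq_comp, ContinuousLinearMap.adjoint_inner_right,
      inner_self_eq_norm_sq_to_K] at this
    exact Complex.ofReal_injective (by push_cast; exact this.symm)
  have hζ1 : ‖ζ‖ = 1 := by nlinarith [norm_nonneg ζ]
  have h3 : ‖π.rep a ζ‖ = ‖a‖ := by
    rwa [sq_eq_sq₀ (norm_nonneg _) (norm_nonneg _)] at h2
  rw [← h3]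
  calc _ ≤ ‖π.rep a‖ * ‖ζ‖ := (π.rep a).le_opNorm ζ
    _ ≤ c := by rw [hζ1, mul_one]; exact h π

end PositiveFunctionals


/-! ### Slice maps -/

section AlgebraicSlices

variable {H K : Type*} [NormedAddCommGroup H] [InnerProductSpace ℂ H]
  [NormedAddCommGroup K] [InnerProductSpace ℂ K]

theorem opNorm_le_of_inner {T : H →L[ℂ] H} {c : ℝ} (hc : 0 ≤ c)
    (h : ∀ ξ η, ‖⟪ξ, T η⟫_ℂ‖ ≤ c * ‖ξ‖ * ‖η‖) : ‖T‖ ≤ c := by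
  refine T.opNorm_le_bound hc fun η => ?_
  have h1 := h (T η) η
  rw [inner_self_eq_norm_sq_to_K, norm_pow, RCLike.norm_ofReal, abs_norm] at h1
  rcases eq_or_ne (‖T η‖) 0 with h0 | h0
  · rw [h0]; positivity
  · have h2 : 0 < ‖T η‖ := lt_of_le_of_ne (norm_nonneg _) (Ne.symm h0)
    refine le_of_mul_le_mul_left ?_ h2
    calc _ = ‖T η‖ ^ 2 := (sq _).symm
      _ ≤ _ := h1
      _ = _ := by ring

theorem norm_inner_toHilbertTensor_le (T : HilbertTensor H K →L[ℂ] HilbertTensor H K)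
    (ξ η : H) (ζ ζ' : K) :
    ‖⟪toHilbertTensor H K (ξ ⊗ₜ ζ), T (toHilbertTensor H K (η ⊗ₜ ζ'))⟫_ℂ‖ ≤
      ‖T‖ * (‖ξ‖ * ‖ζ‖) * (‖η‖ * ‖ζ'‖) := by
  refine (norm_inner_le_norm _ _).trans ?_
  refine (mul_le_mul_of_nonneg_left (T.le_opNorm _) (norm_nonneg _)).trans_eq ?_
  rw [LinearIsometry.norm_map, LinearIsometry.norm_map, TensorProduct.norm_tmul,
    TensorProduct.norm_tmul]
  ring

variable {A B : Type*} [Ring A] [Algebra ℂ A] [Ring B] [Algebra ℂ B]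

/-- `id ⊗ f` on the algebraic tensor product. -/
def algSliceRight (A : Type*) [Ring A] [Algebra ℂ A] (f : B →ₗ[ℂ] ℂ) : A ⊗[ℂ] B →ₗ[ℂ] A :=
  (TensorProduct.rid ℂ A).toLinearMap ∘ₗ LinearMap.lTensor A f

/-- `f ⊗ id` on the algebraic tensor product. -/
def algSliceLeft (B : Type*) [Ring B] [Algebra ℂ B] (f : A →ₗ[ℂ] ℂ) : A ⊗[ℂ] B →ₗ[ℂ] B :=
  (TensorProduct.lid ℂ B).toLinearMap ∘ₗ LinearMap.rTensor B f

theorem algSliceRight_tmul (f : B →ₗ[ℂ] ℂ) (a : A) (b : B) :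
    algSliceRight A f (a ⊗ₜ b) = f b • a := by
  simp [algSliceRight]

theorem algSliceLeft_tmul (f : A →ₗ[ℂ] ℂ) (a : A) (b : B) :
    algSliceLeft B f (a ⊗ₜ b) = f a • b := by
  simp [algSliceLeft]

variable [StarRing A] [StarModule ℂ A] [StarRing B] [StarModule ℂ B]
  [CompleteSpace H] [CompleteSpace K]

/-- When f is the vector functional of ζ, the slice id ⊗ f is the compression of π ⊗ σ to H ⊗ ζ. The
norm bound ‖ζ‖² for slices comes from here. -/
theorem inner_rep_algSliceRight (π : A →⋆ₐ[ℂ] (H →L[ℂ] H)) (σ : B →⋆ₐ[ℂ] (K →L[ℂ] K))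
    (ζ : K) (f : B →ₗ[ℂ] ℂ) (hf : ∀ b, f b = ⟪ζ, σ b ζ⟫_ℂ) (x : A ⊗[ℂ] B) (ξ η : H) :
    ⟪ξ, π (algSliceRight A f x) η⟫_ℂ =
      ⟪toHilbertTensor H K (ξ ⊗ₜ ζ), prodRep π σ x (toHilbertTensor H K (η ⊗ₜ ζ))⟫_ℂ := by
  induction x using TensorProduct.induction_on with
  | zero => simp only [map_zero, zero_apply, inner_zero_right]
  | add a b ha hb => simp only [map_add, add_apply, inner_add_right, ha, hb]
  | tmul a b =>
    rw [algSliceRight_tmul, prodRep_tmul, opTensor_coe, LinearIsometry.inner_map_map,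
      TensorProduct.mapL_tmul, TensorProduct.inner_tmul, map_smul, smul_apply, inner_smul_right,
      hf, mul_comm]

theorem inner_rep_algSliceLeft (π : A →⋆ₐ[ℂ] (H →L[ℂ] H)) (σ : B →⋆ₐ[ℂ] (K →L[ℂ] K))
    (ζ : H) (f : A →ₗ[ℂ] ℂ) (hf : ∀ a, f a = ⟪ζ, π a ζ⟫_ℂ) (x : A ⊗[ℂ] B) (ξ η : K) :
    ⟪ξ, σ (algSliceLeft B f x) η⟫_ℂ =
      ⟪toHilbertTensor H K (ζ ⊗ₜ ξ), prodRep π σ x (toHilbertTensor H K (ζ ⊗ₜ η))⟫_ℂ := by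
  induction x using TensorProduct.induction_on with
  | zero => simp only [map_zero, zero_apply, inner_zero_right]
  | add a b ha hb => simp only [map_add, add_apply, inner_add_right, ha, hb]
  | tmul a b =>
    rw [algSliceLeft_tmul, prodRep_tmul, opTensor_coe, LinearIsometry.inner_map_map,
      TensorProduct.mapL_tmul, TensorProduct.inner_tmul, map_smul, smul_apply, inner_smul_right,
      hf]

theorem norm_rep_algSliceRight_le (π : A →⋆ₐ[ℂ] (H →L[ℂ] H)) (σ : B →⋆ₐ[ℂ] (K →L[ℂ] K))
    (ζ : K) (f : B →ₗ[ℂ] ℂ) (hf : ∀ b, f b = ⟪ζ, σ b ζ⟫_ℂ) (x : A ⊗[ℂ] B) :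
    ‖π (algSliceRight A f x)‖ ≤ ‖ζ‖ ^ 2 * ‖prodRep π σ x‖ := by
  refine opNorm_le_of_inner (by positivity) fun ξ η => ?_
  rw [inner_rep_algSliceRight π σ ζ f hf]
  refine (norm_inner_toHilbertTensor_le _ _ _ _ _).trans_eq ?_
  ring

theorem norm_rep_algSliceLeft_le (π : A →⋆ₐ[ℂ] (H →L[ℂ] H)) (σ : B →⋆ₐ[ℂ] (K →L[ℂ] K))
    (ζ : H) (f : A →ₗ[ℂ] ℂ) (hf : ∀ a, f a = ⟪ζ, π a ζ⟫_ℂ) (x : A ⊗[ℂ] B) :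
    ‖σ (algSliceLeft B f x)‖ ≤ ‖ζ‖ ^ 2 * ‖prodRep π σ x‖ := by
  refine opNorm_le_of_inner (by positivity) fun ξ η => ?_
  rw [inner_rep_algSliceLeft π σ ζ f hf]
  refine (norm_inner_toHilbertTensor_le _ _ _ _ _).trans_eq ?_
  ring

end AlgebraicSlices

section Slices

variable {A B C : Type u} [CStarAlgebra A] [CStarAlgebra B] [CStarAlgebra C]

theorem minLeft_apply (a : A) : minLeft A B a = (minFamily A B).of (a ⊗ₜ 1) := rfl

theorem minRight_apply (b : B) : minRight A B b = (minFamily A B).of (1 ⊗ₜ b) := rfl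

theorem of_tmul (a : A) (b : B) :
    (minFamily A B).of (a ⊗ₜ b) = minLeft A B a * minRight A B b := by
  rw [minLeft_apply, minRight_apply, ← map_mul, Algebra.TensorProduct.tmul_mul_tmul, one_mul,
    mul_one]

theorem of_tmul' (a : A) (b : B) :
    (minFamily A B).of (a ⊗ₜ b) = minRight A B b * minLeft A B a := by
  rw [minLeft_apply, minRight_apply, ← map_mul, Algebra.TensorProduct.tmul_mul_tmul, one_mul,
    mul_one]

theorem minLeft_mul_minRight (a : A) (b : B) :
    minLeft A B a * minRight A B b = minRight A B b * minLeft A B a := by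
  rw [← of_tmul, of_tmul']

/-- Continuous linear maps on the minimal tensor product are determined by elementary tensors. -/
theorem minTensor_ext {D : Type*} [NormedAddCommGroup D] [NormedSpace ℂ D]
    {S T : MinTensor A B →L[ℂ] D}
    (h : ∀ a b, S (minLeft A B a * minRight A B b) = T (minLeft A B a * minRight A B b)) :
    S = T := by
  ext x
  refine RepFamily.induction_on_of x (isClosed_eq S.continuous T.continuous) fun y => ?_
  induction y using TensorProduct.induction_on with
  | zero => simp only [map_zero]
  | add a b ha hb => simp only [map_add, ha, hb]
  | tmul a b => rw [of_tmul, h]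

theorem of_tmul₃ (a : A) (b : B) (c : C) :
    (minFamily₃ A B C).of ((a ⊗ₜ b) ⊗ₜ c) =
      leg₁₂ A B C (minLeft A B a * minRight A B b) * leg₃ A B C c := by
  rw [← of_tmul, leg₁₂_of, leg₃_apply, ← map_mul, algLeg₁₂_apply,
    Algebra.TensorProduct.tmul_mul_tmul, one_mul, mul_one]

theorem minTensor₃_ext {D : Type*} [NormedAddCommGroup D] [NormedSpace ℂ D]
    {S T : MinTensor₃ A B C →L[ℂ] D}
    (h : ∀ a b c, S ((minFamily₃ A B C).of ((a ⊗ₜ b) ⊗ₜ c)) =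
      T ((minFamily₃ A B C).of ((a ⊗ₜ b) ⊗ₜ c))) :
    S = T := by
  ext x
  refine RepFamily.induction_on_of x (isClosed_eq S.continuous T.continuous) fun y => ?_
  induction y using TensorProduct.induction_on with
  | zero => simp only [map_zero]
  | add a b ha hb => simp only [map_add, ha, hb]
  | tmul y c =>
    induction y using TensorProduct.induction_on with
    | zero => simp only [map_zero, TensorProduct.zero_tmul]
    | add a b ha hb => simp only [map_add, TensorProduct.add_tmul, ha, hb]
    | tmul a b => rw [h]

variable (A) in
/-- The slice map `id ⊗ f : A ⊗ B → A`. -/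
def sliceRight (f : B →L[ℂ] ℂ) : MinTensor A B →L[ℂ] A :=
  (algSliceRight A f.toLinearMap).extendOfNorm (minFamily A B).of.toAlgHom.toLinearMap

variable (B) in
/-- The slice map `f ⊗ id : A ⊗ B → B`. -/
def sliceLeft (f : A →L[ℂ] ℂ) : MinTensor A B →L[ℂ] B :=
  (algSliceLeft B f.toLinearMap).extendOfNorm (minFamily A B).of.toAlgHom.toLinearMap

variable (A B) in
/-- The slice map `id ⊗ id ⊗ f : A ⊗ B ⊗ C → A ⊗ B`. -/
def sliceThird (f : C →L[ℂ] ℂ) : MinTensor₃ A B C →L[ℂ] MinTensor A B :=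
  ((minFamily A B).of.toAlgHom.toLinearMap ∘ₗ
    algSliceRight (A ⊗[ℂ] B) f.toLinearMap).extendOfNorm
      (minFamily₃ A B C).of.toAlgHom.toLinearMap

variable (B C) in
/-- The slice map `f ⊗ id ⊗ id : A ⊗ B ⊗ C → B ⊗ C`. -/
def sliceFirst (f : A →L[ℂ] ℂ) : MinTensor₃ A B C →L[ℂ] MinTensor B C :=
  ((minFamily B C).of.toAlgHom.toLinearMap ∘ₗ algSliceLeft (B ⊗[ℂ] C) f.toLinearMap ∘ₗ
    (TensorProduct.assoc ℂ A B C).toLinearMap).extendOfNorm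
      (minFamily₃ A B C).of.toAlgHom.toLinearMap

/-- Positivity of f supplies the bound that makes the extension by continuity meaningful: with a GNS
vector ζ, every representation of the slice is bounded by ‖ζ‖² times the minimal norm. -/
theorem sliceRight_of {f : B →L[ℂ] ℂ} (hf : IsPosFunctional f) (x : A ⊗[ℂ] B) :
    sliceRight A f ((minFamily A B).of x) = algSliceRight A f.toLinearMap x := by
  obtain ⟨σ, ζ, hσ⟩ := exists_rep_of_isPosFunctional hf
  refine LinearMap.extendOfNorm_eq (e := (minFamily A B).of.toAlgHom.toLinearMap)
    (minFamily A B).denseRange_of ⟨‖ζ‖ ^ 2, fun x => ?_⟩ x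
  refine norm_le_of_forall_rep (by positivity) fun π => ?_
  refine (norm_rep_algSliceRight_le π.rep σ.rep ζ f.toLinearMap hσ x).trans ?_
  refine mul_le_mul_of_nonneg_left ?_ (by positivity)
  exact (norm_prodRep_le π.rep σ.rep x).trans_eq ((minFamily A B).norm_of x).symm

theorem sliceLeft_of {f : A →L[ℂ] ℂ} (hf : IsPosFunctional f) (x : A ⊗[ℂ] B) :
    sliceLeft B f ((minFamily A B).of x) = algSliceLeft B f.toLinearMap x := by
  obtain ⟨σ, ζ, hσ⟩ := exists_rep_of_isPosFunctional hf
  refine LinearMap.extendOfNorm_eq (e := (minFamily A B).of.toAlgHom.toLinearMap)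
    (minFamily A B).denseRange_of ⟨‖ζ‖ ^ 2, fun x => ?_⟩ x
  refine norm_le_of_forall_rep (by positivity) fun π => ?_
  refine (norm_rep_algSliceLeft_le σ.rep π.rep ζ f.toLinearMap hσ x).trans ?_
  refine mul_le_mul_of_nonneg_left ?_ (by positivity)
  exact (norm_prodRep_le σ.rep π.rep x).trans_eq ((minFamily A B).norm_of x).symm

theorem sliceThird_of {f : C →L[ℂ] ℂ} (hf : IsPosFunctional f) (x : (A ⊗[ℂ] B) ⊗[ℂ] C) :
    sliceThird A B f ((minFamily₃ A B C).of x) =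
      (minFamily A B).of (algSliceRight (A ⊗[ℂ] B) f.toLinearMap x) := by
  obtain ⟨τ, ζ, hτ⟩ := exists_rep_of_isPosFunctional hf
  refine LinearMap.extendOfNorm_eq (e := (minFamily₃ A B C).of.toAlgHom.toLinearMap)
    (minFamily₃ A B C).denseRange_of ⟨‖ζ‖ ^ 2, fun x => ?_⟩ x
  refine ((minFamily A B).norm_of _).trans_le ?_
  refine RepFamily.seminorm_le _ (by positivity) ?_
  rintro _ ⟨π, σ, rfl⟩
  refine (norm_rep_algSliceRight_le (π.prod σ).rep τ.rep ζ f.toLinearMap hτ x).trans ?_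
  refine mul_le_mul_of_nonneg_left ?_ (by positivity)
  exact ((minFamily₃ A B C).norm_rep_le ((π.prod σ).prod τ) ⟨π, σ, τ, rfl⟩ x).trans_eq
    ((minFamily₃ A B C).norm_of x).symm

theorem assocConj_prodRep {H K L : Type*} [NormedAddCommGroup H] [InnerProductSpace ℂ H]
    [CompleteSpace H] [NormedAddCommGroup K] [InnerProductSpace ℂ K] [CompleteSpace K]
    [NormedAddCommGroup L] [InnerProductSpace ℂ L] [CompleteSpace L]
    (π : A →⋆ₐ[ℂ] (H →L[ℂ] H)) (σ : B →⋆ₐ[ℂ] (K →L[ℂ] K)) (τ : C →⋆ₐ[ℂ] (L →L[ℂ] L))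
    (x : (A ⊗[ℂ] B) ⊗[ℂ] C) :
    assocConj H K L (prodRep π (prodRep σ τ) (TensorProduct.assoc ℂ A B C x)) =
      prodRep (prodRep π σ) τ x := by
  induction x using TensorProduct.induction_on with
  | zero => simp only [map_zero]
  | add a b ha hb => simp only [map_add, ha, hb]
  | tmul y c =>
    induction y using TensorProduct.induction_on with
    | zero => simp only [map_zero, TensorProduct.zero_tmul]
    | add a b ha hb => simp only [map_add, TensorProduct.add_tmul, ha, hb]
    | tmul a b =>
      rw [TensorProduct.assoc_tmul, prodRep_tmul, prodRep_tmul, prodRep_tmul, prodRep_tmul,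
        assocConj_opTensor]

/-- Slicing off the first leg uses the bracketing A ⊗ (B ⊗ C), whereas the norm on three factors is
defined through (A ⊗ B) ⊗ C. This estimate transfers the bound between the two. -/
theorem norm_le_norm_assocConj {H₁ H₂ H₃ : Type*} [NormedAddCommGroup H₁] [InnerProductSpace ℂ H₁]
    [NormedAddCommGroup H₂] [InnerProductSpace ℂ H₂]
    [NormedAddCommGroup H₃] [InnerProductSpace ℂ H₃]
    (T : HilbertTensor H₁ (HilbertTensor H₂ H₃) →L[ℂ] HilbertTensor H₁ (HilbertTensor H₂ H₃)) :
    ‖T‖ ≤ ‖assocConj H₁ H₂ H₃ T‖ := by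
  refine ContinuousLinearMap.opNorm_le_bound _ (norm_nonneg _) fun x => ?_
  have h : T x = hilbertAssoc H₁ H₂ H₃
      (assocConj H₁ H₂ H₃ T ((hilbertAssoc H₁ H₂ H₃).symm x)) := by
    change _ = hilbertAssoc H₁ H₂ H₃ ((hilbertAssoc H₁ H₂ H₃).symm
      (T (hilbertAssoc H₁ H₂ H₃ ((hilbertAssoc H₁ H₂ H₃).symm x))))
    rw [LinearIsometryEquiv.apply_symm_apply, LinearIsometryEquiv.apply_symm_apply]
  rw [h, LinearIsometryEquiv.norm_map]
  exact (ContinuousLinearMap.le_opNorm _ _).trans_eq (by rw [LinearIsometryEquiv.norm_map])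

theorem sliceFirst_of {f : A →L[ℂ] ℂ} (hf : IsPosFunctional f) (x : (A ⊗[ℂ] B) ⊗[ℂ] C) :
    sliceFirst B C f ((minFamily₃ A B C).of x) = (minFamily B C).of
      (algSliceLeft (B ⊗[ℂ] C) f.toLinearMap (TensorProduct.assoc ℂ A B C x)) := by
  obtain ⟨π, ζ, hπ⟩ := exists_rep_of_isPosFunctional hf
  refine LinearMap.extendOfNorm_eq (e := (minFamily₃ A B C).of.toAlgHom.toLinearMap)
    (minFamily₃ A B C).denseRange_of ⟨‖ζ‖ ^ 2, fun x => ?_⟩ x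
  refine ((minFamily B C).norm_of _).trans_le ?_
  refine RepFamily.seminorm_le _ (by positivity) ?_
  rintro _ ⟨σ, τ, rfl⟩
  refine (norm_rep_algSliceLeft_le π.rep (σ.prod τ).rep ζ f.toLinearMap hπ _).trans ?_
  refine mul_le_mul_of_nonneg_left ?_ (by positivity)
  refine (norm_le_norm_assocConj _).trans ?_
  refine (congrArg norm (assocConj_prodRep π.rep σ.rep τ.rep x)).trans_le ?_
  exact ((minFamily₃ A B C).norm_rep_le ((π.prod σ).prod τ) ⟨π, σ, τ, rfl⟩ x).trans_eq
    ((minFamily₃ A B C).norm_of x).symm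

end Slices


/-! ### Cauchy–Schwarz consequences for positive functionals. -/

section PositiveFunctionalLemmas

variable {Q : Type u} [CStarAlgebra Q] {f : Q →L[ℂ] ℂ}

theorem IsPosFunctional.map_star (hf : IsPosFunctional f) (a : Q) : f (star a) = star (f a) := by
  obtain ⟨π, ζ, hπ⟩ := exists_rep_of_isPosFunctional hf
  rw [hπ, hπ, StarHomClass.map_star, ContinuousLinearMap.star_eq_adjoint,
    ContinuousLinearMap.adjoint_inner_right]
  exact (inner_conj_symm _ _).symm

theorem IsPosFunctional.norm_apply_le (hf : IsPosFunctional f) (h1 : f 1 = 1) (a : Q) :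
    ‖f a‖ ≤ ‖a‖ := by
  obtain ⟨π, ζ, hπ⟩ := exists_rep_of_isPosFunctional hf
  have hζ : ‖ζ‖ ^ 2 = 1 := by
    have := hπ 1
    rw [h1, map_one, one_apply_eq_self, inner_self_eq_norm_sq_to_K] at this
    exact Complex.ofReal_injective (by push_cast; exact this.symm)
  rw [hπ]
  calc _ ≤ ‖ζ‖ * ‖π.rep a ζ‖ := norm_inner_le_norm _ _
    _ ≤ ‖ζ‖ * (‖a‖ * ‖ζ‖) := mul_le_mul_of_nonneg_left
        (((π.rep a).le_opNorm ζ).trans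
          (mul_le_mul_of_nonneg_right (π.norm_le a) (norm_nonneg _))) (norm_nonneg _)
    _ = ‖a‖ * ‖ζ‖ ^ 2 := by ring
    _ = ‖a‖ := by rw [hζ, mul_one]

/-- In the GNS representation f(a*a) = ‖π(a)ζ‖², so a null element a satisfies π(a)ζ = 0. -/
theorem IsPosFunctional.apply_mul_eq_zero (hf : IsPosFunctional f) {a : Q}
    (ha : f (star a * a) = 0) (b : Q) : f (b * a) = 0 := by
  obtain ⟨π, ζ, hπ⟩ := exists_rep_of_isPosFunctional hf
  have h : π.rep a ζ = 0 := by
    rw [hπ, map_mul, StarHomClass.map_star, ContinuousLinearMap.star_eq_adjoint, mul_apply_eq_comp,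
      ContinuousLinearMap.adjoint_inner_right, inner_self_eq_zero] at ha
    exact ha
  rw [hπ, map_mul, mul_apply_eq_comp, h, map_zero, inner_zero_right]

theorem IsPosFunctional.apply_mul_eq_zero' (hf : IsPosFunctional f) {a : Q}
    (ha : f (a * star a) = 0) (b : Q) : f (a * b) = 0 := by
  have h := hf.apply_mul_eq_zero (a := star a) (by rwa [star_star]) (star b)
  rwa [← star_mul, hf.map_star, star_eq_zero] at h

theorem IsPosFunctional.add {g : Q →L[ℂ] ℂ} (hf : IsPosFunctional f) (hg : IsPosFunctional g) :
    IsPosFunctional (f + g) := fun a => add_nonneg (hf a) (hg a)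

theorem IsPosFunctional.smul (hf : IsPosFunctional f) {c : ℂ} (hc : 0 ≤ c) :
    IsPosFunctional (c • f) := fun a => mul_nonneg hc (hf a)

end PositiveFunctionalLemmas

/-! ### Slice maps as module maps, Fubini rules, and their interplay with Δ ⊗ id and id ⊗ Δ. -/

section SliceIdentities

variable {A B C D : Type u} [CStarAlgebra A] [CStarAlgebra B] [CStarAlgebra C] [CStarAlgebra D]

/-- A *-homomorphism of C*-algebras as a continuous linear map. -/
def starHomL (φ : A →⋆ₐ[ℂ] B) : A →L[ℂ] B :=
  ⟨φ.toAlgHom.toLinearMap, AddMonoidHomClass.continuous_of_bound φ 1 fun a => by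
    rw [one_mul]; exact NonUnitalStarAlgHom.norm_apply_le φ a⟩

@[simp] theorem starHomL_apply (φ : A →⋆ₐ[ℂ] B) (a : A) : starHomL φ a = φ a := rfl

/-- Left multiplication as a continuous linear map. -/
def mulLeftL (a : A) : A →L[ℂ] A := ContinuousLinearMap.mul ℂ A a

/-- Right multiplication as a continuous linear map. -/
def mulRightL (a : A) : A →L[ℂ] A := (ContinuousLinearMap.mul ℂ A).flip a

@[simp] theorem mulLeftL_apply (a b : A) : mulLeftL a b = a * b := rfl

@[simp] theorem mulRightL_apply (a b : A) : mulRightL a b = b * a := rfl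

theorem leg₁₂_minLeft (a : A) : leg₁₂ A B C (minLeft A B a) = leg₁ A B C a := by
  rw [minLeft_apply, leg₁₂_of]; rfl

theorem leg₁₂_minRight (b : B) : leg₁₂ A B C (minRight A B b) = leg₂₃ A B C (minLeft B C b) := by
  rw [minRight_apply, minLeft_apply, leg₁₂_of, leg₂₃_of, algLeg₂₃_tmul]; rfl

theorem leg₂₃_minRight (c : C) : leg₂₃ A B C (minRight B C c) = leg₃ A B C c := by
  rw [minRight_apply, leg₂₃_of, algLeg₂₃_tmul]; rfl

theorem idTensor_minLeft (Δ : B →⋆ₐ[ℂ] MinTensor C D) (a : A) :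
    idTensor A Δ (minLeft A B a) = leg₁ A C D a := by
  rw [minLeft_apply, idTensor, RepFamily.lift_of, starLift_tmul, map_one, mul_one]

theorem idTensor_minRight (Δ : B →⋆ₐ[ℂ] MinTensor C D) (b : B) :
    idTensor A Δ (minRight A B b) = leg₂₃ A C D (Δ b) := by
  rw [minRight_apply, idTensor, RepFamily.lift_of, starLift_tmul, map_one, one_mul]; rfl

theorem tensorId_minLeft (Δ : A →⋆ₐ[ℂ] MinTensor B C) (a : A) :
    tensorId Δ D (minLeft A D a) = leg₁₂ B C D (Δ a) := by
  rw [minLeft_apply, tensorId, RepFamily.lift_of, starLift_tmul, map_one, mul_one]; rfl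

theorem tensorId_minRight (Δ : A →⋆ₐ[ℂ] MinTensor B C) (d : D) :
    tensorId Δ D (minRight A D d) = leg₃ B C D d := by
  rw [minRight_apply, tensorId, RepFamily.lift_of, starLift_tmul, map_one, one_mul]

theorem of_tmul₃' (a : A) (b : B) (c : C) :
    (minFamily₃ A B C).of ((a ⊗ₜ b) ⊗ₜ c) =
      leg₁ A B C a * leg₂₃ A B C (minLeft B C b * minRight B C c) := by
  rw [of_tmul₃, map_mul, map_mul, leg₁₂_minLeft, leg₁₂_minRight, leg₂₃_minRight, mul_assoc]

theorem sliceRight_tmul {f : B →L[ℂ] ℂ} (hf : IsPosFunctional f) (a : A) (b : B) :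
    sliceRight A f (minLeft A B a * minRight A B b) = f b • a := by
  rw [← of_tmul, sliceRight_of hf, algSliceRight_tmul]; rfl

theorem sliceLeft_tmul {f : A →L[ℂ] ℂ} (hf : IsPosFunctional f) (a : A) (b : B) :
    sliceLeft B f (minLeft A B a * minRight A B b) = f a • b := by
  rw [← of_tmul, sliceLeft_of hf, algSliceLeft_tmul]; rfl

theorem sliceRight_minLeft {f : B →L[ℂ] ℂ} (hf : IsPosFunctional f) (a : A) :
    sliceRight A f (minLeft A B a) = f 1 • a := by
  rw [← sliceRight_tmul hf, map_one, mul_one]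

theorem sliceRight_minRight {f : B →L[ℂ] ℂ} (hf : IsPosFunctional f) (b : B) :
    sliceRight A f (minRight A B b) = f b • 1 := by
  rw [← sliceRight_tmul hf, map_one, one_mul]

theorem sliceLeft_minRight {f : A →L[ℂ] ℂ} (hf : IsPosFunctional f) (b : B) :
    sliceLeft B f (minRight A B b) = f 1 • b := by
  rw [← sliceLeft_tmul hf, map_one, one_mul]

theorem sliceLeft_minLeft {f : A →L[ℂ] ℂ} (hf : IsPosFunctional f) (a : A) :
    sliceLeft B f (minLeft A B a) = f a • 1 := by
  rw [← sliceLeft_tmul hf, map_one, mul_one]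

/-- Slices are module maps over the leg they keep. As with the other identities of this kind, both
sides are continuous and linear, so elementary tensors suffice. -/
theorem sliceRight_minLeft_mul {f : B →L[ℂ] ℂ} (hf : IsPosFunctional f) (a : A)
    (X : MinTensor A B) : sliceRight A f (minLeft A B a * X) = a * sliceRight A f X :=
  DFunLike.congr_fun (minTensor_ext (S := sliceRight A f ∘L mulLeftL (minLeft A B a))
    (T := mulLeftL a ∘L sliceRight A f) fun c d => by
      simp only [ContinuousLinearMap.comp_apply, mulLeftL_apply, ← mul_assoc, ← map_mul]
      rw [sliceRight_tmul hf, sliceRight_tmul hf, mul_smul_comm]) X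

theorem sliceRight_mul_minLeft {f : B →L[ℂ] ℂ} (hf : IsPosFunctional f) (a : A)
    (X : MinTensor A B) : sliceRight A f (X * minLeft A B a) = sliceRight A f X * a :=
  DFunLike.congr_fun (minTensor_ext (S := sliceRight A f ∘L mulRightL (minLeft A B a))
    (T := mulRightL a ∘L sliceRight A f) fun c d => by
      simp only [ContinuousLinearMap.comp_apply, mulRightL_apply]
      rw [mul_assoc, ← minLeft_mul_minRight, ← mul_assoc, ← map_mul, sliceRight_tmul hf,
        sliceRight_tmul hf, smul_mul_assoc]) X

theorem sliceLeft_minRight_mul {f : A →L[ℂ] ℂ} (hf : IsPosFunctional f) (b : B)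
    (X : MinTensor A B) : sliceLeft B f (minRight A B b * X) = b * sliceLeft B f X :=
  DFunLike.congr_fun (minTensor_ext (S := sliceLeft B f ∘L mulLeftL (minRight A B b))
    (T := mulLeftL b ∘L sliceLeft B f) fun c d => by
      simp only [ContinuousLinearMap.comp_apply, mulLeftL_apply]
      rw [← mul_assoc, ← minLeft_mul_minRight, mul_assoc, ← map_mul, sliceLeft_tmul hf,
        sliceLeft_tmul hf, mul_smul_comm]) X

theorem sliceLeft_mul_minRight {f : A →L[ℂ] ℂ} (hf : IsPosFunctional f) (b : B)
    (X : MinTensor A B) : sliceLeft B f (X * minRight A B b) = sliceLeft B f X * b :=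
  DFunLike.congr_fun (minTensor_ext (S := sliceLeft B f ∘L mulRightL (minRight A B b))
    (T := mulRightL b ∘L sliceLeft B f) fun c d => by
      simp only [ContinuousLinearMap.comp_apply, mulRightL_apply]
      rw [mul_assoc, ← map_mul, sliceLeft_tmul hf, sliceLeft_tmul hf, smul_mul_assoc]) X

/-- Fubini for f ⊗ g: the two orders of slicing agree on elementary tensors. -/
theorem apply_sliceRight {f : A →L[ℂ] ℂ} {g : B →L[ℂ] ℂ} (hf : IsPosFunctional f)
    (hg : IsPosFunctional g) (X : MinTensor A B) :
    f (sliceRight A g X) = g (sliceLeft B f X) :=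
  DFunLike.congr_fun (minTensor_ext (S := f ∘L sliceRight A g) (T := g ∘L sliceLeft B f)
    fun a b => by
      simp only [ContinuousLinearMap.comp_apply, sliceRight_tmul hg, sliceLeft_tmul hf, map_smul,
        smul_eq_mul, mul_comm]) X

/-- The product functional `f ⊗ g` is positive. -/
theorem isPosFunctional_prod {f : A →L[ℂ] ℂ} {g : B →L[ℂ] ℂ} (hf : IsPosFunctional f)
    (hg : IsPosFunctional g) : IsPosFunctional (f ∘L sliceRight A g) := by
  obtain ⟨π, ξ, hπ⟩ := exists_rep_of_isPosFunctional hf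
  obtain ⟨σ, ζ, hσ⟩ := exists_rep_of_isPosFunctional hg
  refine isPosFunctional_of_rep ⟨HilbertTensor π.space σ.space, minRep π σ⟩
    (toHilbertTensor π.space σ.space (ξ ⊗ₜ ζ)) fun X => ?_
  refine RepFamily.induction_on_of X (isClosed_eq (ContinuousLinearMap.continuous _) ?_)
    fun x => ?_
  · have := continuous_minRep π σ
    fun_prop
  · change f (sliceRight A g _) = ⟪_, minRep π σ _ _⟫_ℂ
    rw [sliceRight_of hg, minRep_of, hπ,
      inner_rep_algSliceRight π.rep σ.rep ζ g.toLinearMap hσ]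

theorem sliceThird_tmul {f : C →L[ℂ] ℂ} (hf : IsPosFunctional f) (Y : MinTensor A B) (c : C) :
    sliceThird A B f (leg₁₂ A B C Y * leg₃ A B C c) = f c • Y :=
  DFunLike.congr_fun (minTensor_ext
    (S := sliceThird A B f ∘L mulRightL (leg₃ A B C c) ∘L starHomL (leg₁₂ A B C))
    (T := f c • ContinuousLinearMap.id ℂ (MinTensor A B)) fun a b => by
      simp only [ContinuousLinearMap.comp_apply, mulRightL_apply, starHomL_apply]
      rw [← of_tmul₃, sliceThird_of hf, algSliceRight_tmul, map_smul, of_tmul]; rfl) Y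

theorem sliceFirst_tmul {f : A →L[ℂ] ℂ} (hf : IsPosFunctional f) (a : A) (Y : MinTensor B C) :
    sliceFirst B C f (leg₁ A B C a * leg₂₃ A B C Y) = f a • Y :=
  DFunLike.congr_fun (minTensor_ext
    (S := sliceFirst B C f ∘L mulLeftL (leg₁ A B C a) ∘L starHomL (leg₂₃ A B C))
    (T := f a • ContinuousLinearMap.id ℂ (MinTensor B C)) fun b c => by
      simp only [ContinuousLinearMap.comp_apply, mulLeftL_apply, starHomL_apply]
      rw [← of_tmul₃', sliceFirst_of hf, TensorProduct.assoc_tmul, algSliceLeft_tmul, map_smul,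
        of_tmul]; rfl) Y

theorem sliceThird_leg₁₂_mul {f : C →L[ℂ] ℂ} (hf : IsPosFunctional f) (X : MinTensor A B)
    (Z : MinTensor₃ A B C) :
    sliceThird A B f (leg₁₂ A B C X * Z) = X * sliceThird A B f Z :=
  DFunLike.congr_fun (minTensor₃_ext (S := sliceThird A B f ∘L mulLeftL (leg₁₂ A B C X))
    (T := mulLeftL X ∘L sliceThird A B f) fun a b c => by
      simp only [ContinuousLinearMap.comp_apply, mulLeftL_apply]
      rw [of_tmul₃, ← mul_assoc, ← map_mul, sliceThird_tmul hf, sliceThird_tmul hf,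
        mul_smul_comm]) Z

theorem sliceFirst_leg₂₃_mul {f : A →L[ℂ] ℂ} (hf : IsPosFunctional f) (X : MinTensor B C)
    (Z : MinTensor₃ A B C) :
    sliceFirst B C f (leg₂₃ A B C X * Z) = X * sliceFirst B C f Z :=
  DFunLike.congr_fun (minTensor₃_ext (S := sliceFirst B C f ∘L mulLeftL (leg₂₃ A B C X))
    (T := mulLeftL X ∘L sliceFirst B C f) fun a b c => by
      simp only [ContinuousLinearMap.comp_apply, mulLeftL_apply]
      rw [of_tmul₃', ← mul_assoc, ← (commute_leg₁_leg₂₃ a X).eq, mul_assoc, ← map_mul,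
        sliceFirst_tmul hf, sliceFirst_tmul hf, mul_smul_comm]) Z

theorem sliceFirst_mul_leg₂₃ {f : A →L[ℂ] ℂ} (hf : IsPosFunctional f) (X : MinTensor B C)
    (Z : MinTensor₃ A B C) :
    sliceFirst B C f (Z * leg₂₃ A B C X) = sliceFirst B C f Z * X :=
  DFunLike.congr_fun (minTensor₃_ext (S := sliceFirst B C f ∘L mulRightL (leg₂₃ A B C X))
    (T := mulRightL X ∘L sliceFirst B C f) fun a b c => by
      simp only [ContinuousLinearMap.comp_apply, mulRightL_apply]
      rw [of_tmul₃', mul_assoc, ← map_mul, sliceFirst_tmul hf, sliceFirst_tmul hf,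
        smul_mul_assoc]) Z

theorem sliceFirst_leg₁₂ {f : A →L[ℂ] ℂ} (hf : IsPosFunctional f) (X : MinTensor A B) :
    sliceFirst B C f (leg₁₂ A B C X) = minLeft B C (sliceLeft B f X) :=
  DFunLike.congr_fun (minTensor_ext (S := sliceFirst B C f ∘L starHomL (leg₁₂ A B C))
    (T := starHomL (minLeft B C) ∘L sliceLeft B f) fun a b => by
      simp only [ContinuousLinearMap.comp_apply, starHomL_apply]
      rw [map_mul, leg₁₂_minLeft, leg₁₂_minRight, sliceFirst_tmul hf, sliceLeft_tmul hf,
        map_smul]) X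

theorem sliceThird_leg₂₃ {f : C →L[ℂ] ℂ} (hf : IsPosFunctional f) (X : MinTensor B C) :
    sliceThird A B f (leg₂₃ A B C X) = minRight A B (sliceRight B f X) :=
  DFunLike.congr_fun (minTensor_ext (S := sliceThird A B f ∘L starHomL (leg₂₃ A B C))
    (T := starHomL (minRight A B) ∘L sliceRight B f) fun b c => by
      simp only [ContinuousLinearMap.comp_apply, starHomL_apply]
      rw [map_mul, ← leg₁₂_minRight, leg₂₃_minRight, sliceThird_tmul hf, sliceRight_tmul hf,
        map_smul]) X

theorem sliceLeft_sliceThird {f : A →L[ℂ] ℂ} {g : C →L[ℂ] ℂ} (hf : IsPosFunctional f)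
    (hg : IsPosFunctional g) (Z : MinTensor₃ A B C) :
    sliceLeft B f (sliceThird A B g Z) = sliceRight B g (sliceFirst B C f Z) :=
  DFunLike.congr_fun (minTensor₃_ext (S := sliceLeft B f ∘L sliceThird A B g)
    (T := sliceRight B g ∘L sliceFirst B C f) fun a b c => by
      simp only [ContinuousLinearMap.comp_apply]
      rw [of_tmul₃, sliceThird_tmul hg, ← of_tmul₃, of_tmul₃', sliceFirst_tmul hf, map_smul,
        map_smul, sliceLeft_tmul hf, sliceRight_tmul hg, smul_comm]) Z

theorem sliceThird_tensorId {f : D →L[ℂ] ℂ} (hf : IsPosFunctional f) (Δ : A →⋆ₐ[ℂ] MinTensor B C)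
    (X : MinTensor A D) :
    sliceThird B C f (tensorId Δ D X) = Δ (sliceRight A f X) :=
  DFunLike.congr_fun (minTensor_ext (S := sliceThird B C f ∘L starHomL (tensorId Δ D))
    (T := starHomL Δ ∘L sliceRight A f) fun a d => by
      simp only [ContinuousLinearMap.comp_apply, starHomL_apply]
      rw [map_mul, tensorId_minLeft, tensorId_minRight, sliceThird_tmul hf, sliceRight_tmul hf,
        map_smul]) X

theorem sliceFirst_idTensor {f : A →L[ℂ] ℂ} (hf : IsPosFunctional f) (Δ : B →⋆ₐ[ℂ] MinTensor C D)
    (X : MinTensor A B) :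
    sliceFirst C D f (idTensor A Δ X) = Δ (sliceLeft B f X) :=
  DFunLike.congr_fun (minTensor_ext (S := sliceFirst C D f ∘L starHomL (idTensor A Δ))
    (T := starHomL Δ ∘L sliceLeft B f) fun a d => by
      simp only [ContinuousLinearMap.comp_apply, starHomL_apply]
      rw [map_mul, idTensor_minLeft, idTensor_minRight, sliceFirst_tmul hf, sliceLeft_tmul hf,
        map_smul]) X

end SliceIdentities


/-! ### Slices and adjoints, separation by positive functionals, density. -/

section SliceFunctional

variable {A B : Type u} [CStarAlgebra A] [CStarAlgebra B]

theorem sliceRight_add {f g : B →L[ℂ] ℂ} (hf : IsPosFunctional f) (hg : IsPosFunctional g)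
    (X : MinTensor A B) : sliceRight A (f + g) X = sliceRight A f X + sliceRight A g X :=
  DFunLike.congr_fun (minTensor_ext (S := sliceRight A (f + g))
    (T := sliceRight A f + sliceRight A g) fun a b => by
      rw [add_apply, sliceRight_tmul hf, sliceRight_tmul hg, sliceRight_tmul (hf.add hg),
        add_apply, add_smul]) X

theorem sliceRight_smul {f : B →L[ℂ] ℂ} (hf : IsPosFunctional f) {c : ℂ} (hc : 0 ≤ c)
    (X : MinTensor A B) : sliceRight A (c • f) X = c • sliceRight A f X :=
  DFunLike.congr_fun (minTensor_ext (S := sliceRight A (c • f))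
    (T := c • sliceRight A f) fun a b => by
      rw [smul_apply, sliceRight_tmul hf, sliceRight_tmul (hf.smul hc),
        smul_apply, smul_eq_mul, mul_smul]) X

theorem sliceRight_star {f : B →L[ℂ] ℂ} (hf : IsPosFunctional f) (X : MinTensor A B) :
    sliceRight A f (star X) = star (sliceRight A f X) := by
  refine RepFamily.induction_on_of X (isClosed_eq
    ((sliceRight A f).continuous.comp (RepFamily.continuous_star _))
    (continuous_star.comp (sliceRight A f).continuous)) fun x => ?_
  induction x using TensorProduct.induction_on with
  | zero => simp only [map_zero, star_zero]
  | add a b ha hb => simp only [map_add, star_add, ha, hb]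
  | tmul a b =>
    rw [of_tmul, star_mul, ← map_star, ← map_star, ← minLeft_mul_minRight, sliceRight_tmul hf,
      sliceRight_tmul hf, hf.map_star, star_smul]

theorem sliceLeft_star {f : A →L[ℂ] ℂ} (hf : IsPosFunctional f) (X : MinTensor A B) :
    sliceLeft B f (star X) = star (sliceLeft B f X) := by
  refine RepFamily.induction_on_of X (isClosed_eq
    ((sliceLeft B f).continuous.comp (RepFamily.continuous_star _))
    (continuous_star.comp (sliceLeft B f).continuous)) fun x => ?_
  induction x using TensorProduct.induction_on with
  | zero => simp only [map_zero, star_zero]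
  | add a b ha hb => simp only [map_add, star_add, ha, hb]
  | tmul a b =>
    rw [of_tmul, star_mul, ← map_star, ← map_star, ← minLeft_mul_minRight, sliceLeft_tmul hf,
      sliceLeft_tmul hf, hf.map_star, star_smul]

/-- Positive functionals separate the points of a C*-algebra. -/
theorem eq_of_forall_isPosFunctional {x y : A}
    (h : ∀ f : A →L[ℂ] ℂ, IsPosFunctional f → f x = f y) : x = y := by
  rw [← sub_eq_zero, ← norm_le_zero_iff]
  refine norm_le_of_forall_rep le_rfl fun π => ?_
  rw [norm_le_zero_iff, ← ContinuousLinearMap.coe_inj]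
  refine (inner_map_self_eq_zero _).1 fun ξ => ?_
  let f : A →L[ℂ] ℂ := innerSL ℂ ξ ∘L (ContinuousLinearMap.apply ℂ π.space ξ) ∘L
    ⟨π.rep.toAlgHom.toLinearMap, AddMonoidHomClass.continuous_of_bound π.rep 1 fun a => by
      rw [one_mul]; exact π.norm_le a⟩
  have hf : ∀ a, f a = ⟪ξ, π.rep a ξ⟫_ℂ := fun a => rfl
  have h1 := h f (isPosFunctional_of_rep π ξ hf)
  rw [← sub_eq_zero, ← map_sub, hf] at h1
  rw [← inner_conj_symm]
  exact (congrArg _ h1).trans (map_zero _)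

/-- The density axioms of a compact quantum group enter the argument in this form. -/
theorem eqOn_dense_span {E : Type*} [NormedAddCommGroup E] [NormedSpace ℂ E] {s : Set A}
    (hs : Dense (Submodule.span ℂ s : Set A)) {S T : A →L[ℂ] E} (h : ∀ x ∈ s, S x = T x) :
    S = T := by
  refine ContinuousLinearMap.ext fun x => ?_
  refine hs.induction (P := fun x => S x = T x) (fun y hy => ?_)
    (isClosed_eq S.continuous T.continuous) x
  exact LinearMap.eqOn_span (f := S.toLinearMap) (g := T.toLinearMap) h hy

theorem dense_span_star {s t : Set A} (hs : Dense (Submodule.span ℂ s : Set A))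
    (h : ∀ x ∈ s, star x ∈ t) : Dense (Submodule.span ℂ t : Set A) := by
  have h1 : Dense (star '' (Submodule.span ℂ s : Set A)) :=
    (star_involutive.surjective.denseRange).dense_image continuous_star hs
  refine h1.mono ?_
  rintro _ ⟨x, hx, rfl⟩
  induction hx using Submodule.span_induction with
  | mem x hx => exact Submodule.subset_span (h x hx)
  | zero => simp
  | add x y _ _ hx hy => rw [star_add]; exact Submodule.add_mem _ hx hy
  | smul c x _ hx => rw [star_smul]; exact Submodule.smul_mem _ _ hx

end SliceFunctional

namespace CompactQuantumGroup

variable {Q : Type u} [CStarAlgebra Q] (G : CompactQuantumGroup Q)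

/-- Taking adjoints reverses the products, so the axioms also give density with Δ(Q) on the right.
-/
theorem dense_right' : Dense (Submodule.span ℂ
    {x | ∃ a b, x = minRight Q Q b * G.comul a} : Set (MinTensor Q Q)) := by
  refine dense_span_star G.dense_right ?_
  rintro _ ⟨a, b, rfl⟩
  exact ⟨star a, star b, by rw [star_mul, map_star, map_star]⟩

theorem dense_left' : Dense (Submodule.span ℂ
    {x | ∃ a b, x = minLeft Q Q b * G.comul a} : Set (MinTensor Q Q)) := by
  refine dense_span_star G.dense_left ?_
  rintro _ ⟨a, b, rfl⟩
  exact ⟨star a, star b, by rw [star_mul, map_star, map_star]⟩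

/-! ### The Haar state -/

/-- The convolution `f * g = (f ⊗ g)Δ`. -/
def conv (f g : Q →L[ℂ] ℂ) : Q →L[ℂ] ℂ := f ∘L sliceRight Q g ∘L starHomL G.comul

theorem conv_apply (f g : Q →L[ℂ] ℂ) (a : Q) :
    G.conv f g a = f (sliceRight Q g (G.comul a)) := rfl

variable {f g k : Q →L[ℂ] ℂ}

theorem conv_apply' (hf : IsPosFunctional f) (hg : IsPosFunctional g) (a : Q) :
    G.conv f g a = g (sliceLeft Q f (G.comul a)) := apply_sliceRight hf hg _

theorem isPosFunctional_conv (hf : IsPosFunctional f) (hg : IsPosFunctional g) :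
    IsPosFunctional (G.conv f g) := fun a => by
  rw [conv_apply, map_mul, map_star]
  exact isPosFunctional_prod hf hg (G.comul a)

theorem conv_one (hg : IsPosFunctional g) : G.conv f g 1 = f 1 * g 1 := by
  rw [conv_apply, map_one, ← map_one (minRight Q Q), sliceRight_minRight hg, map_smul,
    smul_eq_mul, mul_comm]

theorem sliceRight_sliceThird_idTensor (hf : IsPosFunctional f) (hg : IsPosFunctional g)
    (X : MinTensor Q Q) : sliceRight Q f (sliceThird Q Q g (idTensor Q G.comul X)) =
      sliceRight Q (G.conv f g) X :=
  DFunLike.congr_fun (minTensor_ext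
    (S := sliceRight Q f ∘L sliceThird Q Q g ∘L starHomL (idTensor Q G.comul))
    (T := sliceRight Q (G.conv f g)) fun a b => by
      simp only [ContinuousLinearMap.comp_apply, starHomL_apply]
      rw [map_mul, idTensor_minLeft, idTensor_minRight, ← leg₁₂_minLeft, sliceThird_leg₁₂_mul hg,
        sliceThird_leg₂₃ hg, sliceRight_tmul hf,
        sliceRight_tmul (G.isPosFunctional_conv hf hg), conv_apply]) X

theorem sliceLeft_sliceFirst_tensorId (hf : IsPosFunctional f) (hg : IsPosFunctional g)
    (X : MinTensor Q Q) : sliceLeft Q g (sliceFirst Q Q f (tensorId G.comul Q X)) =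
      sliceLeft Q (G.conv f g) X :=
  DFunLike.congr_fun (minTensor_ext
    (S := sliceLeft Q g ∘L sliceFirst Q Q f ∘L starHomL (tensorId G.comul Q))
    (T := sliceLeft Q (G.conv f g)) fun a b => by
      simp only [ContinuousLinearMap.comp_apply, starHomL_apply]
      rw [map_mul, tensorId_minLeft, tensorId_minRight, ← leg₂₃_minRight, sliceFirst_mul_leg₂₃ hf,
        sliceFirst_leg₁₂ hf, sliceLeft_tmul hg,
        sliceLeft_tmul (G.isPosFunctional_conv hf hg), G.conv_apply' hf hg]) X

/-- Coassociativity in sliced form: iterating the operators (id ⊗ f)Δ corresponds to convolving the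
functionals. -/
theorem sliceRight_comul_sliceRight (hf : IsPosFunctional f) (hg : IsPosFunctional g) (a : Q) :
    sliceRight Q f (G.comul (sliceRight Q g (G.comul a))) =
      sliceRight Q (G.conv f g) (G.comul a) := by
  rw [← sliceThird_tensorId hg, G.coassoc, G.sliceRight_sliceThird_idTensor hf hg]

theorem sliceLeft_comul_sliceLeft (hf : IsPosFunctional f) (hg : IsPosFunctional g) (a : Q) :
    sliceLeft Q g (G.comul (sliceLeft Q f (G.comul a))) =
      sliceLeft Q (G.conv f g) (G.comul a) := by
  rw [← sliceFirst_idTensor hf, ← G.coassoc, G.sliceLeft_sliceFirst_tensorId hf hg]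

theorem conv_assoc (hg : IsPosFunctional g) (hk : IsPosFunctional k) :
    G.conv (G.conv f g) k = G.conv f (G.conv g k) := by
  ext a
  rw [conv_apply, conv_apply, conv_apply, G.sliceRight_comul_sliceRight hg hk]

/-- A state. -/
def _root_.CQG.IsState (f : Q →L[ℂ] ℂ) : Prop := IsPosFunctional f ∧ f 1 = 1

theorem isState_conv (hf : IsState f) (hg : IsState g) : IsState (G.conv f g) :=
  ⟨G.isPosFunctional_conv hf.1 hg.1, by rw [G.conv_one hg.1, hf.2, hg.2, mul_one]⟩

/-- If `h` is invariant under a mean of two states, it is left invariant under each of them. -/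
theorem conv_eq_of_conv_add_eq {h ω ρ₁ ρ₂ : Q →L[ℂ] ℂ} (hh : IsState h) (hρ₁ : IsState ρ₁)
    (hρ₂ : IsState ρ₂) (hω : ω = (1 / 2 : ℂ) • (ρ₁ + ρ₂)) (h1 : G.conv ω h = h)
    (h2 : G.conv h ω = h) : G.conv ρ₁ h = h := by
  have h12 : (0 : ℂ) ≤ 1 / 2 := by simp
  have hωp : IsPosFunctional ω := hω ▸ (hρ₁.1.add hρ₂.1).smul h12
  have key : ∀ a c : Q, h (sliceRight Q (G.conv ρ₁ h) (minLeft Q Q c * G.comul a)) =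
      h (sliceRight Q h (minLeft Q Q c * G.comul a)) := by
    intro a c
    rw [sliceRight_minLeft_mul (G.isPosFunctional_conv hρ₁.1 hh.1), sliceRight_minLeft_mul hh.1,
      ← G.sliceRight_comul_sliceRight hρ₁.1 hh.1]
    set b := sliceRight Q h (G.comul a) with hb
    have hωb : sliceRight Q ω (G.comul b) = b := by
      rw [hb, G.sliceRight_comul_sliceRight hωp hh.1, h1]
    let X : MinTensor Q Q := G.comul b - minLeft Q Q b
    -- Since (id ⊗ ω)Δ(b) = b and h * ω = h, the four terms of (h ⊗ ω)(X*X) are all ±h(b*b) and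
    -- cancel. So b is ω-harmonic only in the trivial way, up to null vectors of h ⊗ ω.
    have hX : h (sliceRight Q ω (star X * X)) = 0 := by
      have e : star X * X = G.comul (star b * b) - star (minLeft Q Q (star b) * G.comul b) -
          minLeft Q Q (star b) * G.comul b + minLeft Q Q (star b) * minLeft Q Q b := by
        simp only [X, star_sub, star_mul, map_mul, map_star, star_star, sub_mul, mul_sub]
        abel
      have hω1 : ω 1 = 1 := by
        rw [hω, smul_apply, add_apply, hρ₁.2, hρ₂.2]; norm_num
      rw [e, map_add, map_sub, map_sub, sliceRight_star hωp, sliceRight_minLeft_mul hωp,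
        sliceRight_minLeft_mul hωp, hωb, sliceRight_minLeft hωp, hω1, one_smul, map_add, map_sub,
        map_sub, ← conv_apply, h2, star_mul, star_star]
      ring
    -- A mean of two nonnegative numbers vanishes only if both do; this is where ω being a mean is
    -- used.
    have hX1 : h (sliceRight Q ρ₁ (star X * X)) = 0 := by
      rw [hω, sliceRight_smul (hρ₁.1.add hρ₂.1) h12, sliceRight_add hρ₁.1 hρ₂.1, map_smul,
        map_add, smul_eq_zero] at hX
      have h3 := hX.resolve_left (by norm_num)
      exact ((add_eq_zero_iff_of_nonneg (isPosFunctional_prod hh.1 hρ₁.1 X)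
        (isPosFunctional_prod hh.1 hρ₂.1 X)).1 h3).1
    have h4 := (isPosFunctional_prod hh.1 hρ₁.1).apply_mul_eq_zero hX1 (minLeft Q Q c)
    rw [ContinuousLinearMap.comp_apply, sliceRight_minLeft_mul hρ₁.1, map_sub,
      sliceRight_minLeft hρ₁.1, hρ₁.2, one_smul, mul_sub, map_sub, sub_eq_zero] at h4
    exact h4
  -- The elements (c ⊗ 1)Δ(a) span a dense subspace, so the equality holds on the whole tensor
  -- product; evaluating at 1 ⊗ x then recovers ρ₁ * h = h.
  have h5 : h ∘L sliceRight Q (G.conv ρ₁ h) = h ∘L sliceRight Q h := by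
    refine eqOn_dense_span G.dense_left' ?_
    rintro _ ⟨a, c, rfl⟩
    exact key a c
  ext x
  have h6 := DFunLike.congr_fun h5 (minRight Q Q x)
  simpa [sliceRight_minRight hh.1, sliceRight_minRight (G.isPosFunctional_conv hρ₁.1 hh.1), hh.2]
    using h6

theorem sliceLeft_add (hf : IsPosFunctional f) (hg : IsPosFunctional g)
    (X : MinTensor Q Q) : sliceLeft Q (f + g) X = sliceLeft Q f X + sliceLeft Q g X :=
  DFunLike.congr_fun (minTensor_ext (S := sliceLeft Q (f + g))
    (T := sliceLeft Q f + sliceLeft Q g) fun a b => by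
      rw [add_apply, sliceLeft_tmul hf, sliceLeft_tmul hg, sliceLeft_tmul (hf.add hg),
        add_apply, add_smul]) X

theorem sliceLeft_smul (hf : IsPosFunctional f) {c : ℂ} (hc : 0 ≤ c)
    (X : MinTensor Q Q) : sliceLeft Q (c • f) X = c • sliceLeft Q f X :=
  DFunLike.congr_fun (minTensor_ext (S := sliceLeft Q (c • f))
    (T := c • sliceLeft Q f) fun a b => by
      rw [smul_apply, sliceLeft_tmul hf, sliceLeft_tmul (hf.smul hc),
        smul_apply, smul_eq_mul, mul_smul]) X

/-- If `h` is invariant under a mean of two states, it is right invariant under each of them. -/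
theorem conv_eq_of_conv_add_eq' {h ω ρ₁ ρ₂ : Q →L[ℂ] ℂ} (hh : IsState h) (hρ₁ : IsState ρ₁)
    (hρ₂ : IsState ρ₂) (hω : ω = (1 / 2 : ℂ) • (ρ₁ + ρ₂)) (h1 : G.conv ω h = h)
    (h2 : G.conv h ω = h) : G.conv h ρ₁ = h := by
  have h12 : (0 : ℂ) ≤ 1 / 2 := by simp
  have hωp : IsPosFunctional ω := hω ▸ (hρ₁.1.add hρ₂.1).smul h12
  -- Fubini identifies this functional with the product ρ ⊗ h, whose positivity is known.
  have hpos : ∀ {ρ : Q →L[ℂ] ℂ}, IsPosFunctional ρ → IsPosFunctional (h ∘L sliceLeft Q ρ) :=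
    fun {ρ} hρ => by
      have e : h ∘L sliceLeft Q ρ = ρ ∘L sliceRight Q h :=
        ContinuousLinearMap.ext fun X => (apply_sliceRight hρ hh.1 X).symm
      rw [e]; exact isPosFunctional_prod hρ hh.1
  have key : ∀ a c : Q, h (sliceLeft Q (G.conv h ρ₁) (minRight Q Q c * G.comul a)) =
      h (sliceLeft Q h (minRight Q Q c * G.comul a)) := by
    intro a c
    rw [sliceLeft_minRight_mul (G.isPosFunctional_conv hh.1 hρ₁.1), sliceLeft_minRight_mul hh.1,
      ← G.sliceLeft_comul_sliceLeft hh.1 hρ₁.1]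
    set b := sliceLeft Q h (G.comul a) with hb
    have hωb : sliceLeft Q ω (G.comul b) = b := by
      rw [hb, G.sliceLeft_comul_sliceLeft hh.1 hωp, h2]
    let X : MinTensor Q Q := G.comul b - minRight Q Q b
    have hX : h (sliceLeft Q ω (star X * X)) = 0 := by
      have e : star X * X = G.comul (star b * b) - star (minRight Q Q (star b) * G.comul b) -
          minRight Q Q (star b) * G.comul b + minRight Q Q (star b) * minRight Q Q b := by
        simp only [X, star_sub, star_mul, map_mul, map_star, star_star, sub_mul, mul_sub]
        abel
      have hω1 : ω 1 = 1 := by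
        rw [hω, smul_apply, add_apply, hρ₁.2, hρ₂.2]; norm_num
      rw [e, map_add, map_sub, map_sub, sliceLeft_star hωp, sliceLeft_minRight_mul hωp,
        sliceLeft_minRight_mul hωp, hωb, sliceLeft_minRight hωp, hω1, one_smul, map_add, map_sub,
        map_sub, ← G.conv_apply' hωp hh.1, h1, star_mul, star_star]
      ring
    have hX1 : h (sliceLeft Q ρ₁ (star X * X)) = 0 := by
      rw [hω, sliceLeft_smul (hρ₁.1.add hρ₂.1) h12, sliceLeft_add hρ₁.1 hρ₂.1, map_smul,
        map_add, smul_eq_zero] at hX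
      have h3 := hX.resolve_left (by norm_num)
      exact ((add_eq_zero_iff_of_nonneg (hpos hρ₁.1 X) (hpos hρ₂.1 X)).1 h3).1
    have h4 := (hpos hρ₁.1).apply_mul_eq_zero hX1 (minRight Q Q c)
    rw [ContinuousLinearMap.comp_apply, sliceLeft_minRight_mul hρ₁.1, map_sub,
      sliceLeft_minRight hρ₁.1, hρ₁.2, one_smul, mul_sub, map_sub, sub_eq_zero] at h4
    exact h4
  have h5 : h ∘L sliceLeft Q (G.conv h ρ₁) = h ∘L sliceLeft Q h := by
    refine eqOn_dense_span G.dense_right' ?_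
    rintro _ ⟨a, c, rfl⟩
    exact key a c
  ext x
  have h6 := DFunLike.congr_fun h5 (minLeft Q Q x)
  simpa [sliceLeft_minLeft hh.1, sliceLeft_minLeft (G.isPosFunctional_conv hh.1 hρ₁.1), hh.2]
    using h6

end CompactQuantumGroup


/-! ### Existence of the Haar state: weak-* compactness, Cesàro means, common fixed point. -/

open Filter Topology

section StateSpace

variable {Q : Type u} [CStarAlgebra Q]

/-- The state space is weak-* compact. -/
theorem isCompact_states : IsCompact {φ : WeakDual ℂ Q | IsState (WeakDual.toStrongDual φ)} := by
  refine (WeakDual.isCompact_closedBall (𝕜 := ℂ) (E := Q) 0 1).of_isClosed_subset ?_ ?_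
  · have e : {φ : WeakDual ℂ Q | IsState (WeakDual.toStrongDual φ)} =
        (⋂ a : Q, {φ : WeakDual ℂ Q | 0 ≤ φ (star a * a)}) ∩ {φ | φ 1 = 1} := by
      ext φ
      simp only [Set.mem_ofPred_eq, Set.mem_inter_iff, Set.mem_iInter]
      rfl
    rw [e]
    refine IsClosed.inter (isClosed_iInter fun a => ?_) ?_
    · exact isClosed_le continuous_const (WeakDual.eval_continuous _)
    · exact isClosed_eq (WeakDual.eval_continuous _) continuous_const
  · intro φ hφ
    rw [Set.mem_preimage, mem_closedBall_zero_iff]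
    refine ContinuousLinearMap.opNorm_le_bound _ zero_le_one fun a => ?_
    rw [one_mul]
    exact hφ.1.norm_apply_le hφ.2 a

end StateSpace

namespace CompactQuantumGroup

variable {Q : Type u} [CStarAlgebra Q] (G : CompactQuantumGroup Q)

/-- The states that are invariant under convolution with the state `ω`. -/
def invariantStates (ω : Q →L[ℂ] ℂ) : Set (WeakDual ℂ Q) :=
  {φ | IsState (WeakDual.toStrongDual φ) ∧ (∀ a, φ (sliceLeft Q ω (G.comul a)) = φ a) ∧
    ∀ a, φ (sliceRight Q ω (G.comul a)) = φ a}

theorem isClosed_invariantStates (ω : Q →L[ℂ] ℂ) : IsClosed (G.invariantStates ω) := by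
  have e : G.invariantStates ω = {φ : WeakDual ℂ Q | IsState (WeakDual.toStrongDual φ)} ∩
      ((⋂ a, {φ : WeakDual ℂ Q | φ (sliceLeft Q ω (G.comul a)) = φ a}) ∩
        ⋂ a, {φ : WeakDual ℂ Q | φ (sliceRight Q ω (G.comul a)) = φ a}) := by
    ext φ
    simp only [invariantStates, Set.mem_inter_iff, Set.mem_iInter]
    rfl
  rw [e]
  exact isCompact_states.isClosed.inter (IsClosed.inter
    (isClosed_iInter fun a => isClosed_eq (WeakDual.eval_continuous _) (WeakDual.eval_continuous _))
    (isClosed_iInter fun a => isClosed_eq (WeakDual.eval_continuous _) (WeakDual.eval_continuous _)))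

theorem isCompact_invariantStates (ω : Q →L[ℂ] ℂ) : IsCompact (G.invariantStates ω) :=
  isCompact_states.of_isClosed_subset (G.isClosed_invariantStates ω) fun _ h => h.1

/-- The defining conditions of `invariantStates` are pointwise, which makes the set visibly weak-*
closed; here they are translated into convolution identities. -/
theorem mem_invariantStates {ω : Q →L[ℂ] ℂ} (hω : IsState ω) (φ : Q →L[ℂ] ℂ) :
    StrongDual.toWeakDual φ ∈ G.invariantStates ω ↔
      IsState φ ∧ G.conv ω φ = φ ∧ G.conv φ ω = φ := by
  refine and_congr_right fun hφ => and_congr ?_ ?_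
  · rw [ContinuousLinearMap.ext_iff]
    exact forall_congr' fun a => by
      rw [G.conv_apply' hω.1 (g := φ) hφ.1]; rfl
  · rw [ContinuousLinearMap.ext_iff]; rfl

/-- The convolution powers `ω, ω * ω, …`. -/
def convPow (ω : Q →L[ℂ] ℂ) : ℕ → (Q →L[ℂ] ℂ)
  | 0 => ω
  | n + 1 => G.conv ω (convPow ω n)

theorem isState_convPow {ω : Q →L[ℂ] ℂ} (hω : IsState ω) (n : ℕ) : IsState (G.convPow ω n) := by
  induction n with
  | zero => exact hω
  | succ n ih => exact G.isState_conv hω ih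

theorem conv_convPow {ω : Q →L[ℂ] ℂ} (hω : IsState ω) (n : ℕ) :
    G.conv (G.convPow ω n) ω = G.convPow ω (n + 1) := by
  induction n with
  | zero => rfl
  | succ n ih =>
    change G.conv (G.conv ω (G.convPow ω n)) ω = G.conv ω (G.convPow ω (n + 1))
    rw [G.conv_assoc (G.isState_convPow hω n).1 hω.1, ih]

/-- The Cesàro means of the convolution powers. -/
def convMean (ω : Q →L[ℂ] ℂ) (n : ℕ) : Q →L[ℂ] ℂ :=
  ((n : ℂ) + 1)⁻¹ • ∑ k ∈ Finset.range (n + 1), G.convPow ω k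

theorem convMean_apply (ω : Q →L[ℂ] ℂ) (n : ℕ) (a : Q) :
    G.convMean ω n a = ((n : ℂ) + 1)⁻¹ * ∑ k ∈ Finset.range (n + 1), G.convPow ω k a := by
  simp [convMean]

theorem isState_convMean {ω : Q →L[ℂ] ℂ} (hω : IsState ω) (n : ℕ) :
    IsState (G.convMean ω n) := by
  have h0 : (0 : ℂ) ≤ ((n : ℂ) + 1)⁻¹ := by
    have := Complex.zero_le_real.2 (show (0 : ℝ) ≤ ((n : ℝ) + 1)⁻¹ by positivity)
    push_cast at this
    exact this
  refine ⟨fun a => ?_, ?_⟩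
  · rw [convMean_apply]
    exact mul_nonneg h0 (Finset.sum_nonneg fun k _ => (G.isState_convPow hω k).1 a)
  · rw [convMean_apply, Finset.sum_congr rfl fun k _ => (G.isState_convPow hω k).2]
    have : (n : ℂ) + 1 ≠ 0 := Nat.cast_add_one_ne_zero n
    simp [this]

/-- The hypothesis makes the difference of means telescope: only two convolution powers survive, of
total size at most 2‖a‖, divided by n + 1. -/
theorem tendsto_convMean_sub {ω : Q →L[ℂ] ℂ} (hω : IsState ω) (a b : Q)
    (h : ∀ k, G.convPow ω k b = G.convPow ω (k + 1) a) :
    Tendsto (fun n => G.convMean ω n b - G.convMean ω n a) atTop (𝓝 0) := by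
  have e : ∀ n : ℕ, G.convMean ω n b - G.convMean ω n a =
      ((n : ℂ) + 1)⁻¹ * (G.convPow ω (n + 1) a - G.convPow ω 0 a) := fun n => by
    rw [convMean_apply, convMean_apply, ← mul_sub, ← Finset.sum_sub_distrib,
      Finset.sum_congr rfl fun k _ => by rw [h k],
      Finset.sum_range_sub (fun k => G.convPow ω k a)]
  refine squeeze_zero_norm (a := fun n : ℕ => (2 * ‖a‖) * (1 / ((n : ℝ) + 1))) (fun n => ?_) ?_
  · rw [e, norm_mul, norm_inv, one_div, mul_comm]
    have h1 : ‖(n : ℂ) + 1‖ = (n : ℝ) + 1 := by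
      rw [← Nat.cast_add_one, Complex.norm_natCast, Nat.cast_add_one]
    rw [h1]
    refine mul_le_mul_of_nonneg_right ((norm_sub_le _ _).trans ?_) (by positivity)
    have h2 := (G.isState_convPow hω (n + 1)).1.norm_apply_le (G.isState_convPow hω (n + 1)).2 a
    have h3 := (G.isState_convPow hω 0).1.norm_apply_le (G.isState_convPow hω 0).2 a
    linarith
  · simpa using (tendsto_one_div_add_atTop_nhds_zero_nat (𝕜 := ℝ)).const_mul (2 * ‖a‖)

/-- A weak-* limit of the Cesàro means along a free ultrafilter is invariant on both sides, because
shifting the means by ω changes them by o(1). -/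
theorem invariantStates_nonempty {ω : Q →L[ℂ] ℂ} (hω : IsState ω) :
    (G.invariantStates ω).Nonempty := by
  let 𝒰 : Ultrafilter ℕ := Filter.hyperfilter ℕ
  have h𝒰 : (𝒰 : Filter ℕ) ≤ atTop := by
    rw [← Nat.cofinite_eq_atTop]; exact Filter.hyperfilter_le_cofinite
  let φ : ℕ → WeakDual ℂ Q := fun n => StrongDual.toWeakDual (G.convMean ω n)
  obtain ⟨ψ, hψ, hlim⟩ := isCompact_states.ultrafilter_le_nhds (𝒰.map φ) (by
    rw [Ultrafilter.coe_map, le_principal_iff, Filter.mem_map]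
    exact Filter.Eventually.of_forall fun n => G.isState_convMean hω n)
  have hlim' : ∀ a : Q, Tendsto (fun n => G.convMean ω n a) 𝒰 (𝓝 (ψ a)) := fun a =>
    ((WeakDual.eval_continuous a).tendsto ψ).comp (f := φ) hlim
  have key : ∀ a b : Q, (∀ k, G.convPow ω k b = G.convPow ω (k + 1) a) → ψ b = ψ a := by
    intro a b h
    have h1 := (hlim' b).sub (hlim' a)
    have h2 := (G.tendsto_convMean_sub hω a b h).mono_left h𝒰
    exact sub_eq_zero.1 (tendsto_nhds_unique h1 h2)
  refine ⟨ψ, hψ, fun a => key _ _ fun k => ?_, fun a => key _ _ fun k => ?_⟩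
  · rw [← G.conv_apply' hω.1 (G.isState_convPow hω k).1]; rfl
  · rw [← G.conv_convPow hω k]; rfl

/-- A Haar state: a state that is invariant on both sides. -/
structure IsHaar (h : Q →L[ℂ] ℂ) : Prop where
  state : IsState h
  left : ∀ a, sliceLeft Q h (G.comul a) = h a • (1 : Q)
  right : ∀ a, sliceRight Q h (G.comul a) = h a • (1 : Q)

/-- The compact sets of ω-invariant states are directed downwards, since states invariant under the
mean of ρ₁ and ρ₂ are invariant under each. Hence some state is invariant under all ω. -/
theorem exists_isHaar [Nontrivial Q] : ∃ h, G.IsHaar h := by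
  obtain ⟨f₀, hf₀, h₀, -⟩ := exists_state_norming (1 : Q)
  have : Nonempty {ω : Q →L[ℂ] ℂ // IsState ω} := ⟨⟨f₀, hf₀, h₀⟩⟩
  obtain ⟨ψ, hψ⟩ := IsCompact.nonempty_iInter_of_directed_nonempty_isCompact_isClosed
    (fun ω : {ω : Q →L[ℂ] ℂ // IsState ω} => G.invariantStates ω.1) (by
      rintro ⟨ρ₁, h₁⟩ ⟨ρ₂, h₂⟩
      have h12 : (0 : ℂ) ≤ 1 / 2 := by simp
      have hω : IsState ((1 / 2 : ℂ) • (ρ₁ + ρ₂)) := by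
        refine ⟨(h₁.1.add h₂.1).smul h12, ?_⟩
        rw [smul_apply, add_apply, h₁.2, h₂.2]; norm_num
      refine ⟨⟨_, hω⟩, fun φ hφ => ?_, fun φ hφ => ?_⟩
      · obtain ⟨a1, a2, a3⟩ := (G.mem_invariantStates hω (WeakDual.toStrongDual φ)).1 hφ
        exact (G.mem_invariantStates h₁ (WeakDual.toStrongDual φ)).2
          ⟨a1, G.conv_eq_of_conv_add_eq a1 h₁ h₂ rfl a2 a3,
            G.conv_eq_of_conv_add_eq' a1 h₁ h₂ rfl a2 a3⟩
      · obtain ⟨a1, a2, a3⟩ := (G.mem_invariantStates hω (WeakDual.toStrongDual φ)).1 hφ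
        exact (G.mem_invariantStates h₂ (WeakDual.toStrongDual φ)).2
          ⟨a1, G.conv_eq_of_conv_add_eq a1 h₂ h₁ (by rw [add_comm]) a2 a3,
            G.conv_eq_of_conv_add_eq' a1 h₂ h₁ (by rw [add_comm]) a2 a3⟩)
    (fun ω => G.invariantStates_nonempty ω.2) (fun ω => G.isCompact_invariantStates ω.1)
    (fun ω => G.isClosed_invariantStates ω.1)
  rw [Set.mem_iInter] at hψ
  let h : Q →L[ℂ] ℂ := WeakDual.toStrongDual ψ
  have hh : ∀ ω : Q →L[ℂ] ℂ, IsState ω → IsState h ∧ G.conv ω h = h ∧ G.conv h ω = h :=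
    fun ω hω => (G.mem_invariantStates hω h).1 (hψ ⟨ω, hω⟩)
  have hs : IsState h := (hh f₀ ⟨hf₀, h₀⟩).1
  -- Every positive functional is zero or a multiple of a state, so invariance under all states can
  -- be tested against a family separating the points of Q.
  have scale : ∀ f : Q →L[ℂ] ℂ, IsPosFunctional f → f = 0 ∨
      ∃ ω : Q →L[ℂ] ℂ, IsState ω ∧ f = f 1 • ω := by
    intro f hf
    rcases eq_or_ne (f 1) 0 with h0 | h0
    · left
      ext b
      have := hf.apply_mul_eq_zero (a := 1) (by simpa using h0) b
      simpa using this
    · right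
      have hp : 0 ≤ f 1 := by simpa using hf 1
      exact ⟨(f 1)⁻¹ • f, ⟨hf.smul (inv_nonneg.2 hp), by simp [h0]⟩, by simp [smul_smul, h0]⟩
  refine ⟨h, hs, fun a => ?_, fun a => ?_⟩
  · refine eq_of_forall_isPosFunctional fun f hf => ?_
    rcases scale f hf with rfl | ⟨ω, hω, hfω⟩
    · simp
    · have h1 : ω (sliceLeft Q h (G.comul a)) = h a := by
        rw [← G.conv_apply' hs.1 hω.1, (hh ω hω).2.2]
      rw [map_smul, hfω, smul_apply, smul_apply, h1, hω.2, smul_eq_mul, smul_eq_mul, smul_eq_mul]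
      ring
  · refine eq_of_forall_isPosFunctional fun f hf => ?_
    rcases scale f hf with rfl | ⟨ω, hω, hfω⟩
    · simp
    · have h1 : ω (sliceRight Q h (G.comul a)) = h a := by
        rw [← conv_apply, (hh ω hω).2.1]
      rw [map_smul, hfω, smul_apply, smul_apply, h1, hω.2, smul_eq_mul, smul_eq_mul, smul_eq_mul]
      ring

end CompactQuantumGroup


namespace CompactQuantumGroup

/-! ### The null space of the Haar state and matrix coefficients -/

variable {Q : Type u} [CStarAlgebra Q] {G : CompactQuantumGroup Q} {h : Q →L[ℂ] ℂ}

namespace IsHaar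

theorem sliceFirst_tensorId (hh : G.IsHaar h) (X : MinTensor Q Q) :
    sliceFirst Q Q h (tensorId G.comul Q X) = minRight Q Q (sliceLeft Q h X) :=
  DFunLike.congr_fun (minTensor_ext (S := sliceFirst Q Q h ∘L starHomL (tensorId G.comul Q))
    (T := starHomL (minRight Q Q) ∘L sliceLeft Q h) fun a b => by
      have hp := hh.state.1
      simp only [ContinuousLinearMap.comp_apply, starHomL_apply]
      rw [map_mul, tensorId_minLeft, tensorId_minRight, ← leg₂₃_minRight, sliceFirst_mul_leg₂₃ hp,
        sliceFirst_leg₁₂ hp, hh.left, map_smul, map_one, smul_mul_assoc, one_mul,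
        sliceLeft_tmul hp, map_smul]) X

/-- The threefold product of a functional with itself. -/
def _root_.CQG.tripleFunctional (h : Q →L[ℂ] ℂ) : MinTensor₃ Q Q Q →L[ℂ] ℂ :=
  h ∘L sliceLeft Q h ∘L sliceFirst Q Q h

/-- By density take X = (1 ⊗ q)Δ(p) and Y = Δ(r)(1 ⊗ s). Coassociativity merges the inner factors
into Δ²(pr), the first leg of which integrates to h(pr); then both sides equal h(pr)h(q)h(s). -/
theorem tripleFunctional_comm (hh : G.IsHaar h) (X Y : MinTensor Q Q) :
    tripleFunctional h (idTensor Q G.comul X * tensorId G.comul Q Y) =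
      tripleFunctional h (tensorId G.comul Q X * idTensor Q G.comul Y) := by
  have hp := hh.state.1
  have key : ∀ p q r s : Q, tripleFunctional h
      (idTensor Q G.comul (minRight Q Q q * G.comul p) *
        tensorId G.comul Q (G.comul r * minRight Q Q s)) =
      tripleFunctional h (tensorId G.comul Q (minRight Q Q q * G.comul p) *
        idTensor Q G.comul (G.comul r * minRight Q Q s)) := by
    intro p q r s
    have e1 : idTensor Q G.comul (minRight Q Q q * G.comul p) *
        tensorId G.comul Q (G.comul r * minRight Q Q s) =
        leg₂₃ Q Q Q (G.comul q) * tensorId G.comul Q (G.comul (p * r)) *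
          leg₂₃ Q Q Q (minRight Q Q s) := by
      rw [map_mul, map_mul, idTensor_minRight, tensorId_minRight, ← G.coassoc, leg₂₃_minRight,
        map_mul G.comul p r, map_mul]
      simp only [mul_assoc]
    have e2 : tensorId G.comul Q (minRight Q Q q * G.comul p) *
        idTensor Q G.comul (G.comul r * minRight Q Q s) =
        leg₂₃ Q Q Q (minRight Q Q q) * tensorId G.comul Q (G.comul (p * r)) *
          leg₂₃ Q Q Q (G.comul s) := by
      rw [map_mul, map_mul, idTensor_minRight, tensorId_minRight, ← G.coassoc, leg₂₃_minRight,
        map_mul G.comul p r, map_mul]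
      simp only [mul_assoc]
    have e3 : sliceFirst Q Q h (tensorId G.comul Q (G.comul (p * r))) = h (p * r) • 1 := by
      rw [hh.sliceFirst_tensorId, hh.left, map_smul, map_one]
    rw [e1, e2]
    simp only [tripleFunctional, ContinuousLinearMap.comp_apply]
    rw [sliceFirst_mul_leg₂₃ hp, sliceFirst_leg₂₃_mul hp, sliceFirst_mul_leg₂₃ hp,
      sliceFirst_leg₂₃_mul hp, e3]
    simp only [mul_smul_comm, smul_mul_assoc, mul_one, map_smul]
    rw [sliceLeft_mul_minRight hp, sliceLeft_minRight_mul hp, hh.left, hh.left]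
    simp only [mul_smul_comm, smul_mul_assoc, mul_one, one_mul, map_smul, smul_eq_mul]
    ring
  have step : ∀ r s : Q, ∀ X : MinTensor Q Q, tripleFunctional h
      (idTensor Q G.comul X * tensorId G.comul Q (G.comul r * minRight Q Q s)) =
      tripleFunctional h (tensorId G.comul Q X *
        idTensor Q G.comul (G.comul r * minRight Q Q s)) := by
    intro r s X
    refine DFunLike.congr_fun (eqOn_dense_span G.dense_right'
      (S := tripleFunctional h ∘L mulRightL (tensorId G.comul Q (G.comul r * minRight Q Q s)) ∘L
        starHomL (idTensor Q G.comul))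
      (T := tripleFunctional h ∘L mulRightL (idTensor Q G.comul (G.comul r * minRight Q Q s)) ∘L
        starHomL (tensorId G.comul Q)) ?_) X
    rintro _ ⟨p, q, rfl⟩
    exact key p q r s
  refine DFunLike.congr_fun (eqOn_dense_span G.dense_right
    (S := tripleFunctional h ∘L mulLeftL (idTensor Q G.comul X) ∘L starHomL (tensorId G.comul Q))
    (T := tripleFunctional h ∘L mulLeftL (tensorId G.comul Q X) ∘L
      starHomL (idTensor Q G.comul)) ?_) Y
  rintro _ ⟨r, s, rfl⟩
  exact step r s X

/-- The strong invariance of the Haar state. -/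
theorem strong_invariance (hh : G.IsHaar h) (x y a b : Q) :
    h (sliceRight Q h (G.comul a * minRight Q Q b) *
        sliceLeft Q h (minLeft Q Q x * G.comul y)) =
      h (sliceLeft Q h (G.comul x * minLeft Q Q y) *
        sliceRight Q h (minRight Q Q a * G.comul b)) := by
  have hp := hh.state.1
  -- On elementary tensors x ⊗ a and y ⊗ b the outer legs can be sliced first, which leaves a
  -- product of two slices in the middle leg on each side.
  have key := hh.tripleFunctional_comm (minLeft Q Q x * minRight Q Q a)
    (minLeft Q Q y * minRight Q Q b)
  have e1 : idTensor Q G.comul (minLeft Q Q x * minRight Q Q a) *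
      tensorId G.comul Q (minLeft Q Q y * minRight Q Q b) =
      leg₂₃ Q Q Q (G.comul a * minRight Q Q b) * leg₁₂ Q Q Q (minLeft Q Q x * G.comul y) := by
    rw [map_mul, map_mul, map_mul, map_mul, idTensor_minLeft, idTensor_minRight, tensorId_minLeft,
      tensorId_minRight, leg₁₂_minLeft, leg₂₃_minRight, (commute_leg₁_leg₂₃ x (G.comul a)).eq,
      (commute_leg₁₂_leg₃ (G.comul y) b).eq]
    have := (commute_leg₁_leg₂₃ x (minRight Q Q b)).eq
    rw [leg₂₃_minRight] at this
    simp only [mul_assoc]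
    rw [← mul_assoc (leg₁ Q Q Q x), this, mul_assoc]
  have e2 : tensorId G.comul Q (minLeft Q Q x * minRight Q Q a) *
      idTensor Q G.comul (minLeft Q Q y * minRight Q Q b) =
      leg₁₂ Q Q Q (G.comul x * minLeft Q Q y) * leg₂₃ Q Q Q (minRight Q Q a * G.comul b) := by
    rw [map_mul, map_mul, map_mul, map_mul, idTensor_minLeft, idTensor_minRight, tensorId_minLeft,
      tensorId_minRight, leg₁₂_minLeft, leg₂₃_minRight]
    have := (commute_leg₁_leg₂₃ y (minRight Q Q a)).eq
    rw [leg₂₃_minRight] at this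
    simp only [mul_assoc]
    rw [← mul_assoc (leg₃ Q Q Q a), ← this, mul_assoc]
  rw [e1, e2] at key
  simp only [tripleFunctional, ContinuousLinearMap.comp_apply] at key
  rw [sliceFirst_leg₂₃_mul hp, sliceFirst_mul_leg₂₃ hp, sliceFirst_leg₁₂ hp, sliceFirst_leg₁₂ hp,
    ← apply_sliceRight hp hp, ← apply_sliceRight hp hp, sliceRight_mul_minLeft hp,
    sliceRight_minLeft_mul hp] at key
  exact key

/-- Every element splits along a finite family with respect to the inner product `h (a* b)`. -/
theorem _root_.CQG.IsPosFunctional.exists_orthogonal_splitting (hp : IsPosFunctional h)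
    {ι : Type*} [Fintype ι] (c : ι → Q) (a : Q) :
    ∃ t : ι → ℂ, ∀ k, h (star (c k) * (a - ∑ i, t i • c i)) = 0 := by
  obtain ⟨π, ζ, hπ⟩ := exists_rep_of_isPosFunctional hp
  let V : Submodule ℂ π.space := Submodule.span ℂ (Set.range fun k => π.rep (c k) ζ)
  have : FiniteDimensional ℂ V := FiniteDimensional.span_of_finite ℂ (Set.finite_range _)
  obtain ⟨t, ht⟩ := (Submodule.mem_span_range_iff_exists_fun ℂ).1
    (V.starProjection_apply_mem (π.rep a ζ))
  refine ⟨t, fun k => ?_⟩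
  have h1 : π.rep (a - ∑ i, t i • c i) ζ = π.rep a ζ - V.starProjection (π.rep a ζ) := by
    rw [← ht, map_sub, map_sum, sub_apply, sum_apply]
    simp only [map_smul, smul_apply]
  rw [hπ, map_mul, map_star, ContinuousLinearMap.star_eq_adjoint, mul_apply_eq_comp,
    ContinuousLinearMap.adjoint_inner_right, h1]
  exact (Submodule.sub_starProjection_mem_orthogonal _) _ (Submodule.subset_span ⟨k, rfl⟩)

variable {ι : Type*} [Fintype ι] {w : ι → ι → Q}

/-- If the coefficients of a finite-dimensional corepresentation are annihilated by the Haar state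
under right multiplication, they are null vectors. -/
theorem coeff_null (hh : G.IsHaar h)
    (hw : ∀ i j, G.comul (w i j) = ∑ k, minLeft Q Q (w i k) * minRight Q Q (w k j))
    (h0 : ∀ i j b, h (w i j * b) = 0) (r i : ι) : h (star (w r i) * w r i) = 0 := by
  have hp := hh.state.1
  have h1 := hh.state.2
  have hws : ∀ i j, G.comul (star (w i j)) =
      ∑ k, minLeft Q Q (star (w i k)) * minRight Q Q (star (w k j)) := by
    intro i j
    rw [map_star, hw, star_sum]
    exact Finset.sum_congr rfl fun k _ => by
      rw [star_mul, ← map_star, ← map_star, minLeft_mul_minRight]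
  -- Strong invariance with x = w_ri*: since Δ(w_ri*) is a finite sum, the right-hand side becomes a
  -- finite sum of products of inner products with coefficients.
  have strong : ∀ (a b f : Q) (i : ι), h (sliceRight Q h (G.comul a * minRight Q Q b) *
      sliceLeft Q h (minLeft Q Q (star (w r i)) * G.comul f)) =
      ∑ k, h (star (w k i) * sliceRight Q h (minRight Q Q a * G.comul b)) *
        h (star (w r k) * f) := by
    intro a b f i
    rw [hh.strong_invariance, hws, Finset.sum_mul, map_sum, Finset.sum_mul, map_sum]
    refine Finset.sum_congr rfl fun k _ => ?_
    rw [mul_assoc, ← minLeft_mul_minRight, ← mul_assoc, ← map_mul, sliceLeft_tmul hp,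
      smul_mul_assoc, map_smul, smul_eq_mul, mul_comm]
  -- slices of a vector orthogonal to the coefficients are null
  have null : ∀ y, (∀ k, h (star (w r k) * y) = 0) → ∀ i e,
      h (e * sliceLeft Q h (minLeft Q Q (star (w r i)) * G.comul y)) = 0 := by
    intro y hy i e
    have := DFunLike.congr_fun (eqOn_dense_span G.dense_right
      (S := h ∘L mulRightL (sliceLeft Q h (minLeft Q Q (star (w r i)) * G.comul y)) ∘L
        sliceRight Q h) (T := 0) (by
        rintro _ ⟨a, b, rfl⟩
        refine (strong a b y i).trans ?_
        simp only [hy, mul_zero, Finset.sum_const_zero]; rfl)) (minLeft Q Q e)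
    simpa [sliceRight_minLeft hp, h1] using this
  -- Being null on one side passes through Δ: with Z = (1 ⊗ q)Δ(p), left invariance reduces the
  -- expression to h(pz)h(qb), where z is the slice, and h(pz) = 0.
  have null' : ∀ y, (∀ k, h (star (w r k) * y) = 0) → ∀ i b Z,
      h (sliceRight Q h (Z * (G.comul (sliceLeft Q h (minLeft Q Q (star (w r i)) * G.comul y)) *
        minRight Q Q b))) = 0 := by
    intro y hy i b Z
    refine DFunLike.congr_fun (eqOn_dense_span G.dense_right'
      (S := h ∘L sliceRight Q h ∘L mulRightL (G.comul (sliceLeft Q h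
        (minLeft Q Q (star (w r i)) * G.comul y)) * minRight Q Q b)) (T := 0) ?_) Z
    rintro _ ⟨p, q, rfl⟩
    simp only [ContinuousLinearMap.comp_apply, mulRightL_apply, zero_apply]
    rw [mul_assoc, ← mul_assoc (G.comul p), ← map_mul, apply_sliceRight hp hp,
      sliceLeft_minRight_mul hp, sliceLeft_mul_minRight hp, hh.left, null y hy i p]
    simp
  -- the slices of the orthogonal complement are orthogonal to the coefficients
  have orth : ∀ (a b f b' : Q) (i : ι),
      ∑ k, h (star (w k i) * sliceRight Q h (minRight Q Q a * G.comul b)) *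
        h (star (w r k) * sliceRight Q h (G.comul f * minRight Q Q b')) = 0 := by
    intro a b f b' i
    -- The part of f in the span of the row w_rk contributes nothing, because (id ⊗ h)(Δ(w_rk)(1 ⊗
    -- b')) = Σ_l h(w_lk b') w_rl = 0. So f may be replaced by its component y orthogonal to the
    -- row.
    obtain ⟨t, ht⟩ := hp.exists_orthogonal_splitting (fun k => w r k) f
    set y := f - ∑ k, t k • w r k with hy
    have e1 : sliceRight Q h (G.comul f * minRight Q Q b') =
        sliceRight Q h (G.comul y * minRight Q Q b') := by
      have e2 : ∀ k, sliceRight Q h (G.comul (w r k) * minRight Q Q b') = 0 := by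
        intro k
        rw [hw, Finset.sum_mul, map_sum]
        refine Finset.sum_eq_zero fun l _ => ?_
        rw [mul_assoc, ← map_mul, sliceRight_tmul hp, h0, zero_smul]
      rw [hy, map_sub, sub_mul, map_sub, map_sum, Finset.sum_mul, map_sum]
      simp only [map_smul, smul_mul_assoc, e2, smul_zero, Finset.sum_const_zero, sub_zero]
    rw [e1, ← strong, ← sliceThird_tensorId hp]
    -- Coassociativity lets the two slices be exchanged, which exposes the null element to which
    -- `null'` applies.
    have e3 : minLeft Q Q (star (w r i)) *
        sliceThird Q Q h (tensorId G.comul Q (G.comul y * minRight Q Q b')) =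
        sliceThird Q Q h (idTensor Q G.comul (minLeft Q Q (star (w r i)) * G.comul y) *
          leg₂₃ Q Q Q (minRight Q Q b')) := by
      rw [← sliceThird_leg₁₂_mul hp, leg₁₂_minLeft, map_mul (tensorId G.comul Q),
        map_mul (idTensor Q G.comul), tensorId_minRight, idTensor_minLeft, G.coassoc,
        leg₂₃_minRight, mul_assoc]
    rw [e3, sliceLeft_sliceThird hp hp, sliceFirst_mul_leg₂₃ hp, sliceFirst_idTensor hp,
      ← sliceRight_minLeft_mul hp]
    exact null' y ht i b' _
  -- The slices of Δ(f)(1 ⊗ b') are total in Q, so w_rj may take their place; next the other slice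
  -- is replaced by an arbitrary d in the same way.
  have orth' : ∀ (a b : Q) (i j : ι),
      ∑ k, h (star (w k i) * sliceRight Q h (minRight Q Q a * G.comul b)) *
        h (star (w r k) * w r j) = 0 := by
    intro a b i j
    have := DFunLike.congr_fun (eqOn_dense_span G.dense_right
      (S := (∑ k, h (star (w k i) * sliceRight Q h (minRight Q Q a * G.comul b)) •
        (h ∘L mulLeftL (star (w r k)))) ∘L sliceRight Q h) (T := 0) (by
        rintro _ ⟨f, b', rfl⟩
        simpa using orth a b f b' i)) (minLeft Q Q (w r j))
    simpa [sliceRight_minLeft hp, h1] using this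
  have orth'' : ∀ (d : Q) (i j : ι), ∑ k, h (star (w k i) * d) * h (star (w r k) * w r j) = 0 := by
    intro d i j
    have := DFunLike.congr_fun (eqOn_dense_span G.dense_right'
      (S := (∑ k, h (star (w r k) * w r j) • (h ∘L mulLeftL (star (w k i)))) ∘L
        sliceRight Q h) (T := 0) (by
        rintro _ ⟨b, a, rfl⟩
        simpa [mul_comm] using orth' a b i j)) (minLeft Q Q d)
    simpa [sliceRight_minLeft hp, h1, mul_comm] using this
  -- Invariance gives h(x) = (h ⊗ h)Δ(x). Expanding Δ(w_ri* w_ri) produces exactly the sums shown to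
  -- vanish.
  have e : h (star (w r i) * w r i) =
      ∑ j, ∑ k, h (star (w k i) * w j i) * h (star (w r k) * w r j) := by
    have e1 : h (sliceLeft Q h (G.comul (star (w r i) * w r i))) = h (star (w r i) * w r i) := by
      rw [hh.left, map_smul, h1, smul_eq_mul, mul_one]
    rw [← e1, map_mul, hws, hw, Finset.sum_mul_sum, Finset.sum_comm, map_sum, map_sum]
    refine Finset.sum_congr rfl fun j _ => ?_
    rw [map_sum, map_sum]
    refine Finset.sum_congr rfl fun k _ => ?_
    have e2 : minLeft Q Q (star (w r k)) * minRight Q Q (star (w k i)) *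
        (minLeft Q Q (w r j) * minRight Q Q (w j i)) =
        minLeft Q Q (star (w r k) * w r j) * minRight Q Q (star (w k i) * w j i) := by
      rw [map_mul, map_mul, mul_assoc, ← mul_assoc (minRight Q Q (star (w k i))),
        ← minLeft_mul_minRight]
      simp only [mul_assoc]
    rw [e2, sliceLeft_tmul hp, map_smul, smul_eq_mul, mul_comm]
  rw [e]
  exact Finset.sum_eq_zero fun j _ => orth'' (w j i) i j

/-- The null coefficients of a corepresentation are also null after taking adjoints. -/
theorem coeff_star_null (hh : G.IsHaar h)
    (hw : ∀ i j, G.comul (w i j) = ∑ k, minLeft Q Q (w i k) * minRight Q Q (w k j))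
    (h0 : ∀ i j, h (star (w i j) * w i j) = 0) (i j : ι) : h (w i j * star (w i j)) = 0 := by
  have hp := hh.state.1
  -- The entrywise adjoint is again a corepresentation matrix, and Cauchy–Schwarz turns h(w*w) = 0
  -- into h(w*b) = 0 for all b.
  have h2 := hh.coeff_null (w := fun i j => star (w i j)) (fun i j => by
    rw [map_star, hw, star_sum]
    exact Finset.sum_congr rfl fun k _ => by
      rw [star_mul, ← map_star, ← map_star, minLeft_mul_minRight]) (fun i j b =>
        hp.apply_mul_eq_zero' (by rw [star_star]; exact h0 i j) b) i j
  rwa [star_star] at h2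

/-- Together with `coeff_star_null` this makes nullity of all coefficients a two-sided notion, which
replaces faithfulness of h on coefficients. -/
theorem coeff_null' (hh : G.IsHaar h)
    (hw : ∀ i j, G.comul (w i j) = ∑ k, minLeft Q Q (w i k) * minRight Q Q (w k j))
    (h0 : ∀ i j, h (w i j * star (w i j)) = 0) (i j : ι) : h (star (w i j) * w i j) = 0 :=
  hh.coeff_null hw (fun i j b => hh.state.1.apply_mul_eq_zero' (h0 i j) b) i j

end IsHaar

end CompactQuantumGroup


/-! ### Matrices over a *-algebra -/

section Matrices

variable {m n : Type*} [Fintype m] [DecidableEq m] [Fintype n] [DecidableEq n]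
variable {A B : Type*} [Ring A] [StarRing A] [Algebra ℂ A] [StarModule ℂ A]
  [Ring B] [StarRing B] [Algebra ℂ B] [StarModule ℂ B]

variable (n) in
/-- The entrywise application of a *-homomorphism to matrices. -/
def amp (f : A →⋆ₐ[ℂ] B) : Matrix n n A →⋆ₐ[ℂ] Matrix n n B :=
  { f.toAlgHom.mapMatrix with
    map_star' := fun M => by
      ext i j
      exact map_star f (M j i) }

theorem amp_apply (f : A →⋆ₐ[ℂ] B) (M : Matrix n n A) (i j : n) : amp n f M i j = f (M i j) := rfl

variable (n A) in
/-- Scalar matrices, seen as matrices over `A`. -/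
def scal : Matrix n n ℂ →⋆ₐ[ℂ] Matrix n n A := amp n (StarAlgHom.ofId ℂ A)

theorem scal_apply (C : Matrix n n ℂ) (i j : n) : scal n A C i j = algebraMap ℂ A (C i j) := rfl

theorem amp_scal (f : A →⋆ₐ[ℂ] B) (C : Matrix n n ℂ) : amp n f (scal n A C) = scal n B C := by
  ext i j
  rw [amp_apply, scal_apply, scal_apply]
  exact AlgHomClass.commutes f _

variable (m n A) in
/-- `U ↦ U ⊗ 1` on matrices. -/
def kronLeft : Matrix m m A →⋆ₐ[ℂ] Matrix (m × n) (m × n) A where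
  toFun U := Matrix.of fun p q => if p.2 = q.2 then U p.1 q.1 else 0
  map_one' := by
    ext ⟨i, k⟩ ⟨j, l⟩
    simp only [Matrix.of_apply, Matrix.one_apply, Prod.mk.injEq]
    split_ifs <;> simp_all
  map_mul' U V := by
    ext ⟨i, k⟩ ⟨j, l⟩
    simp only [Matrix.of_apply, Matrix.mul_apply, Fintype.sum_prod_type, ite_mul, zero_mul,
      mul_ite, mul_zero]
    split_ifs with hkl
    · subst hkl; simp
    · refine (Finset.sum_eq_zero fun p _ => Finset.sum_eq_zero fun q _ => ?_).symm
      split_ifs <;> simp_all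
  map_zero' := by ext; simp
  map_add' U V := by
    ext
    simp only [Matrix.of_apply, Matrix.add_apply]
    split_ifs <;> simp
  commutes' c := by
    ext ⟨i, k⟩ ⟨j, l⟩
    simp only [Matrix.of_apply, Matrix.algebraMap_matrix_apply, Prod.mk.injEq]
    split_ifs <;> simp_all
  map_star' U := by
    ext ⟨i, k⟩ ⟨j, l⟩
    simp only [Matrix.of_apply, Matrix.star_apply, apply_ite star, star_zero, eq_comm]

variable (m n A) in
/-- `V ↦ 1 ⊗ V` on matrices. -/
def kronRight : Matrix n n A →⋆ₐ[ℂ] Matrix (m × n) (m × n) A where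
  toFun V := Matrix.of fun p q => if p.1 = q.1 then V p.2 q.2 else 0
  map_one' := by
    ext ⟨i, k⟩ ⟨j, l⟩
    simp only [Matrix.of_apply, Matrix.one_apply, Prod.mk.injEq]
    split_ifs <;> simp_all
  map_mul' U V := by
    ext ⟨i, k⟩ ⟨j, l⟩
    simp only [Matrix.of_apply, Matrix.mul_apply, Fintype.sum_prod_type_right, ite_mul, zero_mul,
      mul_ite, mul_zero]
    split_ifs with hkl
    · subst hkl; simp
    · refine (Finset.sum_eq_zero fun p _ => Finset.sum_eq_zero fun q _ => ?_).symm
      split_ifs <;> simp_all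
  map_zero' := by ext; simp
  map_add' U V := by
    ext
    simp only [Matrix.of_apply, Matrix.add_apply]
    split_ifs <;> simp
  commutes' c := by
    ext ⟨i, k⟩ ⟨j, l⟩
    simp only [Matrix.of_apply, Matrix.algebraMap_matrix_apply, Prod.mk.injEq]
    split_ifs <;> simp_all
  map_star' U := by
    ext ⟨i, k⟩ ⟨j, l⟩
    simp only [Matrix.of_apply, Matrix.star_apply, apply_ite star, star_zero, eq_comm]

theorem kronLeft_apply (U : Matrix m m A) (p q : m × n) :
    kronLeft m n A U p q = if p.2 = q.2 then U p.1 q.1 else 0 := rfl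

theorem kronRight_apply (V : Matrix n n A) (p q : m × n) :
    kronRight m n A V p q = if p.1 = q.1 then V p.2 q.2 else 0 := rfl

theorem kron_mul_apply (U : Matrix m m A) (V : Matrix n n A) (p q : m × n) :
    (kronLeft m n A U * kronRight m n A V) p q = U p.1 q.1 * V p.2 q.2 := by
  simp [Matrix.mul_apply, kronLeft_apply, kronRight_apply, Fintype.sum_prod_type]

theorem kron_mul_apply' (U : Matrix m m A) (V : Matrix n n A) (p q : m × n) :
    (kronRight m n A V * kronLeft m n A U) p q = V p.2 q.2 * U p.1 q.1 := by
  simp [Matrix.mul_apply, kronLeft_apply, kronRight_apply, Fintype.sum_prod_type]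

theorem kronLeft_scal (C : Matrix m m ℂ) :
    kronLeft m n A (scal m A C) = scal (m × n) A (kronLeft m n ℂ C) := by
  ext p q
  simp only [kronLeft_apply, scal_apply]
  split_ifs <;> simp

theorem kronRight_scal (C : Matrix n n ℂ) :
    kronRight m n A (scal n A C) = scal (m × n) A (kronRight m n ℂ C) := by
  ext p q
  simp only [kronRight_apply, scal_apply]
  split_ifs <;> simp

/-- Over a noncommutative algebra the two Kronecker factors do not commute in general; scalar
entries on one side are what permits the exchange. -/
theorem commute_kronLeft_scal (U : Matrix m m A) (C : Matrix n n ℂ) :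
    kronLeft m n A U * kronRight m n A (scal n A C) =
      kronRight m n A (scal n A C) * kronLeft m n A U := by
  ext p q
  rw [kron_mul_apply, kron_mul_apply', scal_apply, Algebra.commutes]

theorem commute_kronRight_scal (V : Matrix n n A) (C : Matrix m m ℂ) :
    kronLeft m n A (scal m A C) * kronRight m n A V =
      kronRight m n A V * kronLeft m n A (scal m A C) := by
  ext p q
  rw [kron_mul_apply, kron_mul_apply', scal_apply, Algebra.commutes]

theorem kronLeft_injective [Nonempty n] : Function.Injective (kronLeft m n A) := by
  intro U V h
  ext i j
  have := congrFun (congrFun h (i, Classical.arbitrary n)) (j, Classical.arbitrary n)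
  simpa [kronLeft_apply] using this

theorem kronRight_injective [Nonempty m] : Function.Injective (kronRight m n A) := by
  intro U V h
  ext i j
  have := congrFun (congrFun h (Classical.arbitrary m, i)) (Classical.arbitrary m, j)
  simpa [kronRight_apply] using this

theorem map_scal_mul (h : A →ₗ[ℂ] ℂ) (C : Matrix n n ℂ) (M : Matrix n n A) :
    (scal n A C * M).map h = C * M.map h := by
  ext i j
  simp [Matrix.mul_apply, scal_apply, ← Algebra.smul_def]

theorem map_mul_scal (h : A →ₗ[ℂ] ℂ) (C : Matrix n n ℂ) (M : Matrix n n A) :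
    (M * scal n A C).map h = M.map h * C := by
  ext i j
  simp only [Matrix.map_apply, Matrix.mul_apply, scal_apply, map_sum]
  refine Finset.sum_congr rfl fun k _ => ?_
  rw [← Algebra.commutes, ← Algebra.smul_def, map_smul, smul_eq_mul, mul_comm]

/-- A projection with vanishing diagonal is zero. -/
theorem projection_eq_zero {C : Matrix n n ℂ} (h1 : C * C = C) (h2 : star C = C)
    (h3 : ∀ i, C i i = 0) : C = 0 := by
  rw [← Matrix.trace_conjTranspose_mul_self_eq_zero_iff, ← Matrix.star_eq_conjTranspose, h2, h1]
  exact Finset.sum_eq_zero fun i _ => h3 i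

/-- The square root, the kernel projection and the partial inverse of a positive matrix. -/
theorem exists_sqrt_kernel {ρ : Matrix n n ℂ} (hρ : ρ.PosSemidef) :
    ∃ s t q : Matrix n n ℂ, s.PosSemidef ∧ t.PosSemidef ∧ s * s = ρ ∧ t * s = 1 - q ∧
      s * t = 1 - q ∧ s * q = 0 ∧ star q = q := by
  have hH := hρ.isHermitian
  set P := hH.eigenvectorUnitary with hP
  let φ : Matrix n n ℂ ≃⋆ₐ[ℂ] Matrix n n ℂ := Unitary.conjStarAlgAut ℂ _ P
  have hφ : ∀ d : n → ℝ, (∀ i, 0 ≤ d i) →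
      (φ (Matrix.diagonal fun i => (d i : ℂ))).PosSemidef := by
    intro d hd
    have : (Matrix.diagonal fun i => (d i : ℂ)).PosSemidef :=
      Matrix.PosSemidef.diagonal fun i => by simpa using hd i
    simpa [φ, Unitary.conjStarAlgAut_apply, Matrix.star_eq_conjTranspose] using
      this.mul_mul_conjTranspose_same (P : Matrix n n ℂ)
  have hspec : ρ = φ (Matrix.diagonal fun i => (hH.eigenvalues i : ℂ)) := hH.spectral_theorem
  have hpos : ∀ i, 0 ≤ hH.eigenvalues i := hρ.eigenvalues_nonneg
  -- On an eigenvalue λ the three matrices are √λ, (√λ)⁻¹ and the indicator of λ = 0. The convention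
  -- 0⁻¹ = 0 makes t vanish on the kernel.
  refine ⟨φ (Matrix.diagonal fun i => (Real.sqrt (hH.eigenvalues i) : ℂ)),
    φ (Matrix.diagonal fun i => ((Real.sqrt (hH.eigenvalues i))⁻¹ : ℝ)),
    φ (Matrix.diagonal fun i => if hH.eigenvalues i = 0 then 1 else 0),
    hφ _ fun i => Real.sqrt_nonneg _, hφ _ fun i => inv_nonneg.2 (Real.sqrt_nonneg _),
    ?_, ?_, ?_, ?_, ?_⟩
  · refine Eq.trans ?_ hspec.symm
    rw [← map_mul, Matrix.diagonal_mul_diagonal]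
    congr 2
    ext i
    rw [← Complex.ofReal_mul, Real.mul_self_sqrt (hpos i)]
  · rw [← map_mul, ← map_one φ, ← map_sub, Matrix.diagonal_mul_diagonal, ← Matrix.diagonal_one,
      Matrix.diagonal_sub]
    congr 2
    ext i
    by_cases h0 : hH.eigenvalues i = 0
    · simp [h0]
    · have := (Real.sqrt_ne_zero (hpos i)).2 h0
      rw [if_neg h0, ← Complex.ofReal_mul, inv_mul_cancel₀ this]; simp
  · rw [← map_mul, ← map_one φ, ← map_sub, Matrix.diagonal_mul_diagonal, ← Matrix.diagonal_one,
      Matrix.diagonal_sub]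
    congr 2
    ext i
    by_cases h0 : hH.eigenvalues i = 0
    · simp [h0]
    · have := (Real.sqrt_ne_zero (hpos i)).2 h0
      rw [if_neg h0, ← Complex.ofReal_mul, mul_inv_cancel₀ this]; simp
  · rw [← map_mul, ← map_zero φ, Matrix.diagonal_mul_diagonal, ← Matrix.diagonal_zero]
    congr 2
    ext i
    split_ifs with h0 <;> simp [h0]
  · rw [← map_star, Matrix.star_eq_conjTranspose, Matrix.diagonal_conjTranspose]
    congr 2
    ext i
    rw [Pi.star_apply]
    split_ifs <;> simp

end Matrices

/-- `X* X = 0` implies `X = 0` for matrices over a C*-algebra. -/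
theorem matrix_eq_zero_of_star_mul_self {n : Type*} [Fintype n] {A : Type*} [CStarAlgebra A]
    {X : Matrix n n A} (hX : star X * X = 0) : X = 0 := by
  let _ := CStarAlgebra.spectralOrder A
  have := CStarAlgebra.spectralOrderedRing A
  ext i j
  have h := congrFun (congrFun hX j) j
  have h : ∑ i, star (X i j) * X i j = 0 := h
  rw [Finset.sum_eq_zero_iff_of_nonneg fun i _ => star_mul_self_nonneg (X i j)] at h
  exact (CStarRing.star_mul_self_eq_zero_iff _).1 (h i (Finset.mem_univ i))

theorem matrix_eq_zero_of_mul_star_self {n : Type*} [Fintype n] {A : Type*} [CStarAlgebra A]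
    {X : Matrix n n A} (hX : X * star X = 0) : X = 0 := by
  rw [← star_eq_zero]
  exact matrix_eq_zero_of_star_mul_self (by rwa [star_star])


/-! ### Matrix corepresentations -/

namespace CompactQuantumGroup

variable {Q : Type u} [CStarAlgebra Q] {G : CompactQuantumGroup Q} {h : Q →L[ℂ] ℂ}
variable {n : Type*} [Fintype n] [DecidableEq n]

variable (G) in
/-- A matrix over `Q` whose entries satisfy `Δ(v_ij) = ∑ v_ik ⊗ v_kj`. -/
def IsCorepMatrix (V : Matrix n n Q) : Prop :=
  amp n G.comul V = amp n (minLeft Q Q) V * amp n (minRight Q Q) V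

theorem isCorepMatrix_iff {V : Matrix n n Q} : G.IsCorepMatrix V ↔
    ∀ i j, G.comul (V i j) = ∑ k, minLeft Q Q (V i k) * minRight Q Q (V k j) := by
  rw [IsCorepMatrix, ← Matrix.ext_iff]
  rfl

namespace IsCorepMatrix

/-- In (SV₁₂T)(SV₁₃T) the inner TS is absorbed by V₁₃T. This covers conjugation by invertible
matrices as well as restriction to invariant subspaces. -/
theorem scal_mul_mul {V : Matrix n n Q} (hV : G.IsCorepMatrix V) {S T : Matrix n n ℂ}
    (hST : scal n Q (T * S) * V * scal n Q T = V * scal n Q T) :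
    G.IsCorepMatrix (scal n Q S * V * scal n Q T) := by
  have h2 := congrArg (amp n (minRight Q Q)) hST
  simp only [map_mul, amp_scal] at h2
  simp only [IsCorepMatrix, map_mul, amp_scal] at hV ⊢
  rw [hV]
  simp only [mul_assoc] at h2 ⊢
  rw [h2]

theorem scal_mul_mul' {V : Matrix n n Q} (hV : G.IsCorepMatrix V) {S T : Matrix n n ℂ}
    (hST : scal n Q S * V * scal n Q (T * S) = scal n Q S * V) :
    G.IsCorepMatrix (scal n Q S * V * scal n Q T) := by
  have h2 := congrArg (amp n (minLeft Q Q)) hST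
  simp only [map_mul, amp_scal] at h2
  simp only [IsCorepMatrix, map_mul, amp_scal] at hV ⊢
  rw [hV]
  simp only [← mul_assoc] at h2 ⊢
  rw [h2]

theorem conj {V : Matrix n n Q} (hV : G.IsCorepMatrix V) {S T : Matrix n n ℂ} (hTS : T * S = 1) :
    G.IsCorepMatrix (scal n Q S * V * scal n Q T) :=
  hV.scal_mul_mul (by rw [hTS, map_one, one_mul])

theorem conj_iff {V : Matrix n n Q} {S T : Matrix n n ℂ} (hTS : T * S = 1) (hST : S * T = 1) :
    G.IsCorepMatrix (scal n Q S * V * scal n Q T) ↔ G.IsCorepMatrix V := by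
  refine ⟨fun hV => ?_, fun hV => hV.conj hTS⟩
  have := hV.conj hST
  rwa [← mul_assoc, ← mul_assoc, ← map_mul, hTS, map_one, one_mul, mul_assoc, ← map_mul, hTS,
    map_one, mul_one] at this

end IsCorepMatrix

theorem tmul_mul_tmul (a b c d : Q) :
    minLeft Q Q a * minRight Q Q b * (minLeft Q Q c * minRight Q Q d) =
      minLeft Q Q (a * c) * minRight Q Q (b * d) := by
  rw [map_mul, map_mul, mul_assoc, ← mul_assoc (minRight Q Q b), ← minLeft_mul_minRight]
  simp only [mul_assoc]

/-! ### Averaging with the Haar state; isometric corepresentations are unitary. -/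

namespace IsHaar

/-- The mean of `V V*` intertwines `V`. -/
theorem mul_mean_mul_star (hh : G.IsHaar h) {V : Matrix n n Q} (hV : G.IsCorepMatrix V) :
    V * scal n Q ((V * star V).map h) * star V = scal n Q ((V * star V).map h) := by
  rw [isCorepMatrix_iff] at hV
  have key : ∀ i j k, G.comul (V i k * star (V j k)) = ∑ p, ∑ l,
      minLeft Q Q (V i l * star (V j p)) * minRight Q Q (V l k * star (V p k)) := by
    intro i j k
    rw [map_mul, map_star, hV, hV, star_sum, Finset.mul_sum]
    refine Finset.sum_congr rfl fun p _ => ?_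
    rw [Finset.sum_mul]
    refine Finset.sum_congr rfl fun l _ => ?_
    rw [star_mul, ← map_star, ← map_star, ← minLeft_mul_minRight, tmul_mul_tmul]
  ext i j
  -- Right invariance writes h(x)1 as (id ⊗ h)Δ(x); expanding Δ leaves V outside and averages the
  -- inner V V*.
  rw [scal_apply, Matrix.map_apply, Algebra.algebraMap_eq_smul_one, ← hh.right]
  simp only [Matrix.mul_apply, Matrix.star_apply, map_sum, key, Finset.sum_mul, scal_apply,
    Matrix.map_apply, sliceRight_tmul hh.state.1, Finset.mul_sum]
  refine Eq.trans (Finset.sum_congr rfl fun p _ => ?_) Finset.sum_comm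
  refine Eq.trans (Finset.sum_congr rfl fun l _ => Finset.sum_congr rfl fun k _ => ?_)
    Finset.sum_comm
  rw [← Algebra.commutes, mul_assoc, Algebra.smul_def]

/-- The mean of `V* V` intertwines `V`. -/
theorem star_mul_mean_mul (hh : G.IsHaar h) {V : Matrix n n Q} (hV : G.IsCorepMatrix V) :
    star V * scal n Q ((star V * V).map h) * V = scal n Q ((star V * V).map h) := by
  rw [isCorepMatrix_iff] at hV
  have key : ∀ i j k, G.comul (star (V k i) * V k j) = ∑ p, ∑ l,
      minLeft Q Q (star (V k l) * V k p) * minRight Q Q (star (V l i) * V p j) := by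
    intro i j k
    rw [map_mul, map_star, hV, hV, star_sum, Finset.mul_sum]
    refine Finset.sum_congr rfl fun p _ => ?_
    rw [Finset.sum_mul]
    refine Finset.sum_congr rfl fun l _ => ?_
    rw [star_mul, ← map_star, ← map_star, ← minLeft_mul_minRight, tmul_mul_tmul]
  ext i j
  rw [scal_apply, Matrix.map_apply, Algebra.algebraMap_eq_smul_one, ← hh.left]
  simp only [Matrix.mul_apply, Matrix.star_apply, map_sum, key, Finset.sum_mul, scal_apply,
    Matrix.map_apply, sliceLeft_tmul hh.state.1, Finset.mul_sum]
  refine Eq.trans (Finset.sum_congr rfl fun p _ => ?_) Finset.sum_comm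
  refine Eq.trans (Finset.sum_congr rfl fun l _ => Finset.sum_congr rfl fun k _ => ?_)
    Finset.sum_comm
  rw [← Algebra.commutes, mul_assoc, Algebra.smul_def]

theorem entry_mul_star_eq_zero (hh : G.IsHaar h) {V : Matrix n n Q} {i : n}
    (h0 : h ((V * star V) i i) = 0) (j : n) : h (V i j * star (V i j)) = 0 := by
  simp only [Matrix.mul_apply, Matrix.star_apply, map_sum] at h0
  refine (Finset.sum_eq_zero_iff_of_nonneg fun j _ => ?_).1 h0 j (Finset.mem_univ j)
  simpa using hh.state.1 (star (V i j))

theorem entry_star_mul_eq_zero (hh : G.IsHaar h) {V : Matrix n n Q} {j : n}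
    (h0 : h ((star V * V) j j) = 0) (i : n) : h (star (V i j) * V i j) = 0 := by
  simp only [Matrix.mul_apply, Matrix.star_apply, map_sum] at h0
  refine (Finset.sum_eq_zero_iff_of_nonneg fun i _ => ?_).1 h0 i (Finset.mem_univ i)
  exact hh.state.1 (V i j)

theorem map_star_matrix (hh : G.IsHaar h) (M : Matrix n n Q) :
    (star M).map h = star (M.map h) := by
  ext i j
  exact hh.state.1.map_star _

theorem map_one_matrix (hh : G.IsHaar h) : (1 : Matrix n n Q).map h = 1 :=
  Matrix.map_one _ (map_zero h) hh.state.2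

/-- An isometric matrix corepresentation is unitary. -/
theorem mul_star_eq_one (hh : G.IsHaar h) {V : Matrix n n Q} (hV : G.IsCorepMatrix V)
    (hiso : star V * V = 1) : V * star V = 1 := by
  set E := (V * star V).map h with hE
  have h1 : V * scal n Q E * star V = scal n Q E := hh.mul_mean_mul_star hV
  -- As V*V = 1, the relation VEV* = E says that E commutes with V; averaging E·VV* = E then shows
  -- that E is a projection.
  have h2 : scal n Q E * V = V * scal n Q E := by
    rw [← h1, mul_assoc, hiso, mul_one, h1]
  have h3 : scal n Q E * (V * star V) = scal n Q E := by rw [← mul_assoc, h2, h1]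
  have h4 : E * E = E := by
    have := congrArg (fun M : Matrix n n Q => M.map h) h3
    have e := map_scal_mul (h : Q →ₗ[ℂ] ℂ) E (V * star V)
    have e' := map_scal_mul (h : Q →ₗ[ℂ] ℂ) E 1
    simp only [ContinuousLinearMap.coe_coe] at e e'
    rw [mul_one, hh.map_one_matrix, mul_one] at e'
    simpa only [e, e', ← hE] using this
  have h5 : star E = E := by
    rw [hE, ← hh.map_star_matrix, star_mul, star_star]
  have hC : (1 - E) * (1 - E) = 1 - E := by
    rw [sub_mul, one_mul, mul_sub, h4, mul_one, sub_self, sub_zero]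
  have hC' : star (1 - E) = 1 - E := by rw [star_sub, star_one, h5]
  have hCV : scal n Q (1 - E) * V = V * scal n Q (1 - E) := by
    rw [map_sub, map_one, sub_mul, mul_sub, h2, one_mul, mul_one]
  have hV' : G.IsCorepMatrix (scal n Q (1 - E) * V) := by
    have := hV.scal_mul_mul (S := 1 - E) (T := 1 - E) (by
      rw [hC, hCV, mul_assoc, ← map_mul, hC])
    rwa [mul_assoc, ← hCV, ← mul_assoc, ← map_mul, hC] at this
  -- The mean of (CV)(CV)* with C = 1 - E is CEC = 0, so the subcorepresentation CV has null
  -- coefficients on one side, hence on both.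
  have hz : ∀ i j, h ((scal n Q (1 - E) * V) i j * star ((scal n Q (1 - E) * V) i j)) = 0 := by
    intro i j
    refine hh.entry_mul_star_eq_zero ?_ j
    have e := map_scal_mul (h : Q →ₗ[ℂ] ℂ) (1 - E) (V * star V * scal n Q (1 - E))
    rw [map_mul_scal] at e
    simp only [ContinuousLinearMap.coe_coe] at e
    rw [← hE, mul_sub E, h4, mul_one, sub_self, mul_zero] at e
    rw [star_mul, ← map_star, hC', ← mul_assoc, mul_assoc (scal n Q (1 - E)), mul_assoc]
    exact congrFun (congrFun e i) i
  have hz' := fun i j => hh.coeff_null' (isCorepMatrix_iff.1 hV') hz i j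
  have h6 : 1 - E = 0 := by
    refine projection_eq_zero hC hC' fun j => ?_
    -- On the other side (CV)*(CV) = C is scalar, and its diagonal entries are values of h on null
    -- coefficients. Hence C = 0.
    have e : star (scal n Q (1 - E) * V) * (scal n Q (1 - E) * V) = scal n Q (1 - E) := by
      rw [star_mul, ← map_star, hC', hCV, ← mul_assoc, mul_assoc (star V), hCV, ← mul_assoc,
        hiso, one_mul, ← map_mul, hC]
    have e2 : h ((star (scal n Q (1 - E) * V) * (scal n Q (1 - E) * V)) j j) = 0 := by
      simp only [Matrix.mul_apply, Matrix.star_apply, map_sum] at hz' ⊢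
      exact Finset.sum_eq_zero fun i _ => hz' i j
    rwa [e, scal_apply, Algebra.algebraMap_eq_smul_one, map_smul, hh.state.2, smul_eq_mul,
      mul_one] at e2
  rwa [← sub_eq_zero.1 h6, map_one, one_mul] at h3

/-- A coisometric matrix corepresentation is unitary. -/
theorem star_mul_eq_one (hh : G.IsHaar h) {V : Matrix n n Q} (hV : G.IsCorepMatrix V)
    (hiso : V * star V = 1) : star V * V = 1 := by
  set E := (star V * V).map h with hE
  have h1 : star V * scal n Q E * V = scal n Q E := hh.star_mul_mean_mul hV
  have h2 : scal n Q E * V = V * scal n Q E := by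
    nth_rw 2 [← h1]
    rw [mul_assoc, ← mul_assoc V, hiso, one_mul]
  have h3 : star V * V * scal n Q E = scal n Q E := by rw [mul_assoc, ← h2, ← mul_assoc, h1]
  have h4 : E * E = E := by
    have := congrArg (fun M : Matrix n n Q => M.map h) h3
    have e := map_mul_scal (h : Q →ₗ[ℂ] ℂ) E (star V * V)
    have e' := map_scal_mul (h : Q →ₗ[ℂ] ℂ) E 1
    simp only [ContinuousLinearMap.coe_coe] at e e'
    rw [mul_one, hh.map_one_matrix, mul_one] at e'
    simpa only [e, e', ← hE] using this
  have h5 : star E = E := by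
    rw [hE, ← hh.map_star_matrix, star_mul, star_star]
  have hC : (1 - E) * (1 - E) = 1 - E := by
    rw [sub_mul, one_mul, mul_sub, h4, mul_one, sub_self, sub_zero]
  have hC' : star (1 - E) = 1 - E := by rw [star_sub, star_one, h5]
  have hCV : scal n Q (1 - E) * V = V * scal n Q (1 - E) := by
    rw [map_sub, map_one, sub_mul, mul_sub, h2, one_mul, mul_one]
  have hV' : G.IsCorepMatrix (scal n Q (1 - E) * V) := by
    have := hV.scal_mul_mul (S := 1 - E) (T := 1 - E) (by
      rw [hC, hCV, mul_assoc, ← map_mul, hC])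
    rwa [mul_assoc, ← hCV, ← mul_assoc, ← map_mul, hC] at this
  have hz : ∀ i j, h (star ((scal n Q (1 - E) * V) i j) * (scal n Q (1 - E) * V) i j) = 0 := by
    intro i j
    refine hh.entry_star_mul_eq_zero ?_ i
    have e := map_scal_mul (h : Q →ₗ[ℂ] ℂ) (1 - E) (star V * V * scal n Q (1 - E))
    rw [map_mul_scal] at e
    simp only [ContinuousLinearMap.coe_coe] at e
    rw [← hE, mul_sub E, h4, mul_one, sub_self, mul_zero] at e
    rw [hCV, star_mul, ← map_star, hC', ← mul_assoc, mul_assoc (scal n Q (1 - E)), mul_assoc]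
    exact congrFun (congrFun e j) j
  have hz' := fun i j => hh.coeff_star_null (isCorepMatrix_iff.1 hV') hz i j
  have h6 : 1 - E = 0 := by
    refine projection_eq_zero hC hC' fun j => ?_
    have e : scal n Q (1 - E) * V * star (scal n Q (1 - E) * V) = scal n Q (1 - E) := by
      rw [star_mul, ← map_star, hC', mul_assoc, ← mul_assoc V, hiso, one_mul, ← map_mul, hC]
    have e2 : h ((scal n Q (1 - E) * V * star (scal n Q (1 - E) * V)) j j) = 0 := by
      rw [Matrix.mul_apply, map_sum]
      exact Finset.sum_eq_zero fun i _ => hz' j i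
    rwa [e, scal_apply, Algebra.algebraMap_eq_smul_one, map_smul, hh.state.2, smul_eq_mul,
      mul_one] at e2
  rwa [← sub_eq_zero.1 h6, map_one, mul_one] at h3

end IsHaar

end CompactQuantumGroup


namespace CompactQuantumGroup

variable {Q : Type u} [CStarAlgebra Q] {G : CompactQuantumGroup Q} {h : Q →L[ℂ] ℂ}
variable {m n : Type*} [Fintype m] [DecidableEq m] [Fintype n] [DecidableEq n]

/-! ### Unitarizability of the conjugate of a projective corepresentation -/

namespace IsHaar

/-- The quadratic form at x is Σ_k h(y_k* y_k) with y = Mx. -/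
theorem posSemidef_map (hh : G.IsHaar h) (M : Matrix n n Q) :
    ((star M * M).map h).PosSemidef := by
  refine Matrix.PosSemidef.of_dotProduct_mulVec_nonneg ?_ fun x => ?_
  · rw [Matrix.IsHermitian, ← Matrix.star_eq_conjTranspose, ← hh.map_star_matrix, star_mul,
      star_star]
  · have e : star x ⬝ᵥ ((star M * M).map h).mulVec x =
        ∑ k, h (star (∑ i, x i • M k i) * ∑ j, x j • M k j) := by
      simp only [dotProduct, Matrix.mulVec, Matrix.map_apply, Matrix.mul_apply, Matrix.star_apply,
        Pi.star_apply, star_sum, star_smul, Finset.sum_mul, Finset.mul_sum, map_sum,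
        smul_mul_assoc, mul_smul_comm, map_smul, smul_eq_mul]
      rw [Finset.sum_comm]
      refine Eq.trans (Finset.sum_congr rfl fun p _ => Finset.sum_comm) ?_
      rw [Finset.sum_comm]
      refine Finset.sum_congr rfl fun k _ => Finset.sum_congr rfl fun i _ =>
        Finset.sum_congr rfl fun j _ => ?_
      ring
    rw [e]
    exact Finset.sum_nonneg fun k _ => hh.state.1 _

theorem map_kronLeft (M : Matrix m m Q) :
    (kronLeft m n Q M).map h = kronLeft m n ℂ (M.map h) := by
  ext p q
  simp only [Matrix.map_apply, kronLeft_apply, apply_ite h, map_zero]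

theorem map_kronRight (M : Matrix n n Q) :
    (kronRight m n Q M).map h = kronRight m n ℂ (M.map h) := by
  ext p q
  simp only [Matrix.map_apply, kronRight_apply, apply_ite h, map_zero]

theorem map_scal_mul_mul (S T : Matrix n n ℂ) (M : Matrix n n Q) :
    (scal n Q S * M * scal n Q T).map h = S * M.map h * T := by
  have e := map_mul_scal (h : Q →ₗ[ℂ] ℂ) T (scal n Q S * M)
  rw [map_scal_mul] at e
  exact e

/-- The scalar ρ = h(A*A) satisfies A*ρA = ρ, so ρ^{1/2}Aρ^{-1/2} is isometric once ρ has no kernel;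
the unitarity of isometric corepresentations upgrades this to a unitary. -/
theorem exists_unitary_conj_right (hh : G.IsHaar h) [Nonempty n] {U : Matrix n n Q}
    (hU : star U * U = 1) (hU' : U * star U = 1)
    (hW : G.IsCorepMatrix (kronLeft n n Q U * kronRight n n Q (U.map star))) :
    ∃ s t : Matrix n n ℂ, s.PosSemidef ∧ s * t = 1 ∧ t * s = 1 ∧
      scal n Q s * U.map star * scal n Q t ∈ unitary (Matrix n n Q) := by
  set A : Matrix n n Q := U.map star with hA
  have hkU : star (kronLeft n n Q U) * kronLeft n n Q U = 1 := by
    rw [← map_star, ← map_mul, hU, map_one]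
  have hstar : ∀ (B : Matrix n n Q) (C : Matrix n n ℂ),
      star (kronLeft n n Q U * kronRight n n Q B) * kronRight n n Q (scal n Q C) *
        (kronLeft n n Q U * kronRight n n Q B) = kronRight n n Q (star B * scal n Q C * B) := by
    intro B C
    rw [star_mul, mul_assoc, ← mul_assoc (kronRight n n Q (scal n Q C)), ← commute_kronLeft_scal,
      mul_assoc, mul_assoc (kronLeft n n Q U), ← mul_assoc (star (kronLeft n n Q U)), hkU, one_mul,
      ← map_star, ← map_mul, ← map_mul, mul_assoc]
  have hstar' : ∀ B : Matrix n n Q, star (kronLeft n n Q U * kronRight n n Q B) *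
      (kronLeft n n Q U * kronRight n n Q B) = kronRight n n Q (star B * B) := by
    intro B
    simpa only [map_one, mul_one] using hstar B 1
  set ρ := (star A * A).map h with hρ
  -- The factor U cancels in W*(1 ⊗ C)W, so the averaging identity for W = U ⊗ A concerns the second
  -- tensor factor only.
  have hAρ : star A * scal n Q ρ * A = scal n Q ρ := by
    have := hh.star_mul_mean_mul hW
    rw [hstar', map_kronRight, ← kronRight_scal, hstar] at this
    exact kronRight_injective this
  obtain ⟨s, t, q, hs, ht, hss, hts, hst, hsq, hq⟩ :=
    exists_sqrt_kernel (hh.posSemidef_map A)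
  rw [← hρ] at hss
  have hs' : star s = s := hs.isHermitian
  have ht' : star t = t := ht.isHermitian
  -- Its square is qA*ρAq = qρq = 0. Consequently A maps the kernel of ρ into itself, i.e. qAq = Aq.
  have hX : scal n Q s * A * scal n Q q = 0 := by
    refine matrix_eq_zero_of_star_mul_self ?_
    have e : star (scal n Q s * A * scal n Q q) * (scal n Q s * A * scal n Q q) =
        scal n Q q * (star A * scal n Q (s * s) * A) * scal n Q q := by
      rw [star_mul, star_mul, ← map_star, ← map_star, hs', hq, map_mul]
      simp only [mul_assoc]
    rw [e, hss, hAρ, ← map_mul, ← map_mul, ← hss, mul_assoc, mul_assoc, hsq, mul_zero, mul_zero,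
      map_zero]
  have hAq : scal n Q q * (A * scal n Q q) = A * scal n Q q := by
    have e : scal n Q (t * s) * (A * scal n Q q) = 0 := by
      rw [map_mul, mul_assoc, ← mul_assoc (scal n Q s), hX, mul_zero]
    rw [hts, map_sub, map_one, sub_mul, one_mul, sub_eq_zero] at e
    exact e.symm
  -- The subcorepresentation U ⊗ Aq has coefficients null for h, so h(xb) = 0 for each coefficient x
  -- = u_ij (Aq)_kl and each b. With b = u_kl' u_ij*, unitarity of U makes the sum of xb over j and
  -- k the scalar q_{l'l}.
  have hq0 : q = 0 := by
    have hWq : G.IsCorepMatrix (kronLeft n n Q U * kronRight n n Q (A * scal n Q q)) := by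
      have := hW.scal_mul_mul (S := 1) (T := kronRight n n ℂ q) (by
        rw [mul_one, ← kronRight_scal, ← mul_assoc, ← commute_kronLeft_scal, mul_assoc, mul_assoc,
          ← map_mul, ← map_mul, hAq, mul_assoc, ← map_mul])
      rwa [map_one, one_mul, ← kronRight_scal, mul_assoc, ← map_mul] at this
    have hz := hh.coeff_star_null (isCorepMatrix_iff.1 hWq) fun p r =>
      hh.entry_star_mul_eq_zero (by
        have e : (star (A * scal n Q q) * (A * scal n Q q)).map h = 0 := by
          rw [star_mul, ← map_star, hq, ← mul_assoc, mul_assoc (scal n Q q), map_scal_mul_mul,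
            ← hρ, ← hss, mul_assoc, mul_assoc, hsq, mul_zero, mul_zero]
        have e2 := congrArg (fun M => kronRight n n ℂ M r r) e
        simp only [← map_kronRight, ← hstar', map_zero] at e2
        exact e2) p
    have hz' := fun p r => hh.state.1.apply_mul_eq_zero' (hz p r)
    simp only [kron_mul_apply] at hz'
    ext l' l
    obtain ⟨i⟩ := ‹Nonempty n›
    have e1 : ∑ k, (A * scal n Q q) k l * U k l' = algebraMap ℂ Q (q l' l) := by
      have : ∀ k, (A * scal n Q q) k l * U k l' =
          ∑ p, algebraMap ℂ Q (q p l) * (star (U k p) * U k l') := by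
        intro k
        rw [Matrix.mul_apply, Finset.sum_mul]
        refine Finset.sum_congr rfl fun p _ => ?_
        rw [scal_apply, ← Algebra.commutes, mul_assoc]; rfl
      simp only [this]
      rw [Finset.sum_comm]
      simp only [← Finset.mul_sum]
      have e4 : ∀ p, ∑ k, star (U k p) * U k l' = (1 : Matrix n n Q) p l' := fun p => by
        rw [← hU]; rfl
      simp [e4, Matrix.one_apply]
    have e2 : ∑ j, U i j * star (U i j) = 1 := by
      have := congrFun (congrFun hU' i) i
      rw [Matrix.one_apply_eq] at this
      exact this
    have e5 : h (∑ j, ∑ k, U i j * (A * scal n Q q) k l * (U k l' * star (U i j))) = 0 := by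
      rw [map_sum]
      refine Finset.sum_eq_zero fun j _ => ?_
      rw [map_sum]
      exact Finset.sum_eq_zero fun k _ => hz' (i, k) (j, l) _
    have e6 : ∑ j, ∑ k, U i j * (A * scal n Q q) k l * (U k l' * star (U i j)) =
        algebraMap ℂ Q (q l' l) := by
      have : ∀ j, ∑ k, U i j * (A * scal n Q q) k l * (U k l' * star (U i j)) =
          algebraMap ℂ Q (q l' l) * (U i j * star (U i j)) := by
        intro j
        rw [← mul_assoc, Algebra.commutes, ← e1, Finset.mul_sum, Finset.sum_mul]
        exact Finset.sum_congr rfl fun k _ => by simp only [mul_assoc]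
      simp only [this]
      rw [← Finset.mul_sum, e2, mul_one]
    rwa [e6, Algebra.algebraMap_eq_smul_one, map_smul, hh.state.2, smul_eq_mul, mul_one] at e5
  rw [hq0, sub_zero] at hts hst
  refine ⟨s, t, hs, hst, hts, ?_⟩
  have hB : star (scal n Q s * A * scal n Q t) * (scal n Q s * A * scal n Q t) = 1 := by
    have e : star (scal n Q s * A * scal n Q t) * (scal n Q s * A * scal n Q t) =
        scal n Q t * (star A * scal n Q (s * s) * A) * scal n Q t := by
      rw [star_mul, star_mul, ← map_star, ← map_star, hs', ht', map_mul]
      simp only [mul_assoc]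
    rw [e, hss, hAρ, ← map_mul, ← map_mul, ← hss, ← mul_assoc, hts, one_mul, hst, map_one]
  refine ⟨hB, ?_⟩
  set B := scal n Q s * A * scal n Q t with hBdef
  have hV : G.IsCorepMatrix (kronLeft n n Q U * kronRight n n Q B) := by
    have := hW.conj (S := kronRight n n ℂ s) (T := kronRight n n ℂ t) (by
      rw [← map_mul, hts, map_one])
    rwa [← kronRight_scal, ← kronRight_scal, ← mul_assoc, ← commute_kronLeft_scal, mul_assoc,
      mul_assoc, ← map_mul, ← map_mul, ← mul_assoc] at this
  -- From here only B*B = 1 and the corepresentation property of U ⊗ B matter.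
  clear_value B
  have hVV := hh.mul_star_eq_one hV (by rw [hstar', hB, map_one])
  refine kronRight_injective (m := n) ?_
  rw [map_one]
  calc kronRight n n Q (B * star B)
      = star (kronLeft n n Q U) * (kronLeft n n Q U * kronRight n n Q B *
          star (kronLeft n n Q U * kronRight n n Q B)) * kronLeft n n Q U := by
        rw [star_mul, map_mul, map_star]
        simp only [mul_assoc]
        rw [hkU, mul_one, ← mul_assoc (star (kronLeft n n Q U)), hkU, one_mul]
    _ = 1 := by rw [hVV, mul_one, hkU]

/-- Mirror image: now U cancels in WW*, the invariant mean is ρ = h(AA*) with AρA* = ρ, and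
conjugation by ρ^{-1/2} first gives a coisometry. -/
theorem exists_unitary_conj_left (hh : G.IsHaar h) [Nonempty n] {U : Matrix n n Q}
    (hU : star U * U = 1) (hU' : U * star U = 1)
    (hW : G.IsCorepMatrix (kronLeft n n Q (U.map star) * kronRight n n Q U)) :
    ∃ s t : Matrix n n ℂ, s.PosSemidef ∧ s * t = 1 ∧ t * s = 1 ∧
      scal n Q s * U.map star * scal n Q t ∈ unitary (Matrix n n Q) := by
  set A : Matrix n n Q := U.map star with hA
  have hkU' : kronRight n n Q U * star (kronRight n n Q U) = 1 := by
    rw [← map_star, ← map_mul, hU', map_one]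
  have hstar : ∀ (B : Matrix n n Q) (C : Matrix n n ℂ),
      kronLeft n n Q B * kronRight n n Q U * kronLeft n n Q (scal n Q C) *
        star (kronLeft n n Q B * kronRight n n Q U) =
        kronLeft n n Q (B * scal n Q C * star B) := by
    intro B C
    rw [star_mul, mul_assoc (kronLeft n n Q B), ← commute_kronRight_scal]
    simp only [mul_assoc]
    rw [← mul_assoc (kronRight n n Q U), hkU', one_mul, ← map_star, ← map_mul, ← map_mul]
  have hstar' : ∀ B : Matrix n n Q, kronLeft n n Q B * kronRight n n Q U *
      star (kronLeft n n Q B * kronRight n n Q U) = kronLeft n n Q (B * star B) := by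
    intro B
    simpa only [map_one, mul_one] using hstar B 1
  set ρ := (A * star A).map h with hρ
  have hAρ : A * scal n Q ρ * star A = scal n Q ρ := by
    have := hh.mul_mean_mul_star hW
    rw [hstar', map_kronLeft, ← kronLeft_scal, hstar] at this
    exact kronLeft_injective this
  obtain ⟨s, t, q, hs, ht, hss, hts, hst, hsq, hq⟩ :=
    exists_sqrt_kernel (hh.posSemidef_map (star A))
  rw [star_star, ← hρ] at hss
  have hs' : star s = s := hs.isHermitian
  have ht' : star t = t := ht.isHermitian
  have hX : scal n Q q * A * scal n Q s = 0 := by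
    refine matrix_eq_zero_of_mul_star_self ?_
    have e : scal n Q q * A * scal n Q s * star (scal n Q q * A * scal n Q s) =
        scal n Q q * (A * scal n Q (s * s) * star A) * scal n Q q := by
      rw [star_mul, star_mul, ← map_star, ← map_star, hs', hq, map_mul]
      simp only [mul_assoc]
    rw [e, hss, hAρ, ← map_mul, ← map_mul, ← hss, mul_assoc, mul_assoc, hsq, mul_zero, mul_zero,
      map_zero]
  have hAq : scal n Q q * A * scal n Q q = scal n Q q * A := by
    have e : scal n Q q * A * scal n Q (s * t) = 0 := by
      rw [map_mul, ← mul_assoc, hX, zero_mul]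
    rw [hst, map_sub, map_one, mul_sub, mul_one, sub_eq_zero] at e
    exact e.symm
  have hq0 : q = 0 := by
    have hWq : G.IsCorepMatrix (kronLeft n n Q (scal n Q q * A) * kronRight n n Q U) := by
      have := hW.scal_mul_mul' (S := kronLeft n n ℂ q) (T := 1) (by
        rw [one_mul, ← kronLeft_scal, mul_assoc, mul_assoc, ← commute_kronRight_scal, ← mul_assoc,
          ← mul_assoc, ← map_mul, ← map_mul, hAq, ← mul_assoc, ← map_mul])
      rwa [map_one, mul_one, ← kronLeft_scal, ← mul_assoc, ← map_mul] at this
    have hz := hh.coeff_null' (isCorepMatrix_iff.1 hWq) fun p r =>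
      hh.entry_mul_star_eq_zero (by
        have e : (scal n Q q * A * star (scal n Q q * A)).map h = 0 := by
          rw [star_mul, ← map_star, hq, ← mul_assoc, mul_assoc (scal n Q q), map_scal_mul_mul,
            ← hρ, ← hss, mul_assoc, mul_assoc, hsq, mul_zero, mul_zero]
        have e2 := congrArg (fun M => kronLeft n n ℂ M p p) e
        simp only [← map_kronLeft, ← hstar', map_zero] at e2
        exact e2) r
    have hz' := fun p r => hh.state.1.apply_mul_eq_zero (hz p r)
    simp only [kron_mul_apply] at hz'
    ext k k'
    obtain ⟨j⟩ := ‹Nonempty n›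
    have e1 : ∑ l, U k' l * (scal n Q q * A) k l = algebraMap ℂ Q (q k k') := by
      have : ∀ l, U k' l * (scal n Q q * A) k l =
          ∑ p, algebraMap ℂ Q (q k p) * (U k' l * star (U p l)) := by
        intro l
        rw [Matrix.mul_apply, Finset.mul_sum]
        refine Finset.sum_congr rfl fun p _ => ?_
        rw [scal_apply, ← mul_assoc, ← Algebra.commutes, mul_assoc]; rfl
      simp only [this]
      rw [Finset.sum_comm]
      simp only [← Finset.mul_sum]
      have e4 : ∀ p, ∑ l, U k' l * star (U p l) = (1 : Matrix n n Q) k' p := fun p => by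
        rw [← hU']; rfl
      simp [e4, Matrix.one_apply]
    have e2 : ∑ i, star (U i j) * U i j = 1 := by
      have := congrFun (congrFun hU j) j
      rw [Matrix.one_apply_eq] at this
      exact this
    have e5 : h (∑ i, ∑ l, star (U i j) * U k' l * ((scal n Q q * A) k l * U i j)) = 0 := by
      rw [map_sum]
      refine Finset.sum_eq_zero fun i _ => ?_
      rw [map_sum]
      exact Finset.sum_eq_zero fun l _ => hz' (k, i) (l, j) _
    have e6 : ∑ i, ∑ l, star (U i j) * U k' l * ((scal n Q q * A) k l * U i j) =
        algebraMap ℂ Q (q k k') := by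
      have : ∀ i, ∑ l, star (U i j) * U k' l * ((scal n Q q * A) k l * U i j) =
          algebraMap ℂ Q (q k k') * (star (U i j) * U i j) := by
        intro i
        rw [← mul_assoc, Algebra.commutes, ← e1, Finset.mul_sum, Finset.sum_mul]
        exact Finset.sum_congr rfl fun k _ => by simp only [mul_assoc]
      simp only [this]
      rw [← Finset.mul_sum, e2, mul_one]
    rwa [e6, Algebra.algebraMap_eq_smul_one, map_smul, hh.state.2, smul_eq_mul, mul_one] at e5
  rw [hq0, sub_zero] at hts hst
  -- The roles are exchanged with respect to the right-hand case: the conjugating positive matrix is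
  -- t = ρ^{-1/2}.
  refine ⟨t, s, ht, hts, hst, ?_⟩
  have hB : scal n Q t * A * scal n Q s * star (scal n Q t * A * scal n Q s) = 1 := by
    have e : scal n Q t * A * scal n Q s * star (scal n Q t * A * scal n Q s) =
        scal n Q t * (A * scal n Q (s * s) * star A) * scal n Q t := by
      rw [star_mul, star_mul, ← map_star, ← map_star, hs', ht', map_mul]
      simp only [mul_assoc]
    rw [e, hss, hAρ, ← map_mul, ← map_mul, ← hss, ← mul_assoc, hts, one_mul, hst, map_one]
  refine ⟨?_, hB⟩
  set B := scal n Q t * A * scal n Q s with hBdef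
  have hV : G.IsCorepMatrix (kronLeft n n Q B * kronRight n n Q U) := by
    have := hW.conj (S := kronLeft n n ℂ t) (T := kronLeft n n ℂ s) (by
      rw [← map_mul, hst, map_one])
    rwa [← kronLeft_scal, ← kronLeft_scal, mul_assoc, mul_assoc, ← commute_kronRight_scal,
      ← mul_assoc, ← mul_assoc, ← map_mul, ← map_mul] at this
  clear_value B
  have hVV := hh.star_mul_eq_one hV (by rw [hstar', hB, map_one])
  refine kronLeft_injective (n := n) ?_
  rw [map_one]
  calc kronLeft n n Q (star B * B)
      = kronRight n n Q U * (star (kronLeft n n Q B * kronRight n n Q U) *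
          (kronLeft n n Q B * kronRight n n Q U)) * star (kronRight n n Q U) := by
        rw [star_mul, map_mul, map_star]
        simp only [mul_assoc]
        rw [hkU', mul_one, ← mul_assoc (kronRight n n Q U), hkU', one_mul]
    _ = 1 := by rw [hVV, mul_one, hkU']

end IsHaar

/-- The Haar state needs Q ≠ 0 and the kernel argument needs an index; in the two degenerate cases
all matrices over Q coincide. -/
theorem exists_unitary_conj_right {U : Matrix n n Q} (hU : U ∈ unitary (Matrix n n Q))
    (hW : G.IsCorepMatrix (kronLeft n n Q U * kronRight n n Q (U.map star))) :
    ∃ s t : Matrix n n ℂ, s.PosSemidef ∧ s * t = 1 ∧ t * s = 1 ∧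
      scal n Q s * U.map star * scal n Q t ∈ unitary (Matrix n n Q) := by
  cases isEmpty_or_nonempty n
  · exact ⟨1, 1, Matrix.PosSemidef.one, one_mul 1, one_mul 1, Subsingleton.elim _ _,
      Subsingleton.elim _ _⟩
  cases subsingleton_or_nontrivial Q
  · exact ⟨1, 1, Matrix.PosSemidef.one, one_mul 1, one_mul 1, Subsingleton.elim _ _,
      Subsingleton.elim _ _⟩
  obtain ⟨h, hh⟩ := G.exists_isHaar
  exact hh.exists_unitary_conj_right hU.1 hU.2 hW

theorem exists_unitary_conj_left {U : Matrix n n Q} (hU : U ∈ unitary (Matrix n n Q))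
    (hW : G.IsCorepMatrix (kronLeft n n Q (U.map star) * kronRight n n Q U)) :
    ∃ s t : Matrix n n ℂ, s.PosSemidef ∧ s * t = 1 ∧ t * s = 1 ∧
      scal n Q s * U.map star * scal n Q t ∈ unitary (Matrix n n Q) := by
  cases isEmpty_or_nonempty n
  · exact ⟨1, 1, Matrix.PosSemidef.one, one_mul 1, one_mul 1, Subsingleton.elim _ _,
      Subsingleton.elim _ _⟩
  cases subsingleton_or_nontrivial Q
  · exact ⟨1, 1, Matrix.PosSemidef.one, one_mul 1, one_mul 1, Subsingleton.elim _ _,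
      Subsingleton.elim _ _⟩
  obtain ⟨h, hh⟩ := G.exists_isHaar
  exact hh.exists_unitary_conj_left hU.1 hU.2 hW

end CompactQuantumGroup


namespace CompactQuantumGroup

variable {Q : Type u} [CStarAlgebra Q] {G : CompactQuantumGroup Q}
variable {n : Type*} [Fintype n] [DecidableEq n]

/-! ### Projective corepresentations in matrix form -/

theorem amp_mem_unitary {A B : Type*} [Ring A] [StarRing A] [Algebra ℂ A]
    [Ring B] [StarRing B] [Algebra ℂ B] (f : A →⋆ₐ[ℂ] B)
    {U : Matrix n n A} (hU : U ∈ unitary (Matrix n n A)) : amp n f U ∈ unitary (Matrix n n B) :=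
  ⟨by rw [← map_star, ← map_mul, hU.1, map_one], by rw [← map_star, ← map_mul, hU.2, map_one]⟩

/-- The entries of `U₁₂ U₁₃`. -/
def legProd (U : Matrix n n Q) : Matrix n n (MinTensor Q Q) :=
  amp n (minLeft Q Q) U * amp n (minRight Q Q) U

theorem legProd_apply (U : Matrix n n Q) (i j : n) :
    legProd U i j = ∑ k, minLeft Q Q (U i k) * minRight Q Q (U k j) := rfl

theorem legProd_mem_unitary {U : Matrix n n Q} (hU : U ∈ unitary (Matrix n n Q)) :
    legProd U ∈ unitary (Matrix n n (MinTensor Q Q)) :=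
  mul_mem (amp_mem_unitary _ hU) (amp_mem_unitary _ hU)

theorem sum_star_mul {A : Type*} [Ring A] [StarRing A] {M : Matrix n n A}
    (hM : M ∈ unitary (Matrix n n A)) (j : n) : ∑ k, star (M k j) * M k j = 1 := by
  have := congrFun (congrFun hM.1 j) j
  rw [Matrix.one_apply_eq] at this
  exact this

theorem sum_mul_star {A : Type*} [Ring A] [StarRing A] {M : Matrix n n A}
    (hM : M ∈ unitary (Matrix n n A)) (i : n) : ∑ k, M i k * star (M i k) = 1 := by
  have := congrFun (congrFun hM.2 i) i
  rw [Matrix.one_apply_eq] at this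
  exact this

/-- Since the legs commute, the (i,k),(j,l) entry of the product of the two legs of U ⊗ U^c regroups
as L_ij L_kl*, where L = U₁₂U₁₃. This makes the corepresentation condition directly comparable with
a cocycle. -/
theorem isCorepMatrix_kron_conj_iff (U : Matrix n n Q) :
    G.IsCorepMatrix (kronLeft n n Q U * kronRight n n Q (U.map star)) ↔
      ∀ i j k l, G.comul (U i j) * star (G.comul (U k l)) =
        legProd U i j * star (legProd U k l) := by
  have key : ∀ i j k l, legProd U i j * star (legProd U k l) = ∑ p : n × n,
      minLeft Q Q ((kronLeft n n Q U * kronRight n n Q (U.map star)) (i, k) p) *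
        minRight Q Q ((kronLeft n n Q U * kronRight n n Q (U.map star)) p (j, l)) := by
    intro i j k l
    simp only [kron_mul_apply, Matrix.map_apply]
    rw [legProd_apply, legProd_apply, star_sum, Finset.sum_mul_sum, Fintype.sum_prod_type]
    refine Finset.sum_congr rfl fun p _ => Finset.sum_congr rfl fun q _ => ?_
    rw [star_mul, ← map_star, ← map_star, ← minLeft_mul_minRight, tmul_mul_tmul]
  rw [isCorepMatrix_iff]
  constructor
  · intro h i j k l
    rw [key, ← h (i, k) (j, l), kron_mul_apply, map_mul, Matrix.map_apply, map_star]
  · rintro h ⟨i, k⟩ ⟨j, l⟩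
    rw [← key, ← h, kron_mul_apply, map_mul, Matrix.map_apply, map_star]

theorem isCorepMatrix_conj_kron_iff (U : Matrix n n Q) :
    G.IsCorepMatrix (kronLeft n n Q (U.map star) * kronRight n n Q U) ↔
      ∀ i j k l, star (G.comul (U k l)) * G.comul (U i j) =
        star (legProd U k l) * legProd U i j := by
  have key : ∀ i j k l, star (legProd U k l) * legProd U i j = ∑ p : n × n,
      minLeft Q Q ((kronLeft n n Q (U.map star) * kronRight n n Q U) (k, i) p) *
        minRight Q Q ((kronLeft n n Q (U.map star) * kronRight n n Q U) p (l, j)) := by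
    intro i j k l
    simp only [kron_mul_apply, Matrix.map_apply]
    rw [legProd_apply, legProd_apply, star_sum, Finset.sum_mul_sum, Fintype.sum_prod_type]
    refine Finset.sum_congr rfl fun p _ => Finset.sum_congr rfl fun q _ => ?_
    rw [star_mul, ← map_star, ← map_star, ← minLeft_mul_minRight, tmul_mul_tmul]
  rw [isCorepMatrix_iff]
  constructor
  · intro h i j k l
    rw [key, ← h (k, i) (l, j), kron_mul_apply, map_mul, Matrix.map_apply, map_star]
  · rintro h ⟨k, i⟩ ⟨l, j⟩
    rw [← key, ← h, kron_mul_apply, map_mul, Matrix.map_apply, map_star]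

theorem idTensor_legProd (U : Matrix n n Q) (i j : n) :
    idTensor Q G.comul (legProd U i j) =
      ∑ k, leg₁ Q Q Q (U i k) * leg₂₃ Q Q Q (G.comul (U k j)) := by
  rw [legProd_apply, map_sum]
  exact Finset.sum_congr rfl fun k _ => by rw [map_mul, idTensor_minLeft, idTensor_minRight]

theorem tensorId_legProd (U : Matrix n n Q) (i j : n) :
    tensorId G.comul Q (legProd U i j) =
      ∑ k, leg₁₂ Q Q Q (G.comul (U i k)) * leg₃ Q Q Q (U k j) := by
  rw [legProd_apply, map_sum]
  exact Finset.sum_congr rfl fun k _ => by rw [map_mul, tensorId_minLeft, tensorId_minRight]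

/-- Both sides are the (i,j) entry of U₁₂U₁₃U₁₄, bracketed in two ways. -/
theorem sum_leg₁_leg₂₃_legProd (U : Matrix n n Q) (i j : n) :
    ∑ k, leg₁ Q Q Q (U i k) * leg₂₃ Q Q Q (legProd U k j) =
      ∑ k, leg₁₂ Q Q Q (legProd U i k) * leg₃ Q Q Q (U k j) := by
  simp only [legProd_apply, map_sum, map_mul, Finset.mul_sum, Finset.sum_mul, leg₁₂_minLeft,
    leg₁₂_minRight, leg₂₃_minRight, mul_assoc]
  exact Finset.sum_comm

/-- A unitary matrix is right projective iff `U ⊗ Uᶜ` is a corepresentation. -/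
theorem exists_rightCocycle_iff {U : Matrix n n Q} (hU : U ∈ unitary (Matrix n n Q)) :
    (∃ Ω, G.IsRightCocycle Ω ∧ ∀ i j, G.comul (U i j) * Ω = legProd U i j) ↔
      G.IsCorepMatrix (kronLeft n n Q U * kronRight n n Q (U.map star)) := by
  rw [isCorepMatrix_kron_conj_iff]
  constructor
  · rintro ⟨Ω, ⟨hΩ, -⟩, h⟩ i j k l
    rw [← h, ← h, star_mul, mul_assoc, ← mul_assoc Ω, hΩ.2, one_mul]
  intro h
  have hD : ∀ j, ∑ k, star (G.comul (U k j)) * G.comul (U k j) = 1 :=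
    sum_star_mul (amp_mem_unitary G.comul hU)
  have hB := sum_star_mul (legProd_mem_unitary hU)
  rcases isEmpty_or_nonempty n with _ | ⟨⟨r⟩⟩
  · exact ⟨1, ⟨one_mem _, by simp only [map_one]⟩, fun i => isEmptyElim i⟩
  -- Solving Δ(u_kr)Ω = L_kr by means of Σ_k Δ(u_kr)*Δ(u_kr) = 1 leaves only this candidate; the
  -- column r is arbitrary.
  let Ω : MinTensor Q Q := ∑ k, star (G.comul (U k r)) * legProd U k r
  have h1 : ∀ i j, G.comul (U i j) * Ω = legProd U i j := by
    intro i j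
    simp only [Ω, Finset.mul_sum, ← mul_assoc, h]
    simp only [mul_assoc]
    rw [← Finset.mul_sum, hB, mul_one]
  have h2 : ∀ i j, legProd U i j * star Ω = G.comul (U i j) := by
    intro i j
    simp only [Ω, star_sum, star_mul, star_star, Finset.mul_sum, ← mul_assoc, ← h]
    simp only [mul_assoc]
    rw [← Finset.mul_sum, hD, mul_one]
  refine ⟨Ω, ⟨⟨?_, ?_⟩, ?_⟩, h1⟩
  · rw [← hB r]
    conv_lhs => rw [show star Ω = ∑ k, star (legProd U k r) * G.comul (U k r) by
      simp [Ω, star_sum]]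
    rw [Finset.sum_mul]
    simp only [mul_assoc, h1]
  · rw [← hD r, Finset.sum_mul]
    simp only [mul_assoc, h2]
  -- After multiplication by Δ²(u_ij), either side of the cocycle identity collapses to the entry of
  -- U₁₂U₁₃U₁₄.
  · have e : ∀ i j, idTensor Q G.comul (G.comul (U i j)) *
        (idTensor Q G.comul Ω * leg₂₃ Q Q Q Ω) =
        idTensor Q G.comul (G.comul (U i j)) * (tensorId G.comul Q Ω * leg₁₂ Q Q Q Ω) := by
      intro i j
      rw [← mul_assoc, ← map_mul, h1, idTensor_legProd, Finset.sum_mul, ← G.coassoc, ← mul_assoc,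
        ← map_mul, h1, tensorId_legProd, Finset.sum_mul]
      simp only [mul_assoc]
      simp only [← (commute_leg₁₂_leg₃ Ω _).eq, ← map_mul, h1]
      simp only [← mul_assoc, ← map_mul, h1]
      exact sum_leg₁_leg₂₃_legProd U i j
    -- The r-th column of Δ²(U) is isometric, so the factor Δ²(u_kr) can be cancelled after
    -- summation over k.
    have e2 : ∀ X : MinTensor₃ Q Q Q, X = ∑ k, star (idTensor Q G.comul (G.comul (U k r))) *
        (idTensor Q G.comul (G.comul (U k r)) * X) := by
      intro X
      have := congrArg (idTensor Q G.comul) (hD r)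
      simp only [map_sum, map_mul, map_star, map_one] at this
      simp only [← mul_assoc]
      rw [← Finset.sum_mul, this, one_mul]
    rw [e2 (idTensor Q G.comul Ω * leg₂₃ Q Q Q Ω), e2 (tensorId G.comul Q Ω * leg₁₂ Q Q Q Ω)]
    simp only [e]

/-- A unitary matrix is left projective iff `Uᶜ ⊗ U` is a corepresentation. -/
theorem exists_leftCocycle_iff {U : Matrix n n Q} (hU : U ∈ unitary (Matrix n n Q)) :
    (∃ Ω, G.IsLeftCocycle Ω ∧ ∀ i j, Ω * G.comul (U i j) = legProd U i j) ↔
      G.IsCorepMatrix (kronLeft n n Q (U.map star) * kronRight n n Q U) := by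
  rw [isCorepMatrix_conj_kron_iff]
  constructor
  · rintro ⟨Ω, ⟨hΩ, -⟩, h⟩ i j k l
    rw [← h, ← h, star_mul, mul_assoc, ← mul_assoc (star Ω), hΩ.1, one_mul]
  intro h
  have hD : ∀ i, ∑ k, G.comul (U i k) * star (G.comul (U i k)) = 1 :=
    sum_mul_star (amp_mem_unitary G.comul hU)
  have hB := sum_mul_star (legProd_mem_unitary hU)
  rcases isEmpty_or_nonempty n with _ | ⟨⟨r⟩⟩
  · exact ⟨1, ⟨one_mem _, by simp only [map_one]⟩, fun i => isEmptyElim i⟩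
  -- On this side row r plays the part of the column, with Σ_k Δ(u_rk)Δ(u_rk)* = 1.
  let Ω : MinTensor Q Q := ∑ k, legProd U r k * star (G.comul (U r k))
  have h1 : ∀ i j, Ω * G.comul (U i j) = legProd U i j := by
    intro i j
    simp only [Ω, Finset.sum_mul, mul_assoc, h]
    simp only [← mul_assoc]
    rw [← Finset.sum_mul, hB, one_mul]
  have h2 : ∀ i j, star Ω * legProd U i j = G.comul (U i j) := by
    intro i j
    simp only [Ω, star_sum, star_mul, star_star, Finset.sum_mul, mul_assoc, ← h]
    simp only [← mul_assoc]
    rw [← Finset.sum_mul, hD, one_mul]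
  refine ⟨Ω, ⟨⟨?_, ?_⟩, ?_⟩, h1⟩
  · rw [← hD r, Finset.mul_sum]
    simp only [← mul_assoc, h2]
  · rw [← hB r]
    conv_lhs => rw [show star Ω = ∑ k, G.comul (U r k) * star (legProd U r k) by
      simp [Ω, star_sum]]
    rw [Finset.mul_sum]
    simp only [← mul_assoc, h1]
  · have e : ∀ i j, leg₂₃ Q Q Q Ω * idTensor Q G.comul Ω * idTensor Q G.comul (G.comul (U i j)) =
        leg₁₂ Q Q Q Ω * tensorId G.comul Q Ω * idTensor Q G.comul (G.comul (U i j)) := by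
      intro i j
      rw [mul_assoc, ← map_mul, h1, idTensor_legProd, Finset.mul_sum, ← G.coassoc, mul_assoc,
        ← map_mul, h1, tensorId_legProd, Finset.mul_sum]
      simp only [← mul_assoc]
      simp only [← (commute_leg₁_leg₂₃ _ Ω).eq, ← map_mul, h1]
      simp only [mul_assoc, ← map_mul, h1]
      exact sum_leg₁_leg₂₃_legProd U i j
    have e2 : ∀ X : MinTensor₃ Q Q Q, X = ∑ k, X * idTensor Q G.comul (G.comul (U r k)) *
        star (idTensor Q G.comul (G.comul (U r k))) := by
      intro X
      have := congrArg (idTensor Q G.comul) (hD r)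
      simp only [map_sum, map_mul, map_star, map_one] at this
      simp only [mul_assoc]
      rw [← Finset.mul_sum, this, mul_one]
    rw [e2 (leg₂₃ Q Q Q Ω * idTensor Q G.comul Ω), e2 (leg₁₂ Q Q Q Ω * tensorId G.comul Q Ω)]
    simp only [e]

end CompactQuantumGroup


/-! ### Matrix coordinates on `B(H) ⊗ A` -/

section Coordinates

variable {H K : Type v} [NormedAddCommGroup H] [InnerProductSpace ℂ H] [FiniteDimensional ℂ H]
  [NormedAddCommGroup K] [InnerProductSpace ℂ K] [FiniteDimensional ℂ K]
variable {ι κ : Type*} [Fintype ι] [DecidableEq ι] [Fintype κ] [DecidableEq κ]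
variable {A B : Type*} [Ring A] [StarRing A] [Algebra ℂ A] [StarModule ℂ A]
  [Ring B] [StarRing B] [Algebra ℂ B] [StarModule ℂ B]

/-- The matrix of an operator in an orthonormal basis. -/
def opMatrix (b : OrthonormalBasis ι ℂ H) : BoundedOp H ≃⋆ₐ[ℂ] Matrix ι ι ℂ :=
  LinearMap.toMatrixOrthonormal b

theorem opMatrix_apply (b : OrthonormalBasis ι ℂ H) (T : BoundedOp H) (i j : ι) :
    opMatrix b T i j = ⟪b i, (toBoundedOp H).symm T (b j)⟫_ℂ :=
  LinearMap.toMatrixOrthonormal_apply_apply b T i j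

theorem posSemidef_opMatrix_iff (b : OrthonormalBasis ι ℂ H) (T : BoundedOp H) :
    (opMatrix b T).PosSemidef ↔ ((toBoundedOp H).symm T).IsPositive :=
  LinearMap.posSemidef_toMatrix_iff b

variable (A) in
/-- The matrix with entries in `A` of an element of `B(H) ⊗ A`. -/
def coord (b : OrthonormalBasis ι ℂ H) : BoundedOp H ⊗[ℂ] A ≃ₐ[ℂ] Matrix ι ι A :=
  ((Algebra.TensorProduct.congr (opMatrix b).toAlgEquiv AlgEquiv.refl).trans
    (Algebra.TensorProduct.comm ℂ (Matrix ι ι ℂ) A)).trans (matrixEquivTensor ι ℂ A).symm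

theorem coord_tmul (b : OrthonormalBasis ι ℂ H) (T : BoundedOp H) (a : A) (i j : ι) :
    coord A b (T ⊗ₜ a) i j = opMatrix b T i j • a := by
  have : coord A b (T ⊗ₜ a) = a • (opMatrix b T).map (algebraMap ℂ A) := rfl
  rw [this, Matrix.smul_apply, Matrix.map_apply, smul_eq_mul, ← Algebra.commutes,
    Algebra.smul_def]

theorem coord_tmul_one (b : OrthonormalBasis ι ℂ H) (T : BoundedOp H) :
    coord A b (T ⊗ₜ 1) = scal ι A (opMatrix b T) := by
  ext i j
  rw [coord_tmul, scal_apply, Algebra.algebraMap_eq_smul_one]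

theorem coord_star (b : OrthonormalBasis ι ℂ H) (x : BoundedOp H ⊗[ℂ] A) :
    coord A b (star x) = star (coord A b x) := by
  induction x using TensorProduct.induction_on with
  | zero => simp only [star_zero, map_zero]
  | add x y hx hy => rw [star_add, map_add, hx, hy, map_add, star_add]
  | tmul T a =>
    ext i j
    rw [TensorProduct.star_tmul, coord_tmul, Matrix.star_apply, coord_tmul, star_smul, map_star,
      Matrix.star_apply]

theorem coord_mem_unitary_iff (b : OrthonormalBasis ι ℂ H) (x : BoundedOp H ⊗[ℂ] A) :
    coord A b x ∈ unitary (Matrix ι ι A) ↔ x ∈ unitary (BoundedOp H ⊗[ℂ] A) := by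
  simp only [Unitary.mem_iff, ← coord_star, ← map_mul, EmbeddingLike.map_eq_one_iff]

theorem coord_lTensor (b : OrthonormalBasis ι ℂ H) (g : A →ₗ[ℂ] B) (x : BoundedOp H ⊗[ℂ] A)
    (i j : ι) : coord B b (LinearMap.lTensor (BoundedOp H) g x) i j = g (coord A b x i j) := by
  induction x using TensorProduct.induction_on with
  | zero => simp only [map_zero, Matrix.zero_apply]
  | add x y hx hy => simp only [map_add, Matrix.add_apply, hx, hy]
  | tmul T a => rw [LinearMap.lTensor_tmul, coord_tmul, coord_tmul, map_smul]

theorem coord_idAmp (b : OrthonormalBasis ι ℂ H) (f : A →⋆ₐ[ℂ] B) (x : BoundedOp H ⊗[ℂ] A) :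
    coord B b (idAmp f x) = amp ι f (coord A b x) := by
  ext i j
  exact coord_lTensor b f.toAlgHom.toLinearMap x i j

theorem coord_map_opLeft (b : OrthonormalBasis ι ℂ H) (c : OrthonormalBasis κ ℂ K)
    (x : BoundedOp H ⊗[ℂ] A) :
    coord A (b.tensorProduct c) (Algebra.TensorProduct.map (opLeft H K) (AlgHom.id ℂ A) x) =
      kronLeft ι κ A (coord A b x) := by
  induction x using TensorProduct.induction_on with
  | zero => simp only [map_zero]
  | add x y hx hy => simp only [map_add, hx, hy]
  | tmul T a =>
    ext ⟨i, k⟩ ⟨j, l⟩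
    rw [Algebra.TensorProduct.map_tmul, coord_tmul, kronLeft_apply, coord_tmul, opMatrix_apply,
      opMatrix_apply, OrthonormalBasis.tensorProduct_apply, OrthonormalBasis.tensorProduct_apply]
    have : (toBoundedOp (H ⊗[ℂ] K)).symm (opLeft H K T) (b j ⊗ₜ c l) =
      (toBoundedOp H).symm T (b j) ⊗ₜ c l := rfl
    rw [this, TensorProduct.inner_tmul, c.inner_eq_ite]
    split_ifs <;> simp

theorem coord_map_opRight (b : OrthonormalBasis ι ℂ H) (c : OrthonormalBasis κ ℂ K)
    (x : BoundedOp K ⊗[ℂ] A) :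
    coord A (b.tensorProduct c) (Algebra.TensorProduct.map (opRight H K) (AlgHom.id ℂ A) x) =
      kronRight ι κ A (coord A c x) := by
  induction x using TensorProduct.induction_on with
  | zero => simp only [map_zero]
  | add x y hx hy => simp only [map_add, hx, hy]
  | tmul T a =>
    ext ⟨i, k⟩ ⟨j, l⟩
    rw [Algebra.TensorProduct.map_tmul, coord_tmul, kronRight_apply, coord_tmul, opMatrix_apply,
      opMatrix_apply, OrthonormalBasis.tensorProduct_apply, OrthonormalBasis.tensorProduct_apply]
    have : (toBoundedOp (H ⊗[ℂ] K)).symm (opRight H K T) (b j ⊗ₜ c l) =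
      b j ⊗ₜ (toBoundedOp K).symm T (c l) := rfl
    rw [this, TensorProduct.inner_tmul, b.inner_eq_ite]
    split_ifs <;> simp

/-- The conjugate of an orthonormal basis. -/
def conjBasis (b : OrthonormalBasis ι ℂ H) : OrthonormalBasis ι ℂ (Conj H) :=
  OrthonormalBasis.mk (v := fun i => Conj.bar (b i))
    (by
      rw [orthonormal_iff_ite]
      intro i j
      rw [Conj.inner_bar, b.inner_eq_ite]
      simp only [eq_comm])
    (by
      intro x _
      have hx := congrArg Conj.bar (b.sum_repr' (Conj.unbar x))
      have hsum : x = ∑ i, ⟪Conj.unbar x, b i⟫_ℂ • Conj.bar (b i) := by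
        have e := map_sum (Conj.barₛₗ (H := H)) (fun i => ⟪b i, Conj.unbar x⟫_ℂ • b i) Finset.univ
        simp only [map_smulₛₗ, inner_conj_symm] at e
        exact hx.symm.trans e
      rw [hsum]
      exact Submodule.sum_mem _ fun i _ => Submodule.smul_mem _ _ (Submodule.subset_span ⟨i, rfl⟩))

theorem conjBasis_apply (b : OrthonormalBasis ι ℂ H) (i : ι) : conjBasis b i = Conj.bar (b i) := by
  rw [conjBasis, OrthonormalBasis.coe_mk]

variable {Q : Type u} [CStarAlgebra Q]

/-- In the conjugate basis j is transposition; composed with the adjoint it leaves the positions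
alone and stars each entry. -/
theorem coord_conjugate (b : OrthonormalBasis ι ℂ H) (U : BoundedOp H ⊗[ℂ] Q) :
    coord Q (conjBasis b) (conjugate U) = (coord Q b U).map star := by
  rw [conjugate]
  induction U using TensorProduct.induction_on with
  | zero => ext; simp
  | add x y hx hy =>
    rw [star_add, map_add, map_add, hx, hy, map_add]
    ext; simp
  | tmul T a =>
    ext i j
    rw [TensorProduct.star_tmul, LinearMap.rTensor_tmul, coord_tmul, Matrix.map_apply, coord_tmul,
      star_smul, opMatrix_apply, opMatrix_apply, conjBasis_apply, conjBasis_apply]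
    have : (toBoundedOp (Conj H)).symm (conjOp (star T)) (Conj.bar (b j)) =
        Conj.bar ((toBoundedOp H).symm T (b j)) :=
      congrArg (fun S : Module.End ℂ H => Conj.bar (S (b j))) (LinearMap.adjoint_adjoint _)
    rw [this, Conj.inner_bar, ← inner_conj_symm]
    rfl

theorem coord_tensorCorep (b : OrthonormalBasis ι ℂ H) (c : OrthonormalBasis κ ℂ K)
    (U : BoundedOp H ⊗[ℂ] Q) (V : BoundedOp K ⊗[ℂ] Q) :
    coord Q (b.tensorProduct c) (tensorCorep U V) =
      kronLeft ι κ Q (coord Q b U) * kronRight ι κ Q (coord Q c V) := by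
  rw [tensorCorep, map_mul, coord_map_opLeft, coord_map_opRight]

theorem coord_conjBy (b : OrthonormalBasis ι ℂ H) (s : (BoundedOp H)ˣ) (U : BoundedOp H ⊗[ℂ] Q) :
    coord Q b (conjBy s U) = scal ι Q (opMatrix b s) * coord Q b U *
      scal ι Q (opMatrix b (s⁻¹ : (BoundedOp H)ˣ)) := by
  rw [conjBy, map_mul, map_mul, coord_tmul_one, coord_tmul_one]

theorem tensorCorep_mem_unitary {U : BoundedOp H ⊗[ℂ] Q} {V : BoundedOp K ⊗[ℂ] Q}
    (hU : U ∈ unitary (BoundedOp H ⊗[ℂ] Q)) (hV : V ∈ unitary (BoundedOp K ⊗[ℂ] Q)) :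
    tensorCorep U V ∈ unitary (BoundedOp (H ⊗[ℂ] K) ⊗[ℂ] Q) := by
  let b := stdOrthonormalBasis ℂ H
  let c := stdOrthonormalBasis ℂ K
  rw [← coord_mem_unitary_iff b] at hU
  rw [← coord_mem_unitary_iff c] at hV
  rw [← coord_mem_unitary_iff (b.tensorProduct c), coord_tensorCorep]
  refine mul_mem ⟨?_, ?_⟩ ⟨?_, ?_⟩
  · rw [← map_star, ← map_mul, hU.1, map_one]
  · rw [← map_star, ← map_mul, hU.2, map_one]
  · rw [← map_star, ← map_mul, hV.1, map_one]
  · rw [← map_star, ← map_mul, hV.2, map_one]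

theorem isUnit_tensorCorep {U : BoundedOp H ⊗[ℂ] Q} {V : BoundedOp K ⊗[ℂ] Q}
    (hU : IsUnit U) (hV : IsUnit V) : IsUnit (tensorCorep U V) :=
  (hU.map _).mul (hV.map _)

theorem isUnit_of_conjBy {s : (BoundedOp H)ˣ} {U : BoundedOp H ⊗[ℂ] Q}
    (hU : IsUnit (conjBy s U)) : IsUnit U := by
  have h1 : IsUnit ((s : BoundedOp H) ⊗ₜ[ℂ] (1 : Q)) :=
    s.isUnit.map (Algebra.TensorProduct.includeLeft : BoundedOp H →ₐ[ℂ] BoundedOp H ⊗[ℂ] Q)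
  have h2 : IsUnit (((s⁻¹ : (BoundedOp H)ˣ) : BoundedOp H) ⊗ₜ[ℂ] (1 : Q)) :=
    s⁻¹.isUnit.map (Algebra.TensorProduct.includeLeft : BoundedOp H →ₐ[ℂ] BoundedOp H ⊗[ℂ] Q)
  obtain ⟨x, hx⟩ := h1
  obtain ⟨y, hy⟩ := h2
  rwa [conjBy, ← hx, ← hy, Units.isUnit_mul_units, Units.isUnit_units_mul] at hU

namespace CompactQuantumGroup

variable {G : CompactQuantumGroup Q}

theorem isCorep_iff (b : OrthonormalBasis ι ℂ H) (U : BoundedOp H ⊗[ℂ] Q) :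
    G.IsCorep U ↔ G.IsCorepMatrix (coord Q b U) := by
  rw [IsCorep, IsCorepMatrix, ← (coord (MinTensor Q Q) b).injective.eq_iff, map_mul, U₁₂, U₁₃,
    coord_idAmp, coord_idAmp, coord_idAmp]

theorem coord_legs (b : OrthonormalBasis ι ℂ H) (U : BoundedOp H ⊗[ℂ] Q) :
    coord (MinTensor Q Q) b (U₁₂ U * U₁₃ U) = legProd (coord Q b U) := by
  rw [map_mul, U₁₂, U₁₃, coord_idAmp, coord_idAmp]
  rfl

/-- The algebraic half of part (a): the cocycle encodes the corepresentation identity alone.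
Unitarity and invertibility are obtained separately from the Haar state. -/
theorem isRightProjective_iff {U : BoundedOp H ⊗[ℂ] Q} (hU : U ∈ unitary (BoundedOp H ⊗[ℂ] Q)) :
    G.IsRightProjective U ↔ G.IsCorep (tensorCorep U (conjugate U)) := by
  let b := stdOrthonormalBasis ℂ H
  rw [isCorep_iff (b.tensorProduct (conjBasis b)), coord_tensorCorep, coord_conjugate,
    ← exists_rightCocycle_iff ((coord_mem_unitary_iff b U).2 hU), IsRightProjective]
  refine (and_iff_right hU).trans (exists_congr fun Ω => and_congr_right fun _ => ?_)
  rw [← (coord (MinTensor Q Q) b).injective.eq_iff, coord_legs, ← Matrix.ext_iff]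
  refine forall_congr' fun i => forall_congr' fun j => ?_
  rw [coord_lTensor]
  rfl

theorem isLeftProjective_iff {U : BoundedOp H ⊗[ℂ] Q} (hU : U ∈ unitary (BoundedOp H ⊗[ℂ] Q)) :
    G.IsLeftProjective U ↔ G.IsCorep (tensorCorep (conjugate U) U) := by
  let b := stdOrthonormalBasis ℂ H
  rw [isCorep_iff ((conjBasis b).tensorProduct b), coord_tensorCorep, coord_conjugate,
    ← exists_leftCocycle_iff ((coord_mem_unitary_iff b U).2 hU), IsLeftProjective]
  refine (and_iff_right hU).trans (exists_congr fun Ω => and_congr_right fun _ => ?_)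
  rw [← (coord (MinTensor Q Q) b).injective.eq_iff, coord_legs, ← Matrix.ext_iff]
  refine forall_congr' fun i => forall_congr' fun j => ?_
  rw [coord_lTensor]
  rfl

/-- The scalar 1 ⊗ s commutes past U₁₃, so the change amounts to conjugating the whole tensor
product by an invertible scalar matrix. -/
theorem isCorep_tensorCorep_conjBy_right (s : (BoundedOp K)ˣ) (U : BoundedOp H ⊗[ℂ] Q)
    (V : BoundedOp K ⊗[ℂ] Q) :
    G.IsCorep (tensorCorep U (conjBy s V)) ↔ G.IsCorep (tensorCorep U V) := by
  let b := stdOrthonormalBasis ℂ H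
  let c := stdOrthonormalBasis ℂ K
  rw [isCorep_iff (b.tensorProduct c), isCorep_iff (b.tensorProduct c), coord_tensorCorep,
    coord_tensorCorep, coord_conjBy, map_mul, map_mul, ← mul_assoc, ← mul_assoc,
    commute_kronLeft_scal, kronRight_scal, kronRight_scal, mul_assoc (scal _ Q _)]
  refine IsCorepMatrix.conj_iff ?_ ?_
  · rw [← map_mul, ← map_mul, s.inv_mul, map_one, map_one]
  · rw [← map_mul, ← map_mul, s.mul_inv, map_one, map_one]

theorem isCorep_tensorCorep_conjBy_left (s : (BoundedOp K)ˣ) (U : BoundedOp H ⊗[ℂ] Q)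
    (V : BoundedOp K ⊗[ℂ] Q) :
    G.IsCorep (tensorCorep (conjBy s V) U) ↔ G.IsCorep (tensorCorep V U) := by
  let b := stdOrthonormalBasis ℂ H
  let c := stdOrthonormalBasis ℂ K
  rw [isCorep_iff (c.tensorProduct b), isCorep_iff (c.tensorProduct b), coord_tensorCorep,
    coord_tensorCorep, coord_conjBy, map_mul, map_mul, mul_assoc, commute_kronRight_scal,
    ← mul_assoc, mul_assoc (kronLeft _ _ Q (scal _ Q _)), kronLeft_scal, kronLeft_scal]
  refine IsCorepMatrix.conj_iff ?_ ?_
  · rw [← map_mul, ← map_mul, s.inv_mul, map_one, map_one]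
  · rw [← map_mul, ← map_mul, s.mul_inv, map_one, map_one]

theorem _root_.CQG.exists_isPosSqrt_of_matrix (b : OrthonormalBasis ι ℂ H)
    (V : BoundedOp H ⊗[ℂ] Q)
    (h : ∃ s t : Matrix ι ι ℂ, s.PosSemidef ∧ s * t = 1 ∧ t * s = 1 ∧
      scal ι Q s * coord Q b V * scal ι Q t ∈ unitary (Matrix ι ι Q)) :
    ∃ ρ s : (BoundedOp H)ˣ, IsPosSqrt s ρ ∧ conjBy s V ∈ unitary (BoundedOp H ⊗[ℂ] Q) := by
  obtain ⟨s, t, hs, hst, hts, hu⟩ := h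
  let σ : (BoundedOp H)ˣ := ⟨(opMatrix b).symm s, (opMatrix b).symm t,
    by rw [← map_mul, hst, map_one], by rw [← map_mul, hts, map_one]⟩
  have hσ : opMatrix b σ = s := (opMatrix b).apply_symm_apply s
  have hσ' : opMatrix b (σ⁻¹ : (BoundedOp H)ˣ) = t := (opMatrix b).apply_symm_apply t
  -- The matrix argument delivers the positive square root; ρ is defined as its square.
  refine ⟨σ * σ, σ, ⟨?_, ?_, rfl⟩, ?_⟩
  · rw [← posSemidef_opMatrix_iff b, Units.val_mul, map_mul, hσ]
    nth_rw 1 [← hs.isHermitian.eq]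
    exact Matrix.posSemidef_conjTranspose_mul_self s
  · rwa [← posSemidef_opMatrix_iff b, hσ]
  · rwa [← coord_mem_unitary_iff b, coord_conjBy, hσ, hσ']

theorem exists_unitary_conjBy_right {U : BoundedOp H ⊗[ℂ] Q}
    (hU : U ∈ unitary (BoundedOp H ⊗[ℂ] Q))
    (hW : G.IsCorep (tensorCorep U (conjugate U))) :
    ∃ ρ s : (BoundedOp (Conj H))ˣ, IsPosSqrt s ρ ∧
      conjBy s (conjugate U) ∈ unitary (BoundedOp (Conj H) ⊗[ℂ] Q) := by
  let b := stdOrthonormalBasis ℂ H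
  refine exists_isPosSqrt_of_matrix (conjBasis b) _ ?_
  rw [isCorep_iff (b.tensorProduct (conjBasis b)), coord_tensorCorep, coord_conjugate] at hW
  rw [coord_conjugate]
  exact exists_unitary_conj_right ((coord_mem_unitary_iff b U).2 hU) hW

theorem exists_unitary_conjBy_left {U : BoundedOp H ⊗[ℂ] Q}
    (hU : U ∈ unitary (BoundedOp H ⊗[ℂ] Q))
    (hW : G.IsCorep (tensorCorep (conjugate U) U)) :
    ∃ ρ s : (BoundedOp (Conj H))ˣ, IsPosSqrt s ρ ∧
      conjBy s (conjugate U) ∈ unitary (BoundedOp (Conj H) ⊗[ℂ] Q) := by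
  let b := stdOrthonormalBasis ℂ H
  refine exists_isPosSqrt_of_matrix (conjBasis b) _ ?_
  rw [isCorep_iff ((conjBasis b).tensorProduct b), coord_tensorCorep, coord_conjugate] at hW
  rw [coord_conjugate]
  exact exists_unitary_conj_left ((coord_mem_unitary_iff b U).2 hU) hW

end CompactQuantumGroup

end Coordinates

theorem isUnit_of_mem_unitary {R : Type*} [Ring R] [StarRing R] {x : R} (hx : x ∈ unitary R) :
    IsUnit x :=
  ⟨⟨x, star x, hx.2, hx.1⟩, rfl⟩

end CQG

end

/-! ### The three equivalences. -/

theorem mainTheorem3 {Q : Type*} [CStarAlgebra Q] (G : CQG.CompactQuantumGroup Q)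
    {H : Type*} [NormedAddCommGroup H] [InnerProductSpace ℂ H] [FiniteDimensional ℂ H]
    (U : CQG.BoundedOp H ⊗[ℂ] Q) (hU : U ∈ unitary (CQG.BoundedOp H ⊗[ℂ] Q)) :
    List.TFAE
      [G.IsRightProjective U,
        ∃ ρ s : (CQG.BoundedOp (CQG.Conj H))ˣ, CQG.IsPosSqrt s ρ ∧
          G.IsUnitaryCorep (CQG.tensorCorep U (CQG.conjBy s (CQG.conjugate U))),
        G.IsInvertibleCorep (CQG.tensorCorep U (CQG.conjugate U))] ∧
    List.TFAE
      [G.IsLeftProjective U,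
        ∃ ρ s : (CQG.BoundedOp (CQG.Conj H))ˣ, CQG.IsPosSqrt s ρ ∧
          G.IsUnitaryCorep (CQG.tensorCorep (CQG.conjBy s (CQG.conjugate U)) U),
        G.IsInvertibleCorep (CQG.tensorCorep (CQG.conjugate U) U)] ∧
    List.TFAE
      [G.IsBiProjective U,
        ∃ ρ s : (CQG.BoundedOp (CQG.Conj H))ˣ, CQG.IsPosSqrt s ρ ∧
          G.IsUnitaryCorep (CQG.tensorCorep (CQG.conjBy s (CQG.conjugate U)) U) ∧
          G.IsUnitaryCorep (CQG.tensorCorep U (CQG.conjBy s (CQG.conjugate U))),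
        G.IsInvertibleCorep (CQG.tensorCorep U (CQG.conjugate U)) ∧
          G.IsInvertibleCorep (CQG.tensorCorep (CQG.conjugate U) U)] := by
  have hR := G.isRightProjective_iff hU
  have hL := G.isLeftProjective_iff hU
  have hu := CQG.isUnit_of_mem_unitary hU
  have hRs := fun s => G.isCorep_tensorCorep_conjBy_right s U (CQG.conjugate U)
  have hLs := fun s => G.isCorep_tensorCorep_conjBy_left s U (CQG.conjugate U)
  refine ⟨?_, ?_, ?_⟩
  · tfae_have 1 → 2 := fun h => by
      obtain ⟨ρ, s, hs, hc⟩ := G.exists_unitary_conjBy_right hU (hR.1 h)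
      exact ⟨ρ, s, hs, CQG.tensorCorep_mem_unitary hU hc, (hRs s).2 (hR.1 h)⟩
    tfae_have 2 → 1 := fun ⟨_, s, _, h⟩ => hR.2 ((hRs s).1 h.2)
    tfae_have 1 → 3 := fun h => by
      obtain ⟨ρ, s, hs, hc⟩ := G.exists_unitary_conjBy_right hU (hR.1 h)
      -- U^c is similar to the unitary U^c_ρ, hence invertible, and so is its product with U.
      have hv := CQG.isUnit_of_conjBy (CQG.isUnit_of_mem_unitary hc)
      exact ⟨CQG.isUnit_tensorCorep hu hv, hR.1 h⟩
    tfae_have 3 → 1 := fun h => hR.2 h.2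
    tfae_finish
  · tfae_have 1 → 2 := fun h => by
      obtain ⟨ρ, s, hs, hc⟩ := G.exists_unitary_conjBy_left hU (hL.1 h)
      exact ⟨ρ, s, hs, CQG.tensorCorep_mem_unitary hc hU, (hLs s).2 (hL.1 h)⟩
    tfae_have 2 → 1 := fun ⟨_, s, _, h⟩ => hL.2 ((hLs s).1 h.2)
    tfae_have 1 → 3 := fun h => by
      obtain ⟨ρ, s, hs, hc⟩ := G.exists_unitary_conjBy_left hU (hL.1 h)
      have hv := CQG.isUnit_of_conjBy (CQG.isUnit_of_mem_unitary hc)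
      exact ⟨CQG.isUnit_tensorCorep hv hu, hL.1 h⟩
    tfae_have 3 → 1 := fun h => hL.2 h.2
    tfae_finish
  · tfae_have 1 → 2 := fun h => by
      -- The ρ found on the right also works on the left: unitarity of U^c_ρ makes both tensor
      -- products unitary, and neither corepresentation identity depends on s.
      obtain ⟨ρ, s, hs, hc⟩ := G.exists_unitary_conjBy_right hU (hR.1 h.2)
      exact ⟨ρ, s, hs, ⟨CQG.tensorCorep_mem_unitary hc hU, (hLs s).2 (hL.1 h.1)⟩,
        CQG.tensorCorep_mem_unitary hU hc, (hRs s).2 (hR.1 h.2)⟩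
    tfae_have 2 → 1 := fun ⟨_, s, _, h, h'⟩ => ⟨hL.2 ((hLs s).1 h.2), hR.2 ((hRs s).1 h'.2)⟩
    tfae_have 1 → 3 := fun h => by
      obtain ⟨ρ, s, hs, hc⟩ := G.exists_unitary_conjBy_right hU (hR.1 h.2)
      have hv := CQG.isUnit_of_conjBy (CQG.isUnit_of_mem_unitary hc)
      exact ⟨⟨CQG.isUnit_tensorCorep hu hv, hR.1 h.2⟩, CQG.isUnit_tensorCorep hv hu, hL.1 h.1⟩
    tfae_have 3 → 1 := fun h => ⟨hL.2 h.2.2, hR.2 h.1.2⟩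
    tfae_finish
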